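/- Metrize $\mathbf{RP}^2$ by the angle in $[0,\pi/2]$ between lines of $\mathbf R^3$, and let the height of a rational point be $\max(|x|,|y|,|z|)$ for coprime integral homogeneous coordinates $(x:y:z)$. Let $\phi:[0,1]\to\mathbf{RP}^2$ be a differentiable map with bounded second derivatives, with image $C$; that is, $\phi(t)=(F(t))$ for a twice differentiable $F:[0,1]\to\mathbf R^3\setminus\{0\}$ such that $\|F\|$, $1/\|F\|$, $\|F'\|$, $\|F''\|$ are bounded by some natural number $B$. Assume that a number within $2^{-p}$ of any coordinate of $F$ or $F'$ at a dyadic parameter $t=j/2^p\in[0,1]$ can be computed in time and space at most $B(p+1)^e$; the real inputs $N$ and $\min(\delta,2)$ below are presented in the same way, by approximations on request (all distances in $\mathbf{RP}^2$ being less than $2$). Computations are carried out by programs over finitely many integer registers (addition, subtraction, multiplication, division with remainder, sign tests, loops, requests for approximations, and writing of records on a write-only output), with time and space measured in binary digits. There are a single program, a computable function $K(B,e)$ and a computable function $k(e)$ such that for all such $B$, $e$, $\phi$ and all real $N>1$ and $\delta\ge N^{-2}$ the following holds, with $K=K(B,e)$ and $k=k(e)$. The program (given $B$ and the approximations above) halts,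 and its output is a list of at most $K\delta N^3$ rational points, given by integral homogeneous coordinates, and at most $KN$ line segments with rational endpoints (possibly degenerate to points), each of length at most $K/N$, which together contain every rational point of height $\le N$ at distance $\le\delta$ from $C$. It runs in time at most $K\,\delta N^3(1+\log N)^k$ and in working space at most $K(1+\log N)^k$, not counting the output, and the whole output takes at most $K\,\delta N^3(1+\log N)$ binary digits to record. -/

import Mathlib

open LinearAlgebra.Projectivization

namespace NearCurve

/-! ### The real projective plane, distances, segments, rational points -/

/-- Euclidean three-space, the space of homogeneous coordinate vectors. -/
abbrev E3 : Type := EuclideanSpace ℝ (Fin 3)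

/-- The real projective plane. -/
abbrev RP2 : Type := ℙ ℝ E3

/-- The rational projective plane. -/
abbrev QP2 : Type := ℙ ℚ (Fin 3 → ℚ)

/-- The coordinatewise inclusion of rational vectors in real vectors. -/
noncomputable def ratVec : (Fin 3 → ℚ) →ₛₗ[algebraMap ℚ ℝ] E3 where
  toFun v := WithLp.toLp 2 fun i => (v i : ℝ)
  map_add' v w := by ext i; simp
  map_smul' c v := by ext i; simp

theorem ratVec_injective : Function.Injective ratVec := by
  intro v w h
  funext i
  have h1 := congrArg (fun x : E3 => x i) h
  simpa [ratVec] using h1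

/-- A rational point, seen as a point of the real projective plane. -/
noncomputable def toReal : QP2 → RP2 := Projectivization.map ratVec ratVec_injective

/-- An integer vector as a real vector. -/
noncomputable def intVec (v : Fin 3 → ℤ) : E3 := WithLp.toLp 2 fun i => (v i : ℝ)

/-- The standard (round, or Fubini-Study) distance on the projective plane: the angle, in
`[0, π/2]`, between the two lines through the origin. -/
noncomputable def projDist (p q : RP2) : ℝ :=
  Real.arccos (|inner ℝ p.rep q.rep| / (‖p.rep‖ * ‖q.rep‖))

/-- The distance does not depend on the choice of homogeneous coordinates. -/
theorem projDist_mk (u v : E3) (hu : u ≠ 0) (hv : v ≠ 0) :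
    projDist (Projectivization.mk ℝ u hu) (Projectivization.mk ℝ v hv) =
      Real.arccos (|inner ℝ u v| / (‖u‖ * ‖v‖)) := by
  obtain ⟨a, ha⟩ := Projectivization.exists_smul_eq_mk_rep ℝ u hu
  obtain ⟨b, hb⟩ := Projectivization.exists_smul_eq_mk_rep ℝ v hv
  unfold projDist
  rw [← ha, ← hb]
  congr 1
  have h1 : |(a : ℝ)| ≠ 0 := abs_ne_zero.mpr a.ne_zero
  have h2 : |(b : ℝ)| ≠ 0 := abs_ne_zero.mpr b.ne_zero
  have h3 : ‖u‖ ≠ 0 := norm_ne_zero_iff.mpr hu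
  have h4 : ‖v‖ ≠ 0 := norm_ne_zero_iff.mpr hv
  simp only [Units.smul_def, inner_smul_left, inner_smul_right, norm_smul, Real.norm_eq_abs,
    abs_mul, RCLike.conj_to_real]
  field_simp

/-- The projective line segment with ends `(u)` and `(v)` that consists of the points `(a u + b v)`
with `a, b ≥ 0`.  Its length in the metric `projDist` is the angle between the vectors `u` and `v`
(it shrinks to a point when `u` and `v` are proportional). -/
noncomputable def projSegment (u v : E3) : Set RP2 :=
  {p | ∃ a b : ℝ, 0 ≤ a ∧ 0 ≤ b ∧ ∃ h : a • u + b • v ≠ 0,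
    p = Projectivization.mk ℝ (a • u + b • v) h}

/-- `F` is a lift to homogeneous coordinates of the map `φ` from `[0,1]` to the projective plane,
twice differentiable on `[0,1]` with derivatives `dF` and `ddF`, where the natural number `B`
bounds `‖F‖`, `1/‖F‖`, `‖dF‖` and `‖ddF‖`.
A map from `[0,1]` to the projective plane is differentiable with bounded second derivatives exactly
if it has such a lift for some `B`. -/
structure BoundedLift (φ : unitInterval → RP2) (F dF ddF : ℝ → E3) (B : ℕ) : Prop where
  ne_zero : ∀ t : unitInterval, F t ≠ 0
  lift : ∀ t : unitInterval, φ t = Projectivization.mk ℝ (F t) (ne_zero t)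
  hasDeriv : ∀ t ∈ Set.Icc (0 : ℝ) 1, HasDerivWithinAt F (dF t) (Set.Icc 0 1) t
  hasSecondDeriv : ∀ t ∈ Set.Icc (0 : ℝ) 1, HasDerivWithinAt dF (ddF t) (Set.Icc 0 1) t
  norm_le : ∀ t ∈ Set.Icc (0 : ℝ) 1, ‖F t‖ ≤ B
  le_norm : ∀ t ∈ Set.Icc (0 : ℝ) 1, 1 ≤ B * ‖F t‖
  norm_deriv_le : ∀ t ∈ Set.Icc (0 : ℝ) 1, ‖dF t‖ ≤ B
  norm_secondDeriv_le : ∀ t ∈ Set.Icc (0 : ℝ) 1, ‖ddF t‖ ≤ B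

/-! ### Real data of a computation -/

/-- The real quantities a program may ask for: coordinates of the curve and of its derivative at a
dyadic parameter, the height bound, and the distance bound. -/
inductive Quantity where
  | curve (i : Fin 3)
  | deriv (i : Fin 3)
  | heightBound
  | distBound

/-- Answers to the questions for approximations: quantity, precision, numerator of the parameter. -/
abbrev Answers : Type := Quantity → ℕ → ℤ → ℤ

/-- The answer `a` to a question with precision `p` is within `1` of `2 ^ p` times the true value,
that is, `a / 2 ^ p` is within `2 ^ (-p)` of it.  The parameter is `t = j / 2 ^ p`, and nothing is
promised for parameters outside `[0,1]`.  Since all distances in the projective plane are less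
than `2`, a distance bound `δ > 2` is presented as `2`. -/
structure Answers.Correct (A : Answers) (F dF : ℝ → E3) (N δ : ℝ) : Prop where
  curve : ∀ (i : Fin 3) (p : ℕ) (j : ℤ), 0 ≤ j → j ≤ 2 ^ p →
    |(A (.curve i) p j : ℝ) - 2 ^ p * F (j / 2 ^ p) i| ≤ 1
  deriv : ∀ (i : Fin 3) (p : ℕ) (j : ℤ), 0 ≤ j → j ≤ 2 ^ p →
    |(A (.deriv i) p j : ℝ) - 2 ^ p * dF (j / 2 ^ p) i| ≤ 1
  heightBound : ∀ (p : ℕ) (j : ℤ), |(A .heightBound p j : ℝ) - 2 ^ p * N| ≤ 1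
  distBound : ∀ (p : ℕ) (j : ℤ), |(A .distBound p j : ℝ) - 2 ^ p * min δ 2| ≤ 1

/-! ### Programs over integer registers, with bit costs -/

/-- The number of binary digits of an integer. -/
def intBits (z : ℤ) : ℕ := z.natAbs.size

/-- The contents of the registers, which are numbered by the natural numbers; all but finitely many
registers hold `0`. -/
abbrev Store : Type := ℕ →₀ ℤ

/-- The memory in use: the number of binary digits of the contents of all registers. -/
noncomputable def Store.space (σ : Store) : ℕ := σ.sum fun _ z => intBits z

inductive Op where
  | add | sub | mul | div

def Op.apply : Op → ℤ → ℤ → ℤ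
  | .add, a, b => a + b
  | .sub, a, b => a - b
  | .mul, a, b => a * b
  | .div, a, b => a / b

/-- A record on the write-only output: a point, given by integral homogeneous coordinates,
or a segment, given by integral vectors at its two ends. -/
inductive Record where
  | point (v : Fin 3 → ℤ)
  | segment (u v : Fin 3 → ℤ)

def Record.isPoint : Record → Bool
  | .point _ => true
  | .segment _ _ => false

def Record.isSegment : Record → Bool
  | .point _ => false
  | .segment _ _ => true

/-- All coordinate vectors of the record are nonzero, so that they represent rational points. -/
def Record.Valid : Record → Prop
  | .point v => v ≠ 0
  | .segment u v => u ≠ 0 ∧ v ≠ 0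

/-- The set of points of the projective plane that the record describes. -/
noncomputable def Record.carrier : Record → Set RP2
  | .point v => {p | ∃ h : intVec v ≠ 0, p = Projectivization.mk ℝ (intVec v) h}
  | .segment u v => projSegment (intVec u) (intVec v)

/-- The length of the segment, and `0` for a point. -/
noncomputable def Record.length : Record → ℝ
  | .point _ => 0
  | .segment u v => InnerProductGeometry.angle (intVec u) (intVec v)

/-- The number of binary symbols that it takes to write the record. -/
def Record.bits : Record → ℕ
  | .point v => 1 + ∑ i, (1 + intBits (v i))
  | .segment u v => 1 + ∑ i, (1 + intBits (u i)) + ∑ i, (1 + intBits (v i))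

/-- Programs over integer registers.  `query r q p j` asks for the quantity `q` with the precision in
register `p`, at the parameter whose numerator is in register `j`, and puts the answer in `r`. -/
inductive Program where
  | const (r : ℕ) (z : ℤ)
  | op (o : Op) (r a b : ℕ)
  | query (r : ℕ) (q : Quantity) (p j : ℕ)
  | emitPoint (r : Fin 3 → ℕ)
  | emitSegment (r s : Fin 3 → ℕ)
  | seq (P Q : Program)
  | ifPos (r : ℕ) (P Q : Program)
  | whilePos (r : ℕ) (P : Program)

/-- `Runs A c P σ τ out time space`: given the answers `A`, where an answer of precision `p` takes
`c p` units of time and of memory to compute, the program `P`, started with register contents `σ`,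
halts with register contents `τ`, after writing the records `out`, in time `time` and with peak
memory `space` (which does not count the output).  Arithmetic is charged as for the schoolbook
algorithms on binary digits. -/
inductive Runs (A : Answers) (c : ℕ → ℕ) :
    Program → Store → Store → List Record → ℕ → ℕ → Prop where
  | const (r : ℕ) (z : ℤ) (σ : Store) :
      Runs A c (.const r z) σ (σ.update r z) [] (1 + intBits z)
        (max σ.space (Store.space (σ.update r z)))
  | op (o : Op) (r a b : ℕ) (σ : Store) :
      Runs A c (.op o r a b) σ (σ.update r (o.apply (σ a) (σ b))) []
        ((1 + intBits (σ a)) * (1 + intBits (σ b)))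
        (max σ.space (Store.space (σ.update r (o.apply (σ a) (σ b)))))
  | query (r : ℕ) (q : Quantity) (p j : ℕ) (σ : Store) :
      Runs A c (.query r q p j) σ (σ.update r (A q (σ p).toNat (σ j))) []
        (1 + (σ p).toNat + intBits (σ j) + intBits (A q (σ p).toNat (σ j)) + c (σ p).toNat)
        (max (σ.space + (σ p).toNat + c (σ p).toNat)
          (Store.space (σ.update r (A q (σ p).toNat (σ j)))))
  | emitPoint (r : Fin 3 → ℕ) (σ : Store) :
      Runs A c (.emitPoint r) σ σ [.point fun i => σ (r i)]
        (Record.bits (.point fun i => σ (r i))) σ.space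
  | emitSegment (r s : Fin 3 → ℕ) (σ : Store) :
      Runs A c (.emitSegment r s) σ σ [.segment (fun i => σ (r i)) fun i => σ (s i)]
        (Record.bits (.segment (fun i => σ (r i)) fun i => σ (s i))) σ.space
  | seq {P Q : Program} {σ τ υ : Store} {out₁ out₂ : List Record} {t₁ t₂ s₁ s₂ : ℕ} :
      Runs A c P σ τ out₁ t₁ s₁ → Runs A c Q τ υ out₂ t₂ s₂ →
      Runs A c (.seq P Q) σ υ (out₁ ++ out₂) (t₁ + t₂) (max s₁ s₂)
  | ifTrue {r : ℕ} {P Q : Program} {σ τ : Store} {out : List Record} {t s : ℕ} :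
      0 < σ r → Runs A c P σ τ out t s → Runs A c (.ifPos r P Q) σ τ out (1 + t) s
  | ifFalse {r : ℕ} {P Q : Program} {σ τ : Store} {out : List Record} {t s : ℕ} :
      σ r ≤ 0 → Runs A c Q σ τ out t s → Runs A c (.ifPos r P Q) σ τ out (1 + t) s
  | whileDone {r : ℕ} {P : Program} {σ : Store} :
      σ r ≤ 0 → Runs A c (.whilePos r P) σ σ [] 1 σ.space
  | whileStep {r : ℕ} {P : Program} {σ τ υ : Store} {out₁ out₂ : List Record} {t₁ t₂ s₁ s₂ : ℕ} :
      0 < σ r → Runs A c P σ τ out₁ t₁ s₁ → Runs A c (.whilePos r P) τ υ out₂ t₂ s₂ →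
      Runs A c (.whilePos r P) σ υ (out₁ ++ out₂) (1 + t₁ + t₂) (max s₁ s₂)

end NearCurve

/-!
The curve is covered by arcs whose parameter intervals have length about `δ + 1 / N`.  On such an
arc the curve departs from its tangent by `O(δ)`, so an integral vector `w` with coordinates at most
`N` that represents a point within `δ` of the arc has the form `α f + β (s / P) g + ε`.  Here `f`
and `g` are integral approximations to `P F` and `P F'` at the start of the arc, with `P = 2 ^ p` of
the order of `N²`, the step of the parameter is `s / P`, and `α`, `β` and `ε` are small
(`exists_arc_decomposition`).  Such vectors lie in a parallelepiped, and the positive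
definite quadratic form `V3.bil`, up to a factor the adjugate of `P² f fᵀ + s² g gᵀ + P² d² I` with
`d ≈ δ P`, is at most a threshold `T` at all of them (`bil_le_threshold`).  This form has integral coefficients, so
that everything is computed in integers of `O(log N)` digits.

For each arc a basis of `ℤ³` is reduced with respect to the form, by lattice reduction in
dimension three.  The product of the first two Gram determinants `D₁`, `D₂` is a positive integer
that drops by the factor `3 / 4` in every exchange, so `O(log N)` rounds are enough
(`ev_reduceLoop`).  Coordinates of short vectors in a reduced basis are bounded by the Gram-Schmidt
lengths (`V3.Reduced.coord_le`), which leaves two cases.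

* If `D₃ ≤ T D₂`, all combinations with coefficients in these bounds are written.  No range of
  coefficients is trivial, so their number `n` is bounded by the volume, `n² D₃ ≤ 4096 T³`
  (`ev_enumerate`), which amounts to `O(N³ δ)` times the length of the arc (`count_le`).  Summed
  over all arcs, there are `O(δ N³)` points (`arcs_mul_arcCount_le`).
* Otherwise the third coordinate of every such vector vanishes: all of them lie in the plane of the
  first two basis vectors (`V3.Reduced.dot_cross_eq_zero`).  The neighbourhood must then be thin,
  as it would contain all unit vectors otherwise (`V3.Reduced.thin`), so the vectors
  have an angle of `O(1 / N)` with `f` (`cone_of_near`).  A single segment of length `O(1 / N)` in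
  this plane contains all the points (`projSegment_contains`, `angle_ends_le`).  There are `O(N)`
  arcs, hence `O(N)` segments (`arcs_le`).

Rational points of height at most `N` have integral coordinates of absolute value at most `N`
(`exists_integral_coordinates`).  The program is written with arithmetic expressions and structured
control flow, and its runs are described by a calculus of total correctness, `Budget.Ev`, which
counts elementary instructions.  The sizes of all numbers are controlled by a tower of bounds `lev`
over the largest parameter `Y`, polynomial in `N`: an expression of bounded size takes values one
level higher.  As there are only seven levels, all registers have `O(log N)` digits, which turns
the number of instructions into the bounds for time and space (`search_spec`).
-/

namespace NearCurve

/-! ### Expressions and structured programs -/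

/-- Arithmetic expressions over registers, compiled below to straight-line programs. -/
inductive Expr where
  | const (z : ℤ)
  | var (r : ℕ)
  | bin (o : Op) (a b : Expr)

namespace Expr

instance : Add Expr := ⟨bin .add⟩
instance : Sub Expr := ⟨bin .sub⟩
instance : Mul Expr := ⟨bin .mul⟩
instance : Div Expr := ⟨bin .div⟩
instance (n : ℕ) : OfNat Expr n := ⟨const n⟩

/-- The value of an expression when register `r` holds `s r`. -/
def eval (s : ℕ → ℤ) : Expr → ℤ
  | const z => z
  | var r => s r
  | bin o a b => o.apply (a.eval s) (b.eval s)

@[simp] theorem eval_const (s : ℕ → ℤ) (z : ℤ) : (const z).eval s = z := rfl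
@[simp] theorem eval_var (s : ℕ → ℤ) (r : ℕ) : (var r).eval s = s r := rfl
@[simp] theorem eval_add (s : ℕ → ℤ) (a b : Expr) : (a + b).eval s = a.eval s + b.eval s := rfl
@[simp] theorem eval_sub (s : ℕ → ℤ) (a b : Expr) : (a - b).eval s = a.eval s - b.eval s := rfl
@[simp] theorem eval_mul (s : ℕ → ℤ) (a b : Expr) : (a * b).eval s = a.eval s * b.eval s := rfl
@[simp] theorem eval_div (s : ℕ → ℤ) (a b : Expr) : (a / b).eval s = a.eval s / b.eval s := rfl
@[simp] theorem eval_ofNat (s : ℕ → ℤ) (n : ℕ) [n.AtLeastTwo] :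
    (no_index (OfNat.ofNat n : Expr)).eval s = OfNat.ofNat n := rfl
@[simp] theorem eval_zero (s : ℕ → ℤ) : (0 : Expr).eval s = 0 := rfl
@[simp] theorem eval_one (s : ℕ → ℤ) : (1 : Expr).eval s = 1 := rfl

/-- A size for which values of expressions are at most the `size`-th power of the largest register
content, and which bounds the number of auxiliary registers. -/
def size : Expr → ℕ
  | const z => z.natAbs.log2 + 1
  | var _ => 1
  | bin _ a b => a.size + b.size + 1

/-- Only registers below `m` are read. -/
def Below (m : ℕ) : Expr → Prop
  | const _ => True
  | var r => r < m
  | bin _ a b => a.Below m ∧ b.Below m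

/-- The side conditions on registers in the program below are closed terms, checked by evaluation.
-/
instance decidableBelow (m : ℕ) : (e : Expr) → Decidable (e.Below m)
  | const _ => .isTrue trivial
  | var r => inferInstanceAs (Decidable (r < m))
  | bin _ a b =>
    have := decidableBelow m a
    have := decidableBelow m b
    inferInstanceAs (Decidable (_ ∧ _))

/-- The program that evaluates an expression into register `t`, using the registers from `t` on as
scratch space. -/
def compile : Expr → ℕ → Program
  | const z, t => .const t z
  | var r, t => .seq (.const t 0) (.op .add t r t)
  | bin o a b, t => .seq (a.compile t) (.seq (b.compile (t + 1)) (.op o t t (t + 1)))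

theorem size_pos (e : Expr) : 1 ≤ e.size := by cases e <;> simp [size]

theorem abs_apply_le (o : Op) {a b : ℤ} {Z m n : ℕ} (hZ : 2 ≤ Z) (hm : 1 ≤ m) (hn : 1 ≤ n)
    (ha : |a| ≤ (Z : ℤ) ^ m) (hb : |b| ≤ (Z : ℤ) ^ n) : |o.apply a b| ≤ (Z : ℤ) ^ (m + n) := by
  have hZ' : (2 : ℤ) ≤ Z := by exact_mod_cast hZ
  have h1 : (2 : ℤ) ≤ (Z : ℤ) ^ m := hZ'.trans (le_self_pow₀ (by omega) (by omega))
  have h2 : (2 : ℤ) ≤ (Z : ℤ) ^ n := hZ'.trans (le_self_pow₀ (by omega) (by omega))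
  have h3 : (Z : ℤ) ^ m + (Z : ℤ) ^ n ≤ (Z : ℤ) ^ m * (Z : ℤ) ^ n := by nlinarith
  rw [pow_add]
  cases o
  · exact (abs_add_le _ _).trans (by linarith)
  · exact (abs_sub _ _).trans (by linarith)
  · simp only [Op.apply, abs_mul]; gcongr
  · have h4 : |a / b| ≤ |a| := by
      rw [Int.abs_eq_natAbs, Int.abs_eq_natAbs]
      exact_mod_cast Int.natAbs_ediv_le_natAbs a b
    simp only [Op.apply]
    nlinarith

/-- Division does not increase absolute values and products add exponents, so the size of an
expression controls its value. -/
theorem abs_eval_le {s : ℕ → ℤ} {Z m : ℕ} (hZ : 2 ≤ Z) (hs : ∀ r < m, |s r| ≤ Z) :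
    ∀ e : Expr, e.Below m → |e.eval s| ≤ (Z : ℤ) ^ e.size
  | const z, _ => by
    have h1 : z.natAbs < 2 ^ (z.natAbs.log2 + 1) := Nat.lt_log2_self
    have h2 : 2 ^ (z.natAbs.log2 + 1) ≤ Z ^ (z.natAbs.log2 + 1) := Nat.pow_le_pow_left hZ _
    simp only [eval, size, Int.abs_eq_natAbs]
    exact_mod_cast h1.le.trans h2
  | var r, h => by simpa [size] using hs r h
  | bin o a b, h => by
    refine (abs_apply_le o hZ a.size_pos b.size_pos (abs_eval_le hZ hs a h.1)
      (abs_eval_le hZ hs b h.2)).trans ?_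
    exact pow_le_pow_right₀ (by exact_mod_cast (by omega : 1 ≤ Z)) (by simp [size])

theorem eval_congr {s t : ℕ → ℤ} {m : ℕ} (h : ∀ r < m, s r = t r) :
    ∀ e : Expr, e.Below m → e.eval s = e.eval t
  | const _, _ => rfl
  | var r, hr => h r hr
  | bin o a b, hab => by simp only [eval, eval_congr h a hab.1, eval_congr h b hab.2]

end Expr

/-- The registers below `numVars` hold the variables of the program; the others are scratch
space for the evaluation of expressions.  Register `0` holds the bound `B`, `1` the working height
`H`, `2` and `3` the precision `p` and `P = 2 ^ p`, `4` and `5` the width `d` and the step `s` in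
units of `1 / P`, and `6` the numerator of the parameter at which the current arc starts.  For
this arc, `7` to `9` and `10` to `12` hold the vectors `f` and `g`, `13` the threshold `T`, `14` the
Gram determinant `D₃` of the lattice, `15` to `23` a basis of the lattice, and `24` the flag of the
lattice reduction.  Register `25` is a temporary variable, `26` to `28` hold the coefficients
`c₃, c₂, c₁` of the enumeration, and `29` to `34` the vectors to be written. -/
abbrev numVars : ℕ := 35

/-- The number of elementary instructions in the text of a program. -/
def Program.ops : Program → ℕ
  | .const _ _ | .op _ _ _ _ | .query _ _ _ _ | .emitPoint _ | .emitSegment _ _ => 1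
  | .seq P Q => P.ops + Q.ops
  | .ifPos _ P Q => 1 + P.ops + Q.ops
  | .whilePos _ P => 1 + P.ops

/-- Store the value of an expression in a variable. -/
def assign (x : ℕ) (e : Expr) : Program :=
  .seq (e.compile numVars) (.seq (.const x 0) (.op .add x numVars x))

/-- Branch on the sign of an expression. -/
def ifE (e : Expr) (P Q : Program) : Program := .seq (e.compile numVars) (.ifPos numVars P Q)

/-- Repeat as long as an expression is positive. -/
def whileE (e : Expr) (P : Program) : Program :=
  .seq (e.compile numVars) (.whilePos numVars (.seq P (e.compile numVars)))

/-- A sequence of assignments. -/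
def block : List (ℕ × Expr) → Program
  | [] => .const numVars 0
  | (x, e) :: l => .seq (assign x e) (block l)

/-- The effect of a sequence of assignments on the variables. -/
def runBlock : List (ℕ × Expr) → (ℕ → ℤ) → ℕ → ℤ
  | [], s => s
  | (x, e) :: l, s => runBlock l (Function.update s x (e.eval s))

/-- The side conditions of a sequence of assignments: only variables are read and written, the
expressions are of size at most `S`, and all values assigned are at most `X`. -/
def OkBlock (S X : ℕ) : List (ℕ × Expr) → (ℕ → ℤ) → Prop
  | [], _ => True
  | (x, e) :: l, s => (x < numVars ∧ e.Below numVars ∧ e.size ≤ S) ∧ |e.eval s| ≤ X ∧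
      OkBlock S X l (Function.update s x (e.eval s))

/-! ### Cost accounting -/

/-- The data of a run together with bounds: `X` for the variables, `S` for the size of expressions,
`U` for the time of an elementary instruction, and `M` for the memory.  All register contents are
then at most `X ^ S`, and questions are asked only with a precision of at most that number of
digits; an answer of precision `p` takes `c p` units. -/
structure Budget where
  A : Answers
  c : ℕ → ℕ
  X : ℕ
  S : ℕ
  U : ℕ
  M : ℕ
  two_le : 2 ≤ X
  one_le : 1 ≤ S
  time_le : ∀ p ≤ (X ^ S).size, 7 * (1 + (X ^ S).size) ^ 2 + p + c p ≤ U
  space_le : ∀ p ≤ (X ^ S).size, (numVars + S + 1) * (X ^ S).size + p + c p ≤ M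

namespace Budget

variable (m : Budget)

/-- A bound for the binary digits of all registers. -/
def digits : ℕ := (m.X ^ m.S).size

/-- All registers are within bounds, and those after `numVars + S` are not in use. -/
def Fits (σ : Store) : Prop :=
  (∀ r, |σ r| ≤ (m.X ^ m.S : ℕ)) ∧ ∀ r, numVars + m.S < r → σ r = 0

/-- The store holds the variables of the state `s`, all of which are at most `X`. -/
def Holds (s : ℕ → ℤ) (σ : Store) : Prop :=
  m.Fits σ ∧ ∀ x < numVars, σ x = s x ∧ |s x| ≤ m.X

/-- The program `P`, started in state `s`, halts within the time of `n` elementary instructions and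
within the memory of the budget, and the final state and the output satisfy `Q`. -/
def Ev (P : Program) (s : ℕ → ℤ) (n : ℕ) (Q : (ℕ → ℤ) → List Record → Prop) : Prop :=
  ∀ σ, m.Holds s σ → ∃ τ t out time space, Runs m.A m.c P σ τ out time space ∧
    m.Holds t τ ∧ Q t out ∧ time ≤ n * m.U ∧ space ≤ m.M

variable {m}

theorem X_le : m.X ≤ m.X ^ m.S := le_self_pow₀ (by have := m.two_le; omega)
  (by have := m.one_le; omega)

theorem intBits_le {z : ℤ} (h : |z| ≤ (m.X ^ m.S : ℕ)) : intBits z ≤ m.digits := by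
  refine Nat.size_le_size ?_
  rw [Int.abs_eq_natAbs] at h
  exact_mod_cast h

theorem Fits.space_add_le {σ : Store} (h : m.Fits σ) {p : ℕ} (hp : p ≤ m.digits) :
    σ.space + p + m.c p ≤ m.M := by
  have h1 : σ.space ≤ (numVars + m.S + 1) * m.digits := by
    have h2 : σ.support ⊆ Finset.range (numVars + m.S + 1) := by
      intro r hr
      rw [Finset.mem_range]
      by_contra hc
      exact Finsupp.mem_support_iff.1 hr (h.2 r (by omega))
    calc σ.space ≤ ∑ r ∈ Finset.range (numVars + m.S + 1), intBits (σ r) :=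
          Finset.sum_le_sum_of_subset h2
      _ ≤ ∑ r ∈ Finset.range (numVars + m.S + 1), m.digits :=
          Finset.sum_le_sum fun r _ => intBits_le (h.1 r)
      _ = _ := by simp
  have := m.space_le p hp
  simp only [digits] at h1
  omega

theorem Fits.space_le {σ : Store} (h : m.Fits σ) : σ.space + m.c 0 ≤ m.M :=
  h.space_add_le (Nat.zero_le _)

theorem Fits.update {σ : Store} (h : m.Fits σ) {r : ℕ} {z : ℤ} (hr : r ≤ numVars + m.S)
    (hz : |z| ≤ (m.X ^ m.S : ℕ)) : m.Fits (σ.update r z) := by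
  constructor
  · intro q
    rw [Finsupp.update_apply]
    split_ifs
    · exact hz
    · exact h.1 q
  · intro q hq
    rw [Finsupp.update_apply, if_neg (by omega)]
    exact h.2 q hq

theorem const_time_le {z : ℤ} (h : |z| ≤ (m.X ^ m.S : ℕ)) : 1 + intBits z ≤ m.U := by
  have h1 := intBits_le h
  have h2 := m.time_le 0 (Nat.zero_le _)
  have h3 : m.digits = (m.X ^ m.S).size := rfl
  rw [← h3] at h2
  nlinarith

theorem op_time_le {y z : ℤ} (h : |y| ≤ (m.X ^ m.S : ℕ)) (h' : |z| ≤ (m.X ^ m.S : ℕ)) :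
    (1 + intBits y) * (1 + intBits z) ≤ m.U := by
  have h1 := intBits_le h
  have h1' := intBits_le h'
  have h2 := m.time_le 0 (Nat.zero_le _)
  have h3 : m.digits = (m.X ^ m.S).size := rfl
  rw [← h3] at h2
  have : (1 + intBits y) * (1 + intBits z) ≤ (1 + m.digits) * (1 + m.digits) := by gcongr
  nlinarith

theorem one_le_U : 1 ≤ m.U := by
  have := const_time_le (m := m) (z := 0) (by simp)
  omega

/-- Evaluating an expression leaves everything below the target register untouched. -/
theorem runs_compile {σ : Store} (hσ : m.Fits σ) (hX : ∀ x < numVars, |σ x| ≤ m.X) :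
    ∀ (e : Expr) (t : ℕ), e.Below numVars → numVars ≤ t → t + e.size ≤ numVars + m.S → e.size ≤ m.S →
      ∀ σ', m.Fits σ' → (∀ r < numVars, σ' r = σ r) → ∃ τ time space,
      Runs m.A m.c (e.compile t) σ' τ [] time space ∧ τ t = e.eval σ ∧ (∀ r < t, τ r = σ' r) ∧
        m.Fits τ ∧ time ≤ (e.compile t).ops * m.U ∧ space ≤ m.M
  | .const z, t, _, ht, hs, hS, σ', h, _ => by
    have hz : |z| ≤ (m.X ^ m.S : ℕ) := by
      have := Expr.abs_eval_le (s := σ) m.two_le hX (.const z) trivial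
      refine this.trans ?_
      exact_mod_cast Nat.pow_le_pow_right (by have := m.two_le; omega) hS
    have h1 := h.update (r := t) (by omega) hz
    refine ⟨_, _, _, Runs.const t z σ', ?_, ?_, h1, ?_, ?_⟩
    · simp [Expr.eval]
    · intro r hr
      rw [Finsupp.update_apply, if_neg (by omega)]
    · simpa [Expr.compile, Program.ops] using const_time_le hz
    · exact max_le (by have := h.space_le; omega) (by have := h1.space_le; omega)
  | .var x, t, hb, ht, hs, hS, σ', h, hv => by
    have hb : x < numVars := hb
    have h1 := h.update (r := t) (z := 0) (by omega) (by simp)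
    have hz : |σ x| ≤ (m.X ^ m.S : ℕ) := (hX x hb).trans (by exact_mod_cast X_le)
    have h2 := h1.update (r := t) (z := σ x) (by omega) hz
    have h3 : Op.apply .add ((σ'.update t 0) x) ((σ'.update t 0) t) = σ x := by
      rw [Finsupp.update_apply, Finsupp.update_apply, if_neg (by omega), if_pos rfl, hv x hb]
      simp [Op.apply]
    have h4 := Runs.seq (Runs.const (A := m.A) (c := m.c) t 0 σ')
      (Runs.op .add t x t (σ'.update t 0))
    rw [h3] at h4
    refine ⟨_, _, _, h4, ?_, ?_, h2, ?_, ?_⟩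
    · simp [Expr.eval]
    · intro r hr
      rw [Finsupp.update_apply, if_neg (by omega), Finsupp.update_apply, if_neg (by omega)]
    · have := const_time_le (m := m) (z := 0) (by simp)
      have := op_time_le (h1.1 x) (h1.1 t)
      simp only [Expr.compile, Program.ops]
      omega
    · exact max_le (max_le (by have := h.space_le; omega) (by have := h1.space_le; omega))
        (max_le (by have := h1.space_le; omega) (by have := h2.space_le; omega))
  | .bin o a b, t, hb, ht, hs, hS, σ', h, hv => by
    have hsz : (Expr.bin o a b).size = a.size + b.size + 1 := rfl
    have ha1 := a.size_pos
    have hb1 := b.size_pos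
    obtain ⟨τ₁, t₁, s₁, r₁, v₁, f₁, ok₁, tb₁, sb₁⟩ :=
      runs_compile hσ hX a t hb.1 ht (by omega) (by omega) σ' h hv
    obtain ⟨τ₂, t₂, s₂, r₂, v₂, f₂, ok₂, tb₂, sb₂⟩ :=
      runs_compile hσ hX b (t + 1) hb.2 (by omega) (by omega) (by omega) τ₁ ok₁
        (fun r hr => (f₁ r (by omega)).trans (hv r hr))
    have hz : |(Expr.bin o a b).eval σ| ≤ (m.X ^ m.S : ℕ) := by
      refine (Expr.abs_eval_le (s := σ) m.two_le hX _ hb).trans ?_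
      exact_mod_cast Nat.pow_le_pow_right (by have := m.two_le; omega) hS
    have h3 := ok₂.update (r := t) (by omega) hz
    have h4 := Runs.seq r₁ (Runs.seq r₂ (Runs.op o t t (t + 1) τ₂))
    have h5 : o.apply (τ₂ t) (τ₂ (t + 1)) = (Expr.bin o a b).eval σ := by
      rw [v₂, f₂ t (by omega), v₁]; rfl
    rw [h5] at h4
    refine ⟨_, _, _, h4, ?_, ?_, h3, ?_, ?_⟩
    · simp
    · intro r hr
      rw [Finsupp.update_apply, if_neg (by omega), f₂ r (by omega), f₁ r hr]
    · have := op_time_le (ok₂.1 t) (ok₂.1 (t + 1))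
      simp only [Expr.compile, Program.ops]
      nlinarith
    · exact max_le sb₁ (max_le sb₂
        (max_le (by have := ok₂.space_le; omega) (by have := h3.space_le; omega)))

/-- Evaluation into the first scratch register does not change the variables. -/
theorem runs_compile' {σ : Store} {s : ℕ → ℤ} (hσ : m.Holds s σ) {e : Expr}
    (hb : e.Below numVars) (hS : e.size ≤ m.S) : ∃ τ time space,
      Runs m.A m.c (e.compile numVars) σ τ [] time space ∧ τ numVars = e.eval s ∧
        m.Holds s τ ∧ time ≤ (e.compile numVars).ops * m.U ∧ space ≤ m.M := by
  obtain ⟨τ, t, sp, r, v, f, ok, tb, sb⟩ := runs_compile hσ.1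
    (fun x hx => by rw [(hσ.2 x hx).1]; exact (hσ.2 x hx).2) e numVars hb le_rfl
    (by omega) hS σ hσ.1 (fun _ _ => rfl)
  refine ⟨τ, t, sp, r, ?_, ⟨ok, fun x hx => ⟨?_, (hσ.2 x hx).2⟩⟩, tb, sb⟩
  · rw [v]
    exact Expr.eval_congr (fun r hr => (hσ.2 r hr).1) e hb
  · rw [f x hx, (hσ.2 x hx).1]

theorem Holds.update {σ : Store} {s : ℕ → ℤ} (h : m.Holds s σ) {x : ℕ} {z : ℤ}
    (hx : x < numVars) (hz : |z| ≤ m.X) :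
    m.Holds (Function.update s x z) (σ.update x z) := by
  refine ⟨h.1.update (by omega) (hz.trans (by exact_mod_cast X_le)), fun y hy => ?_⟩
  rw [Finsupp.update_apply, Function.update_apply]
  split_ifs
  · exact ⟨rfl, hz⟩
  · exact h.2 y hy

theorem Ev.mono {P : Program} {s : ℕ → ℤ} {n n' : ℕ} {Q Q' : (ℕ → ℤ) → List Record → Prop}
    (h : m.Ev P s n Q) (hn : n ≤ n') (hQ : ∀ t o, Q t o → Q' t o) : m.Ev P s n' Q' := by
  intro σ hσ
  obtain ⟨τ, t, o, ti, sp, r, h1, h2, h3, h4⟩ := h σ hσ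
  exact ⟨τ, t, o, ti, sp, r, h1, hQ _ _ h2, h3.trans (Nat.mul_le_mul_right _ hn), h4⟩

/-- The bounds for the variables may be used to derive a specification, as stores that hold the
state satisfy them. -/
theorem Ev.of_bounded {P : Program} {s : ℕ → ℤ} {n : ℕ} {Q : (ℕ → ℤ) → List Record → Prop}
    (h : (∀ x < numVars, |s x| ≤ m.X) → m.Ev P s n Q) : m.Ev P s n Q :=
  fun σ hσ => h (fun x hx => (hσ.2 x hx).2) σ hσ

theorem Ev.seq {P P' : Program} {s : ℕ → ℤ} {n n' : ℕ} {Q Q' : (ℕ → ℤ) → List Record → Prop}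
    (h : m.Ev P s n Q) (h' : ∀ t o, Q t o → m.Ev P' t n' fun u o' => Q' u (o ++ o')) :
    m.Ev (.seq P P') s (n + n') Q' := by
  intro σ hσ
  obtain ⟨τ, t, o, ti, sp, r, h1, h2, h3, h4⟩ := h σ hσ
  obtain ⟨τ', t', o', ti', sp', r', h1', h2', h3', h4'⟩ := h' t o h2 τ h1
  exact ⟨τ', t', o ++ o', _, _, r.seq r', h1', h2', by rw [add_mul]; omega, max_le h4 h4'⟩

theorem Ev.assign {s : ℕ → ℤ} {Q : (ℕ → ℤ) → List Record → Prop} {x : ℕ} {e : Expr}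
    (hx : x < numVars) (hb : e.Below numVars) (hS : e.size ≤ m.S) (hX : |e.eval s| ≤ m.X)
    (h : Q (Function.update s x (e.eval s)) []) :
    m.Ev (NearCurve.assign x e) s (NearCurve.assign x e).ops Q := by
  intro σ hσ
  obtain ⟨τ, ti, sp, r, v, h1, h2, h3⟩ := runs_compile' hσ hb hS
  have h4 := h1.update hx (z := 0) (by simp)
  have h5 := h4.update hx hX
  have h6 : Op.apply .add ((τ.update x 0) numVars) ((τ.update x 0) x) = e.eval s := by
    rw [Finsupp.update_apply, Finsupp.update_apply, if_neg (by omega), if_pos rfl, v]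
    simp [Op.apply]
  have h7 := r.seq ((Runs.const (A := m.A) (c := m.c) x 0 τ).seq
      (Runs.op .add x numVars x (τ.update x 0)))
  rw [h6] at h7
  refine ⟨_, Function.update s x (e.eval s), _, _, _, h7, ?_, h, ?_, ?_⟩
  · rwa [Function.update_idem] at h5
  · have := const_time_le (m := m) (z := 0) (by simp)
    have := op_time_le (h4.1.1 numVars) (h4.1.1 x)
    simp only [NearCurve.assign, Program.ops]
    nlinarith
  · exact max_le h3 (max_le (max_le (by have := h1.1.space_le; omega)
      (by have := h4.1.space_le; omega)) (max_le (by have := h4.1.space_le; omega)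
      (by have := h5.1.space_le; omega)))

theorem Ev.block : ∀ {l : List (ℕ × Expr)} {s : ℕ → ℤ} {Q : (ℕ → ℤ) → List Record → Prop},
    OkBlock m.S m.X l s → Q (runBlock l s) [] →
      m.Ev (NearCurve.block l) s (NearCurve.block l).ops Q
  | [], s, Q, _, h => by
    intro σ hσ
    have h1 := hσ.1.update (r := numVars) (z := 0) (by omega) (by simp)
    refine ⟨_, s, _, _, _, Runs.const numVars 0 σ, ⟨h1, fun x hx => ?_⟩, h, ?_, ?_⟩
    · rw [Finsupp.update_apply, if_neg (by omega)]
      exact hσ.2 x hx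
    · simpa [NearCurve.block, Program.ops] using const_time_le (m := m) (z := 0) (by simp)
    · exact max_le (by have := hσ.1.space_le; omega) (by have := h1.space_le; omega)
  | (x, e) :: l, s, Q, hok, h =>
    Ev.seq (Q := fun t o => t = Function.update s x (e.eval s) ∧ o = [])
      (Ev.assign hok.1.1 hok.1.2.1 hok.1.2.2 hok.2.1 ⟨rfl, rfl⟩)
      (by rintro t o ⟨rfl, rfl⟩; exact Ev.block hok.2.2 h)

theorem Ev.ifE {P P' : Program} {s : ℕ → ℤ} {n n' : ℕ} {Q : (ℕ → ℤ) → List Record → Prop}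
    {e : Expr} (hb : e.Below numVars) (hS : e.size ≤ m.S)
    (h : 0 < e.eval s → m.Ev P s n Q) (h' : e.eval s ≤ 0 → m.Ev P' s n' Q) :
    m.Ev (NearCurve.ifE e P P') s ((e.compile numVars).ops + 1 + n + n') Q := by
  intro σ hσ
  obtain ⟨τ, ti, sp, r, v, h1, h2, h3⟩ := runs_compile' hσ hb hS
  have hU := m.one_le_U
  by_cases hp : 0 < e.eval s
  · obtain ⟨τ', t', o', ti', sp', r', k1, k2, k3, k4⟩ := h hp τ h1
    refine ⟨τ', t', _, _, _, r.seq (.ifTrue (by rwa [v]) r'), k1, k2, ?_, max_le h3 k4⟩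
    nlinarith [Nat.zero_le (n' * m.U)]
  · obtain ⟨τ', t', o', ti', sp', r', k1, k2, k3, k4⟩ := h' (not_lt.1 hp) τ h1
    refine ⟨τ', t', _, _, _, r.seq (.ifFalse (by rw [v]; omega) r'), k1, k2, ?_, max_le h3 k4⟩
    nlinarith [Nat.zero_le (n * m.U)]

/-- The case of branches without loops, whose cost is the length of their text. -/
theorem Ev.ifE_ops {P P' : Program} {s : ℕ → ℤ} {Q : (ℕ → ℤ) → List Record → Prop}
    {e : Expr} (hb : e.Below numVars) (hS : e.size ≤ m.S)
    (h : 0 < e.eval s → m.Ev P s P.ops Q) (h' : e.eval s ≤ 0 → m.Ev P' s P'.ops Q) :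
    m.Ev (NearCurve.ifE e P P') s (NearCurve.ifE e P P').ops Q :=
  (Ev.ifE hb hS h h').mono (by simp only [NearCurve.ifE, Program.ops]; omega) fun _ _ h => h

/-- Total correctness of a loop: the invariant `I k` allows at most `k` further passes, each of
which takes at most `n` units. -/
theorem Ev.whileE {P : Program} {n : ℕ} {e : Expr} (hb : e.Below numVars) (hS : e.size ≤ m.S)
    {I : ℕ → (ℕ → ℤ) → List Record → Prop}
    (h : ∀ k s acc, I k s acc → 0 < e.eval s → ∃ k', k = k' + 1 ∧
      m.Ev P s n fun t o => I k' t (acc ++ o))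
    (k : ℕ) (s : ℕ → ℤ) (hI : I k s []) :
    m.Ev (NearCurve.whileE e P) s ((k + 1) * (n + (e.compile numVars).ops + 1))
      fun t o => e.eval t ≤ 0 ∧ ∃ k', I k' t o := by
  have hU := m.one_le_U
  have key : ∀ k s acc, I k s acc → ∀ σ, m.Holds s σ → σ numVars = e.eval s →
      ∃ τ t out time space, Runs m.A m.c
        (.whilePos numVars (.seq P (e.compile numVars))) σ τ out time space ∧ m.Holds t τ ∧
        (e.eval t ≤ 0 ∧ ∃ k', I k' t (acc ++ out)) ∧
        time ≤ (k * (n + (e.compile numVars).ops + 1) + 1) * m.U ∧ space ≤ m.M := by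
    intro k
    induction k with
    | zero =>
      intro s acc hI σ hσ hv
      have hp : ¬ 0 < e.eval s := fun hp => by
        obtain ⟨k', hk', _⟩ := h 0 s acc hI hp
        omega
      refine ⟨σ, s, _, _, _, .whileDone (by omega), hσ, ⟨not_lt.1 hp, 0, by simpa using hI⟩, ?_, ?_⟩
      · nlinarith
      · have := hσ.1.space_le
        omega
    | succ k ih =>
      intro s acc hI σ hσ hv
      by_cases hp : 0 < e.eval s
      · obtain ⟨k', hk', hev⟩ := h _ s acc hI hp
        obtain rfl : k = k' := by omega
        obtain ⟨τ, t, o, ti, sp, r, h1, h2, h3, h4⟩ := hev σ hσ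
        obtain ⟨τ', ti', sp', r', v', h1', h3', h4'⟩ := runs_compile' h1 hb hS
        obtain ⟨τ₂, t₂, o₂, ti₂, sp₂, r₂, h1₂, ⟨h5, k₂, h2₂⟩, h3₂, h4₂⟩ := ih t _ h2 τ' h1' v'
        refine ⟨τ₂, t₂, _, _, _, .whileStep (by omega) (r.seq r') r₂, h1₂, ⟨h5, k₂, ?_⟩, ?_,
          max_le (max_le h4 h4') h4₂⟩
        · simpa using h2₂
        · calc _ ≤ m.U + (n * m.U + (e.compile numVars).ops * m.U) +
                (k * (n + (e.compile numVars).ops + 1) + 1) * m.U := by omega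
            _ = _ := by ring
      · refine ⟨σ, s, _, _, _, .whileDone (by omega), hσ,
          ⟨not_lt.1 hp, k + 1, by simpa using hI⟩, ?_, ?_⟩
        · nlinarith [Nat.zero_le ((k + 1) * (n + (e.compile numVars).ops + 1) * m.U)]
        · have := hσ.1.space_le
          omega
  intro σ hσ
  obtain ⟨τ, ti, sp, r, v, h1, h2, h3⟩ := runs_compile' hσ hb hS
  obtain ⟨τ₂, t₂, o₂, ti₂, sp₂, r₂, h1₂, h2₂, h3₂, h4₂⟩ := key k s [] hI τ h1 v
  refine ⟨τ₂, t₂, _, _, _, r.seq r₂, h1₂, h2₂, ?_, max_le h3 h4₂⟩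
  calc _ ≤ (e.compile numVars).ops * m.U +
      (k * (n + (e.compile numVars).ops + 1) + 1) * m.U := by omega
    _ ≤ (k + 1) * (n + (e.compile numVars).ops + 1) * m.U := by
      rw [← add_mul]
      refine Nat.mul_le_mul_right _ ?_
      nlinarith

/-- A counting loop: `I i` holds at the start of pass number `i`, and the loop is left after exactly
`M` passes; pass `i` writes an output that satisfies `Φ i`. -/
theorem Ev.count {P : Program} {n : ℕ} {e : Expr} (hb : e.Below numVars) (hS : e.size ≤ m.S)
    (M : ℕ) {I : ℕ → (ℕ → ℤ) → Prop} {Φ : ℕ → List Record → Prop}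
    (hg : ∀ i s, I i s → i ≤ M → (0 < e.eval s ↔ i < M))
    (h : ∀ i s, I i s → i < M → m.Ev P s n fun t o => I (i + 1) t ∧ Φ i o)
    (s : ℕ → ℤ) (hI : I 0 s) :
    m.Ev (NearCurve.whileE e P) s ((M + 1) * (n + (e.compile numVars).ops + 1))
      fun t o => I M t ∧ ∃ os : ℕ → List Record, o = (List.range M).flatMap os ∧
        ∀ i < M, Φ i (os i) := by
  refine Ev.mono (Ev.whileE hb hS (n := n) (I := fun k s acc => ∃ i, i + k = M ∧ I i s ∧
    ∃ os : ℕ → List Record, acc = (List.range i).flatMap os ∧ ∀ j < i, Φ j (os j)) ?_ M s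
    ⟨0, by omega, hI, fun _ => [], by simp, by simp⟩) le_rfl ?_
  · rintro k s acc ⟨i, hi, hIi, os, rfl, hos⟩ hp
    have hlt := (hg i s hIi (by omega)).1 hp
    refine ⟨k - 1, by omega, Ev.mono (h i s hIi hlt) le_rfl ?_⟩
    rintro t o ⟨hIt, hΦ⟩
    refine ⟨i + 1, by omega, hIt, Function.update os i o, ?_, ?_⟩
    · rw [List.range_succ, List.flatMap_append]
      congr 1
      · refine List.flatMap_congr fun j hj => ?_
        rw [Function.update_of_ne (by have := List.mem_range.1 hj; omega)]
      · simp
    · intro j hj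
      by_cases hji : j = i
      · subst hji; simpa using hΦ
      · rw [Function.update_of_ne hji]
        exact hos j (by omega)
  · rintro t o ⟨hle, k, i, hi, hIi, os, ho, hos⟩
    have : ¬ i < M := fun hlt => by
      have := (hg i t hIi (by omega)).2 hlt
      omega
    obtain rfl : i = M := by omega
    exact ⟨hIi, os, ho, hos⟩

/-- A question takes one unit of time: `U` includes the cost of answers up to precision `digits`. -/
theorem Ev.query {s : ℕ → ℤ} {Q : (ℕ → ℤ) → List Record → Prop} {x p j : ℕ} {q : Quantity}
    (hx : x < numVars) (hp : p < numVars) (hj : j < numVars) (hd : (s p).toNat ≤ m.digits)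
    (hX : |m.A q (s p).toNat (s j)| ≤ m.X)
    (h : Q (Function.update s x (m.A q (s p).toNat (s j))) []) :
    m.Ev (.query x q p j) s 1 Q := by
  intro σ hσ
  have h1 := hσ.update hx hX
  have h2 := Runs.query (A := m.A) (c := m.c) x q p j σ
  rw [(hσ.2 p hp).1, (hσ.2 j hj).1] at h2
  refine ⟨_, _, _, _, _, h2, h1, h, ?_, ?_⟩
  · have h3 := m.time_le _ hd
    have h4 : m.digits = (m.X ^ m.S).size := rfl
    have h5 := intBits_le (h1.1.1 x)
    have h6 := intBits_le (hσ.1.1 j)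
    rw [Finsupp.update_apply, if_pos rfl] at h5
    rw [(hσ.2 j hj).1] at h6
    rw [← h4] at h3
    nlinarith
  · exact max_le (hσ.1.space_add_le hd) (by have := h1.1.space_le; omega)

theorem Ev.emitPoint {s : ℕ → ℤ} {Q : (ℕ → ℤ) → List Record → Prop} {r : Fin 3 → ℕ}
    (hr : ∀ i, r i < numVars) (h : Q s [.point fun i => s (r i)]) :
    m.Ev (.emitPoint r) s 1 Q := by
  intro σ hσ
  have h2 := Runs.emitPoint (A := m.A) (c := m.c) r σ
  have h3 : (fun i => σ (r i)) = fun i => s (r i) := funext fun i => (hσ.2 _ (hr i)).1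
  have h5 : ∀ i, intBits (s (r i)) ≤ m.digits := fun i => by
    rw [← (hσ.2 _ (hr i)).1]; exact intBits_le (hσ.1.1 _)
  rw [h3] at h2
  refine ⟨_, _, _, _, _, h2, hσ, h, ?_, by have := hσ.1.space_le; omega⟩
  have h6 := m.time_le 0 (Nat.zero_le _)
  have h4 : m.digits = (m.X ^ m.S).size := rfl
  rw [← h4] at h6
  simp only [Record.bits, Fin.sum_univ_three]
  have := h5 0; have := h5 1; have := h5 2
  nlinarith

theorem Ev.emitSegment {s : ℕ → ℤ} {Q : (ℕ → ℤ) → List Record → Prop} {r r' : Fin 3 → ℕ}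
    (hr : ∀ i, r i < numVars) (hr' : ∀ i, r' i < numVars)
    (h : Q s [.segment (fun i => s (r i)) fun i => s (r' i)]) :
    m.Ev (.emitSegment r r') s 1 Q := by
  intro σ hσ
  have h2 := Runs.emitSegment (A := m.A) (c := m.c) r r' σ
  have h3 : (fun i => σ (r i)) = fun i => s (r i) := funext fun i => (hσ.2 _ (hr i)).1
  have h3' : (fun i => σ (r' i)) = fun i => s (r' i) := funext fun i => (hσ.2 _ (hr' i)).1
  have h5 : ∀ x < numVars, intBits (s x) ≤ m.digits := fun x hx => by
    rw [← (hσ.2 _ hx).1]; exact intBits_le (hσ.1.1 _)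
  rw [h3, h3'] at h2
  refine ⟨_, _, _, _, _, h2, hσ, h, ?_, by have := hσ.1.space_le; omega⟩
  have h6 := m.time_le 0 (Nat.zero_le _)
  have h4 : m.digits = (m.X ^ m.S).size := rfl
  rw [← h4] at h6
  simp only [Record.bits, Fin.sum_univ_three]
  have := h5 _ (hr 0); have := h5 _ (hr 1); have := h5 _ (hr 2)
  have := h5 _ (hr' 0); have := h5 _ (hr' 1); have := h5 _ (hr' 2)
  nlinarith

end Budget

end NearCurve

namespace NearCurve

/-! ### Vectors with three coordinates and the quadratic form of an arc -/

/-- Vectors with three coordinates.  The operations below are meant for numbers as well as for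
expressions in registers. -/
@[ext] structure V3 (α : Type) where
  x : α
  y : α
  z : α

namespace V3

section Operations

variable {α : Type} [Add α] [Sub α] [Mul α]

/-- The standard bilinear form. -/
def dot (a b : V3 α) : α := a.x * b.x + a.y * b.y + a.z * b.z

/-- The vector product. -/
def cross (a b : V3 α) : V3 α :=
  ⟨a.y * b.z - a.z * b.y, a.z * b.x - a.x * b.z, a.x * b.y - a.y * b.x⟩

/-- The determinant of three vectors. -/
def det (a b c : V3 α) : α := dot a (cross b c)

/-- The vector `a - r b`. -/
def subMul (a : V3 α) (r : α) (b : V3 α) : V3 α := ⟨a.x - r * b.x, a.y - r * b.y, a.z - r * b.z⟩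

/-- The vector `a + r b`. -/
def addMul (a : V3 α) (r : α) (b : V3 α) : V3 α := ⟨a.x + r * b.x, a.y + r * b.y, a.z + r * b.z⟩

/-- The vector `r a`. -/
def smul (r : α) (a : V3 α) : V3 α := ⟨r * a.x, r * a.y, r * a.z⟩

/-- The bilinear form whose quadratic form is small at the integral vectors near an arc.  The arc
leaves the point `f` in direction `g`; lengths are measured in units of `1 / P`, in which the
step of the parameter is `s` and the distance bound is `d`.  Up to the factor `P ^ 2` its matrix is
the adjugate of `P² f fᵀ + s² g gᵀ + P² d² I`. -/
def bil (P d s : α) (f g a b : V3 α) : α :=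
  s * s * (det a f g * det b f g) + P * P * (d * d) * dot (cross a f) (cross b f) +
    d * d * (s * s) * dot (cross a g) (cross b g) + P * P * (d * d * (d * d)) * dot a b

/-- The determinant of `P² f fᵀ + s² g gᵀ + P² d² I`, divided by `P ^ 4`. -/
def disc (P d s : α) (f g : V3 α) : α :=
  s * s * (d * d) * dot (cross f g) (cross f g) +
    d * d * (d * d) * (P * P * dot f f + s * s * dot g g) + P * P * (d * d * (d * d) * (d * d))

end Operations

theorem det_cyclic {R : Type} [CommRing R] (a b c : V3 R) : det a b c = det b c a := by
  simp only [det, dot, cross]; ring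

section Form

variable {P d s : ℤ} {f g : V3 ℤ}

theorem bil_comm (a b : V3 ℤ) : bil P d s f g a b = bil P d s f g b a := by
  simp only [bil, det, dot, cross]; ring

theorem bil_subMul_right (a b c : V3 ℤ) (r : ℤ) :
    bil P d s f g a (subMul b r c) = bil P d s f g a b - r * bil P d s f g a c := by
  simp only [bil, det, dot, cross, subMul]; ring

theorem bil_addMul_right (a b c : V3 ℤ) (r : ℤ) :
    bil P d s f g a (addMul b r c) = bil P d s f g a b + r * bil P d s f g a c := by
  simp only [bil, det, dot, cross, addMul]; ring

theorem bil_smul_right (a b : V3 ℤ) (r : ℤ) :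
    bil P d s f g a (smul r b) = r * bil P d s f g a b := by
  simp only [bil, det, dot, cross, smul]; ring

theorem bil_subMul_left (a b c : V3 ℤ) (r : ℤ) :
    bil P d s f g (subMul b r c) a = bil P d s f g b a - r * bil P d s f g c a := by
  simp only [bil, det, dot, cross, subMul]; ring

theorem bil_addMul_left (a b c : V3 ℤ) (r : ℤ) :
    bil P d s f g (addMul b r c) a = bil P d s f g b a + r * bil P d s f g c a := by
  simp only [bil, det, dot, cross, addMul]; ring

theorem bil_smul_left (a b : V3 ℤ) (r : ℤ) :
    bil P d s f g (smul r b) a = r * bil P d s f g b a := by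
  simp only [bil, det, dot, cross, smul]; ring

theorem dot_self_nonneg (a : V3 ℤ) : 0 ≤ dot a a := by
  simp only [dot]; nlinarith [mul_self_nonneg a.x, mul_self_nonneg a.y, mul_self_nonneg a.z]

theorem dot_le_bil (hP : 0 < P) (hd : 0 < d) (a : V3 ℤ) : dot a a ≤ bil P d s f g a a := by
  have h1 : (1 : ℤ) ≤ P * P * (d * d * (d * d)) := by
    have : 0 < P * P * (d * d * (d * d)) := by positivity
    omega
  have h2 := mul_self_nonneg (det a f g)
  have h3 := dot_self_nonneg (cross a f)
  have h4 := dot_self_nonneg (cross a g)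
  have h5 := dot_self_nonneg a
  have h6 : 0 ≤ s * s * (det a f g * det a f g) := mul_nonneg (mul_self_nonneg s) h2
  have h7 : 0 ≤ P * P * (d * d) * dot (cross a f) (cross a f) := by positivity
  have h8 : 0 ≤ d * d * (s * s) * dot (cross a g) (cross a g) :=
    mul_nonneg (mul_nonneg (mul_self_nonneg d) (mul_self_nonneg s)) h4
  simp only [bil]
  nlinarith

theorem bil_self_pos (hP : 0 < P) (hd : 0 < d) {a : V3 ℤ} (ha : a ≠ ⟨0, 0, 0⟩) :
    0 < bil P d s f g a a := by
  refine lt_of_lt_of_le ?_ (dot_le_bil hP hd a)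
  by_contra hc
  apply ha
  simp only [dot] at hc
  have hx : a.x * a.x = 0 := by
    nlinarith [mul_self_nonneg a.x, mul_self_nonneg a.y, mul_self_nonneg a.z]
  have hy : a.y * a.y = 0 := by
    nlinarith [mul_self_nonneg a.x, mul_self_nonneg a.y, mul_self_nonneg a.z]
  have hz : a.z * a.z = 0 := by
    nlinarith [mul_self_nonneg a.x, mul_self_nonneg a.y, mul_self_nonneg a.z]
  ext
  · simpa using hx
  · simpa using hy
  · simpa using hz

theorem abs_le_bil (hP : 0 < P) (hd : 0 < d) (a : V3 ℤ) :
    |a.x| ≤ bil P d s f g a a ∧ |a.y| ≤ bil P d s f g a a ∧ |a.z| ≤ bil P d s f g a a := by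
  have h := dot_le_bil (s := s) (f := f) (g := g) hP hd a
  have key : ∀ t : ℤ, |t| ≤ t * t := fun t => by
    rw [← abs_mul_abs_self t]
    rcases (abs_nonneg t).eq_or_lt with h0 | h0
    · rw [← h0]; simp
    · nlinarith
  simp only [dot] at h
  have hx := key a.x; have hy := key a.y; have hz := key a.z
  have := mul_self_nonneg a.x; have := mul_self_nonneg a.y; have := mul_self_nonneg a.z
  refine ⟨?_, ?_, ?_⟩ <;> linarith

/-- The quadratic form is at most `Δ / d²` times the Euclidean one, `Δ` being `disc`. -/
theorem bil_le_disc (a : V3 ℤ) :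
    d * d * bil P d s f g a a ≤ disc P d s f g * dot a a := by
  have h : disc P d s f g * dot a a - d * d * bil P d s f g a a =
      s * s * (d * d) * dot (cross a (cross f g)) (cross a (cross f g)) +
        d * d * (d * d) * (P * P * (dot f a * dot f a) + s * s * (dot g a * dot g a)) := by
    simp only [bil, disc, det, dot, cross]; ring
  have h1 := dot_self_nonneg (cross a (cross f g))
  have h2 : 0 ≤ s * s * (d * d) * dot (cross a (cross f g)) (cross a (cross f g)) :=
    mul_nonneg (mul_nonneg (mul_self_nonneg _) (mul_self_nonneg _)) h1
  have h3 : 0 ≤ d * d * (d * d) * (P * P * (dot f a * dot f a) + s * s * (dot g a * dot g a)) := by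
    have := mul_self_nonneg (d * d)
    have := mul_self_nonneg (P * dot f a)
    have := mul_self_nonneg (s * dot g a)
    nlinarith
  linarith

end Form

section Gram

variable {α : Type} [Add α] [Sub α] [Mul α]

/-- The Gram determinant of two vectors. -/
def gram2 (P d s : α) (f g a b : V3 α) : α :=
  bil P d s f g a a * bil P d s f g b b - bil P d s f g a b * bil P d s f g a b

/-- The inner product of `c` with the component of `b` orthogonal to `a`, times the square of the
length of `a`. -/
def gramNu (P d s : α) (f g a b c : V3 α) : α :=
  bil P d s f g a a * bil P d s f g b c - bil P d s f g a b * bil P d s f g a c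

/-- The Gram determinant of three vectors. -/
def gram3 (P d s : α) (f g a b c : V3 α) : α :=
  bil P d s f g a a * gram2 P d s f g b c - bil P d s f g a b *
    (bil P d s f g a b * bil P d s f g c c - bil P d s f g b c * bil P d s f g a c) +
    bil P d s f g a c *
    (bil P d s f g a b * bil P d s f g b c - bil P d s f g b b * bil P d s f g a c)

end Gram

/-- The determinant of a Gram matrix `Bᵀ m B`. -/
theorem gram_det_of_matrix (m₁ m₂ m₃ m₁₂ m₁₃ m₂₃ : ℤ) (q : V3 ℤ → V3 ℤ → ℤ)
    (hq : ∀ a b, q a b = a.x * (m₁ * b.x + m₁₂ * b.y + m₁₃ * b.z) +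
      a.y * (m₁₂ * b.x + m₂ * b.y + m₂₃ * b.z) + a.z * (m₁₃ * b.x + m₂₃ * b.y + m₃ * b.z))
    (a b c : V3 ℤ) :
    q a a * (q b b * q c c - q b c * q b c) - q a b * (q a b * q c c - q b c * q a c) +
      q a c * (q a b * q b c - q b b * q a c) =
    (m₁ * m₂ * m₃ + 2 * m₁₂ * m₁₃ * m₂₃ - m₁ * m₂₃ ^ 2 - m₂ * m₁₃ ^ 2 - m₃ * m₁₂ ^ 2) *
      (det a b c * det a b c) := by
  simp only [hq, det, dot, cross]; ring

end V3
end NearCurve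

namespace NearCurve
namespace V3

/-- The determinant of the form: the adjugate of a `3 × 3` matrix `M` has determinant
`(det M) ^ 2`. -/
theorem gram3_eq {P d s : ℤ} {f g : V3 ℤ} (hP : 0 < P) (a b c : V3 ℤ) :
    gram3 P d s f g a b c =
      P * P * (disc P d s f g * disc P d s f g) * (det a b c * det a b c) := by
  obtain ⟨f₁, f₂, f₃⟩ := f
  obtain ⟨g₁, g₂, g₃⟩ := g
  obtain ⟨M₁, hM₁⟩ : ∃ M, M = P ^ 2 * f₁ ^ 2 + s ^ 2 * g₁ ^ 2 + P ^ 2 * d ^ 2 := ⟨_, rfl⟩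
  obtain ⟨M₂, hM₂⟩ : ∃ M, M = P ^ 2 * f₂ ^ 2 + s ^ 2 * g₂ ^ 2 + P ^ 2 * d ^ 2 := ⟨_, rfl⟩
  obtain ⟨M₃, hM₃⟩ : ∃ M, M = P ^ 2 * f₃ ^ 2 + s ^ 2 * g₃ ^ 2 + P ^ 2 * d ^ 2 := ⟨_, rfl⟩
  obtain ⟨M₁₂, hM₁₂⟩ : ∃ M, M = P ^ 2 * f₁ * f₂ + s ^ 2 * g₁ * g₂ := ⟨_, rfl⟩
  obtain ⟨M₁₃, hM₁₃⟩ : ∃ M, M = P ^ 2 * f₁ * f₃ + s ^ 2 * g₁ * g₃ := ⟨_, rfl⟩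
  obtain ⟨M₂₃, hM₂₃⟩ : ∃ M, M = P ^ 2 * f₂ * f₃ + s ^ 2 * g₂ * g₃ := ⟨_, rfl⟩
  have hq : ∀ a b : V3 ℤ, P ^ 2 * bil P d s ⟨f₁, f₂, f₃⟩ ⟨g₁, g₂, g₃⟩ a b =
      a.x * ((M₂ * M₃ - M₂₃ ^ 2) * b.x + (M₁₃ * M₂₃ - M₁₂ * M₃) * b.y +
        (M₁₂ * M₂₃ - M₁₃ * M₂) * b.z) +
      a.y * ((M₁₃ * M₂₃ - M₁₂ * M₃) * b.x + (M₁ * M₃ - M₁₃ ^ 2) * b.y +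
        (M₁₂ * M₁₃ - M₂₃ * M₁) * b.z) +
      a.z * ((M₁₂ * M₂₃ - M₁₃ * M₂) * b.x + (M₁₂ * M₁₃ - M₂₃ * M₁) * b.y +
        (M₁ * M₂ - M₁₂ ^ 2) * b.z) := by
    intro a b
    subst hM₁ hM₂ hM₃ hM₁₂ hM₁₃ hM₂₃
    simp only [bil, det, dot, cross]; ring
  have hM : P ^ 4 * disc P d s ⟨f₁, f₂, f₃⟩ ⟨g₁, g₂, g₃⟩ = M₁ * M₂ * M₃ + 2 * M₁₂ * M₁₃ * M₂₃ -
      M₁ * M₂₃ ^ 2 - M₂ * M₁₃ ^ 2 - M₃ * M₁₂ ^ 2 := by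
    subst hM₁ hM₂ hM₃ hM₁₂ hM₁₃ hM₂₃
    simp only [disc, dot, cross]; ring
  have h1 := gram_det_of_matrix _ _ _ _ _ _ _ hq a b c
  have h2 : P ^ 6 * gram3 P d s ⟨f₁, f₂, f₃⟩ ⟨g₁, g₂, g₃⟩ a b c =
      P ^ 6 * (P * P * (disc P d s ⟨f₁, f₂, f₃⟩ ⟨g₁, g₂, g₃⟩ * disc P d s ⟨f₁, f₂, f₃⟩ ⟨g₁, g₂, g₃⟩) *
        (det a b c * det a b c)) := by
    calc _ = _ := by simp only [gram3, gram2]; ring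
      _ = _ := h1
      _ = (P ^ 4 * disc P d s ⟨f₁, f₂, f₃⟩ ⟨g₁, g₂, g₃⟩) ^ 2 * (det a b c * det a b c) := by
        rw [hM]; ring
      _ = _ := by ring
  exact mul_left_cancel₀ (by positivity) h2

section Pos

variable {P d s : ℤ} {f g : V3 ℤ}

theorem gram2_pos (hP : 0 < P) (hd : 0 < d) {a b c : V3 ℤ} (h : det a b c ≠ 0) :
    0 < bil P d s f g a a ∧ 0 < gram2 P d s f g a b := by
  have ha : a ≠ ⟨0, 0, 0⟩ := by
    rintro rfl
    exact h (by simp [det, dot])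
  have h1 : 0 < bil P d s f g a a := bil_self_pos hP hd ha
  refine ⟨h1, ?_⟩
  have h2 : smul (bil P d s f g a a) b ≠ smul (bil P d s f g a b) a := by
    intro hc
    have : bil P d s f g a a * det a b c = 0 := by
      have e : bil P d s f g a a * det a b c = det a (smul (bil P d s f g a a) b) c := by
        simp only [det, dot, cross, smul]; ring
      rw [e, hc]
      simp only [det, dot, cross, smul]; ring
    rcases mul_eq_zero.1 this with h' | h'
    · omega
    · exact h h'
  have h3 : subMul (smul (bil P d s f g a a) b) (bil P d s f g a b) a ≠ ⟨0, 0, 0⟩ := by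
    intro hc
    apply h2
    simp only [subMul, V3.mk.injEq] at hc
    ext
    · simp only [smul] at *; linarith [hc.1]
    · simp only [smul] at *; linarith [hc.2.1]
    · simp only [smul] at *; linarith [hc.2.2]
  have h4 := bil_self_pos (s := s) (f := f) (g := g) hP hd h3
  have h5 : bil P d s f g (subMul (smul (bil P d s f g a a) b) (bil P d s f g a b) a)
      (subMul (smul (bil P d s f g a a) b) (bil P d s f g a b) a) =
      bil P d s f g a a * gram2 P d s f g a b := by
    simp only [bil_subMul_right, bil_subMul_left, bil_smul_right, bil_smul_left, gram2]
    rw [bil_comm b a]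
    ring
  rw [h5] at h4
  exact pos_of_mul_pos_right h4 h1.le

theorem disc_pos (hP : 0 < P) (hd : 0 < d) : 0 < disc P d s f g := by
  have h1 := dot_self_nonneg (cross f g)
  have h2 := dot_self_nonneg f
  have h3 := dot_self_nonneg g
  have h4 : 0 < P * P * (d * d * (d * d) * (d * d)) := by positivity
  have h5 : 0 ≤ s * s * (d * d) * dot (cross f g) (cross f g) :=
    mul_nonneg (mul_nonneg (mul_self_nonneg _) (mul_self_nonneg _)) h1
  have h6 : 0 ≤ d * d * (d * d) * (P * P * dot f f + s * s * dot g g) := by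
    have := mul_self_nonneg s
    positivity
  simp only [disc]
  linarith

end Pos

/-! ### Lattice reduction in dimension three -/

/-- Rounding a quotient to a nearest integer. -/
theorem abs_sub_round_le {u a : ℤ} (ha : 0 < a) :
    |2 * (u - (2 * u + a) / (2 * a) * a)| ≤ a := by
  have h1 := Int.mul_ediv_add_emod (2 * u + a) (2 * a)
  have h2 := Int.emod_nonneg (2 * u + a) (by omega : 2 * a ≠ 0)
  have h3 := Int.emod_lt_of_pos (2 * u + a) (by omega : 0 < 2 * a)
  rw [abs_le]
  constructor <;> linarith

/-- A size-reduced basis: the Gram-Schmidt coefficients are at most `1 / 2`. -/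
structure SizeReduced (P d s : ℤ) (f g a b c : V3 ℤ) : Prop where
  ab : |2 * bil P d s f g a b| ≤ bil P d s f g a a
  ac : |2 * bil P d s f g a c| ≤ bil P d s f g a a
  nu : |2 * gramNu P d s f g a b c| ≤ gram2 P d s f g a b

/-- The two exchange conditions of lattice reduction do not apply: the squared lengths of the
Gram-Schmidt vectors decrease at most by a factor `2` at each step. -/
structure Reduced (P d s : ℤ) (f g a b c : V3 ℤ) : Prop extends SizeReduced P d s f g a b c where
  fst : bil P d s f g a a * bil P d s f g a a ≤ 2 * gram2 P d s f g a b
  snd : gram2 P d s f g a b * gram2 P d s f g a b ≤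
    2 * gram3 P d s f g a b c * bil P d s f g a a

section Reduction

variable {P d s : ℤ} {f g a b c : V3 ℤ}

theorem sq_le_of_abs_le {x y : ℤ} (h : |2 * x| ≤ y) : 4 * (x * x) ≤ y * y := by
  have h1 : |2 * x| * |2 * x| ≤ y * y := mul_self_le_mul_self (abs_nonneg _) h
  rw [abs_mul_abs_self] at h1
  linarith

theorem gram3_schur : bil P d s f g a a * gram3 P d s f g a b c =
    gram2 P d s f g a b * gram2 P d s f g a c -
      gramNu P d s f g a b c * gramNu P d s f g a b c := by
  simp only [gram3, gram2, gramNu]; ring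

/-- The lengths of the vectors of a size-reduced basis are bounded by its Gram determinants. -/
theorem bil_snd_le (h : |2 * bil P d s f g a b| ≤ bil P d s f g a a)
    (h1 : 0 < bil P d s f g a a) (h2 : 0 < gram2 P d s f g a b) :
    bil P d s f g b b ≤ bil P d s f g a a + gram2 P d s f g a b := by
  have k1 := sq_le_of_abs_le h
  have e2 : bil P d s f g a a * bil P d s f g b b = gram2 P d s f g a b +
    bil P d s f g a b * bil P d s f g a b := by simp only [gram2]; ring
  generalize bil P d s f g a a = A at *
  generalize bil P d s f g a b = u at *
  generalize bil P d s f g b b = B at *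
  generalize gram2 P d s f g a b = D at *
  refine le_of_mul_le_mul_left (?_ : A * B ≤ A * (A + D)) h1
  nlinarith

theorem SizeReduced.bil_thd_le (h : SizeReduced P d s f g a b c) (h1 : 0 < bil P d s f g a a)
    (h2 : 0 < gram2 P d s f g a b) (h3 : 0 < gram3 P d s f g a b c) :
    bil P d s f g c c ≤ bil P d s f g a a + gram2 P d s f g a b + gram3 P d s f g a b c := by
  have e := gram3_schur (P := P) (d := d) (s := s) (f := f) (g := g) (a := a) (b := b) (c := c)
  have k2 := sq_le_of_abs_le h.ac
  have k3 := sq_le_of_abs_le h.nu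
  have e3 : bil P d s f g a a * bil P d s f g c c = gram2 P d s f g a c +
    bil P d s f g a c * bil P d s f g a c := by simp only [gram2]; ring
  generalize bil P d s f g a a = A at *
  generalize bil P d s f g a c = v at *
  generalize bil P d s f g c c = C at *
  generalize gram2 P d s f g a b = D at *
  generalize gram2 P d s f g a c = D' at *
  generalize gram3 P d s f g a b c = E at *
  generalize gramNu P d s f g a b c = n at *
  refine le_of_mul_le_mul_left (?_ : A * D * C ≤ A * D * (A + D + E)) (by positivity)
  have e4 : A * D * C = A * E + n * n + D * (v * v) := by linear_combination D * e3 - e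
  have k4 : D * (4 * (v * v)) ≤ D * (A * A) := mul_le_mul_of_nonneg_left k2 h2.le
  have k5 : A * E ≤ A * D * E := by
    have := mul_pos h1 h3
    nlinarith
  have k6 : D * D ≤ A * D * D := by
    have := mul_pos h2 h2
    nlinarith
  have k7 : 0 ≤ A * D * D := by positivity
  have k8 : 0 ≤ A * D * A := by positivity
  nlinarith

/-- Exchanging the first two vectors when the first one is too long shortens it. -/
theorem SizeReduced.swap_fst (h : SizeReduced P d s f g a b c) (h1 : 0 < bil P d s f g a a)
    (hs : 2 * gram2 P d s f g a b < bil P d s f g a a * bil P d s f g a a) :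
    4 * bil P d s f g b b < 3 * bil P d s f g a a := by
  have k1 := sq_le_of_abs_le h.ab
  simp only [gram2] at hs
  nlinarith

/-- Exchanging the last two vectors when the second one is too long makes the area of the first two
smaller. -/
theorem SizeReduced.swap_snd (h : SizeReduced P d s f g a b c) (h2 : 0 < gram2 P d s f g a b)
    (hs : 2 * gram3 P d s f g a b c * bil P d s f g a a <
      gram2 P d s f g a b * gram2 P d s f g a b) :
    4 * gram2 P d s f g a c < 3 * gram2 P d s f g a b := by
  have e := gram3_schur (P := P) (d := d) (s := s) (f := f) (g := g) (a := a) (b := b) (c := c)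
  have k3 := sq_le_of_abs_le h.nu
  nlinarith

/-- The vector with coordinates `i, j, k` in the basis `a, b, c`. -/
def comb {α : Type} [Add α] [Mul α] (i j k : α) (a b c : V3 α) : V3 α :=
  addMul (addMul (smul i a) j b) k c

/-- Coordinates of short vectors in a reduced basis are bounded by the Gram-Schmidt lengths. -/
theorem Reduced.coord_le (h : Reduced P d s f g a b c) (h1 : 0 < bil P d s f g a a)
    (h2 : 0 < gram2 P d s f g a b) (h3 : 0 < gram3 P d s f g a b c) {T i j k : ℤ}
    (hT : bil P d s f g (comb i j k a b c) (comb i j k a b c) ≤ T) :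
    k * k * gram3 P d s f g a b c ≤ T * gram2 P d s f g a b ∧
    j * j * gram2 P d s f g a b ≤ 4 * T * bil P d s f g a a ∧
    i * i * bil P d s f g a a ≤ 16 * T := by
  have e : bil P d s f g a a * gram2 P d s f g a b *
        bil P d s f g (comb i j k a b c) (comb i j k a b c) =
      gram2 P d s f g a b * ((bil P d s f g a a * i + bil P d s f g a b * j +
        bil P d s f g a c * k) ^ 2) +
      (gram2 P d s f g a b * j + gramNu P d s f g a b c * k) ^ 2 +
      bil P d s f g a a * gram3 P d s f g a b c * (k * k) := by
    simp only [comb, bil_addMul_right, bil_addMul_left, bil_smul_right, bil_smul_left]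
    rw [bil_comm b a, bil_comm c a, bil_comm c b]
    simp only [gram3, gram2, gramNu]
    ring
  have k1 := sq_le_of_abs_le h.ab
  have k2 := sq_le_of_abs_le h.ac
  have k3 := sq_le_of_abs_le h.nu
  have k4 := h.fst
  have k5 := h.snd
  generalize bil P d s f g a a = A at *
  generalize bil P d s f g a b = u at *
  generalize bil P d s f g a c = v at *
  generalize gram2 P d s f g a b = D at *
  generalize gram3 P d s f g a b c = E at *
  generalize gramNu P d s f g a b c = n at *
  generalize bil P d s f g (comb i j k a b c) (comb i j k a b c) = q at *
  have hqT : A * D * q ≤ A * D * T := mul_le_mul_of_nonneg_left hT (by positivity)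
  obtain ⟨y, hy⟩ : ∃ y, y = A * i + u * j + v * k := ⟨_, rfl⟩
  obtain ⟨w, hw⟩ : ∃ w, w = D * j + n * k := ⟨_, rfl⟩
  rw [← hy, ← hw] at e
  have p1 : 0 ≤ D * y ^ 2 := by positivity
  have p2 : 0 ≤ w ^ 2 := by positivity
  have p3 : 0 ≤ A * E * (k * k) := mul_nonneg (by positivity) (mul_self_nonneg k)
  have r1 : k * k * E ≤ T * D := by
    refine le_of_mul_le_mul_left (?_ : A * (k * k * E) ≤ A * (T * D)) h1
    nlinarith
  have r2 : w ^ 2 ≤ A * D * T := by linarith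
  have r3 : y ^ 2 ≤ A * T := by
    refine le_of_mul_le_mul_left (?_ : D * y ^ 2 ≤ D * (A * T)) h2
    nlinarith
  have hkk := mul_self_nonneg k
  have hjj := mul_self_nonneg j
  have r4 : k * k * D ≤ 2 * T * A := by
    refine le_of_mul_le_mul_left (?_ : D * (k * k * D) ≤ D * (2 * T * A)) h2
    have : k * k * (D * D) ≤ k * k * (2 * E * A) := mul_le_mul_of_nonneg_left k5 hkk
    have : A * (k * k * E) ≤ A * (T * D) := mul_le_mul_of_nonneg_left r1 h1.le
    nlinarith
  have r5 : j * j * D ≤ 3 * T * A := by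
    refine le_of_mul_le_mul_left (?_ : D * (j * j * D) ≤ D * (3 * T * A)) h2
    have s1 : D * j = w - n * k := by linarith
    have s2 : D * (j * j * D) = (w - n * k) ^ 2 := by rw [← s1]; ring
    have s3 : 0 ≤ (w + n * k) ^ 2 := sq_nonneg _
    have s4 : k * k * (4 * (n * n)) ≤ k * k * (D * D) := mul_le_mul_of_nonneg_left k3 hkk
    have s5 : D * (k * k * D) ≤ D * (2 * T * A) := mul_le_mul_of_nonneg_left r4 h2.le
    rw [s2]
    nlinarith
  refine ⟨r1, ?_, ?_⟩
  · nlinarith [mul_nonneg hjj h2.le]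
  · refine le_of_mul_le_mul_left (?_ : A * (i * i * A) ≤ A * (16 * T)) h1
    have s1 : A * i = y - (u * j + v * k) := by linarith
    have s2 : A * (i * i * A) = (y - (u * j + v * k)) ^ 2 := by rw [← s1]; ring
    have s3 : 0 ≤ (y + (u * j + v * k)) ^ 2 := sq_nonneg _
    have s3' : 0 ≤ (u * j - v * k) ^ 2 := sq_nonneg _
    have s4 : k * k * (4 * (v * v)) ≤ k * k * (A * A) := mul_le_mul_of_nonneg_left k2 hkk
    have s5 : j * j * (4 * (u * u)) ≤ j * j * (A * A) := mul_le_mul_of_nonneg_left k1 hjj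
    have s6 : k * k * (A * A) ≤ k * k * (2 * D) := mul_le_mul_of_nonneg_left k4 hkk
    have s7 : j * j * (A * A) ≤ j * j * (2 * D) := mul_le_mul_of_nonneg_left k4 hjj
    have hTA : 0 ≤ A * T := le_trans (sq_nonneg y) r3
    rw [s2]
    nlinarith

end Reduction

end V3
end NearCurve

namespace NearCurve

/-! ### Registers and the program for lattice reduction -/

open V3

/-- The vector of variables that starts at register `k`. -/
def vec (k : ℕ) : V3 Expr := ⟨.var k, .var (k + 1), .var (k + 2)⟩

/-- The integral vector stored from register `k` on. -/
def val (k : ℕ) (s : ℕ → ℤ) : V3 ℤ := ⟨s k, s (k + 1), s (k + 2)⟩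

/-- The bilinear form of the current arc, as an expression. -/
def qE (a b : V3 Expr) : Expr := bil (.var 3) (.var 4) (.var 5) (vec 7) (vec 10) a b
/-- The Gram determinant of two vectors in the form of the current arc, as an expression. -/
def gram2E (a b : V3 Expr) : Expr := gram2 (.var 3) (.var 4) (.var 5) (vec 7) (vec 10) a b
/-- The expression for `gramNu` in the form of the current arc. -/
def gramNuE (a b c : V3 Expr) : Expr := gramNu (.var 3) (.var 4) (.var 5) (vec 7) (vec 10) a b c
/-- The expression for `disc` of the current arc. -/
def discE : Expr := disc (.var 3) (.var 4) (.var 5) (vec 7) (vec 10)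

/-- The variables `3, 4, 5` and the vectors at `7` and `10` hold the data of an arc. -/
structure AtArc (P d st : ℤ) (f g : V3 ℤ) (s : ℕ → ℤ) : Prop where
  P : s 3 = P
  d : s 4 = d
  st : s 5 = st
  f : val 7 s = f
  g : val 10 s = g

/-- The assignments of the vector `v` to the registers from `k` on. -/
def setVec (k : ℕ) (v : V3 Expr) : List (ℕ × Expr) := [(k, v.x), (k + 1, v.y), (k + 2, v.z)]

/-- Subtract from the vector at `k` the multiple `e` of the vector at `i`. -/
def reduceBy (e : Expr) (k i : ℕ) : Program :=
  .seq (assign 25 e) (block (setVec k (subMul (vec k) (.var 25) (vec i))))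

/-- The quotient `u / a`, rounded to a nearest integer. -/
def roundE (u a : Expr) : Expr := (2 * u + a) / (2 * a)

/-- Exchange the contents of two registers. -/
def swapReg (k i : ℕ) : List (ℕ × Expr) := [(25, .var k), (k, .var i), (i, .var 25)]

/-- Exchange the vectors at `k` and at `i`. -/
def swapVec (k i : ℕ) : Program :=
  .seq (block (swapReg k i)) (.seq (block (swapReg (k + 1) (i + 1))) (block (swapReg (k + 2) (i + 2))))

/-- Make the basis size-reduced. -/
def sizeReduce : Program :=
  .seq (reduceBy (roundE (qE (vec 15) (vec 18)) (qE (vec 15) (vec 15))) 18 15)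
  (.seq (reduceBy (roundE (gramNuE (vec 15) (vec 18) (vec 21)) (gram2E (vec 15) (vec 18))) 21 18)
    (reduceBy (roundE (qE (vec 15) (vec 21)) (qE (vec 15) (vec 15))) 21 15))

/-- One round of lattice reduction: size reduction, and an exchange if there is a useful one;
otherwise the flag in register `24` is cleared. -/
def reduceRound : Program :=
  .seq sizeReduce
  (ifE (qE (vec 15) (vec 15) * qE (vec 15) (vec 15) - 2 * gram2E (vec 15) (vec 18)) (swapVec 15 18)
  (ifE (gram2E (vec 15) (vec 18) * gram2E (vec 15) (vec 18) -
      2 * .var 14 * qE (vec 15) (vec 15)) (swapVec 18 21)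
  (assign 24 0)))

/-- Lattice reduction: rounds are repeated until the flag in register `24` is cleared. -/
def reduceLoop : Program := whileE (.var 24) reduceRound

/-! ### Correctness of the lattice reduction -/

/-- A tower of bounds for the variables: `lev Y S (i + 1)` bounds expressions of size at most `S` in
variables that are bounded by `lev Y S i`. -/
def lev (Y S i : ℕ) : ℕ := Y ^ S ^ i

theorem lev_mono {Y S i j : ℕ} (hY : 2 ≤ Y) (hS : 1 ≤ S) (h : i ≤ j) : lev Y S i ≤ lev Y S j :=
  Nat.pow_le_pow_right (by omega) (Nat.pow_le_pow_right (by omega) h)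

theorem two_le_lev {Y S : ℕ} (i : ℕ) (hY : 2 ≤ Y) (hS : 1 ≤ S) : 2 ≤ lev Y S i :=
  hY.trans (by simpa [lev] using lev_mono hY hS (Nat.zero_le i))

theorem abs_eval_le_lev {Y S i n : ℕ} (hY : 2 ≤ Y) (hS : 1 ≤ S) {s : ℕ → ℤ}
    (hs : ∀ x < n, |s x| ≤ lev Y S i) {e : Expr} (hb : e.Below n) (he : e.size ≤ S) :
    |e.eval s| ≤ lev Y S (i + 1) := by
  refine (Expr.abs_eval_le (two_le_lev i hY hS) hs e hb).trans ?_
  have h2 := two_le_lev i hY hS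
  have h3 : lev Y S i ^ e.size ≤ lev Y S i ^ S := Nat.pow_le_pow_right (by omega) he
  have h4 : lev Y S i ^ S = lev Y S (i + 1) := by
    simp only [lev]
    rw [← pow_mul, pow_succ]
  rw [h4] at h3
  exact_mod_cast h3

end NearCurve

namespace NearCurve
open V3

/-- The variables of the budget `m` may be as large as the sixth level of the tower over `Y`, and
expressions may have size `10000`, which exceeds the sizes of all expressions in the program. -/
structure Scale (m : Budget) (Y : ℕ) : Prop where
  two_le : 2 ≤ Y
  size_le : 10000 ≤ m.S
  X_eq : m.X = lev Y m.S 6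

section Reduction

variable {m : Budget} {Y : ℕ}

theorem Scale.lev_le (h : Scale m Y) {i : ℕ} (hi : i ≤ 6) : lev Y m.S i ≤ m.X := by
  rw [h.X_eq]
  exact lev_mono h.two_le m.one_le hi

theorem Scale.mono (h : Scale m Y) {i j : ℕ} (hij : i ≤ j) {z : ℤ} (hz : |z| ≤ lev Y m.S i) :
    |z| ≤ lev Y m.S j :=
  hz.trans (by exact_mod_cast lev_mono h.two_le m.one_le hij)

theorem Scale.abs_le (h : Scale m Y) {i : ℕ} (hi : i ≤ 6) {z : ℤ} (hz : |z| ≤ lev Y m.S i) :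
    |z| ≤ m.X :=
  hz.trans (by exact_mod_cast h.lev_le hi)

theorem Scale.eval_le (h : Scale m Y) {i n : ℕ} {s : ℕ → ℤ} (hs : ∀ x < n, |s x| ≤ lev Y m.S i)
    {e : Expr} (hb : e.Below n) (he : e.size ≤ 10000) : |e.eval s| ≤ lev Y m.S (i + 1) :=
  abs_eval_le_lev h.two_le m.one_le hs hb (he.trans h.size_le)

theorem Expr.Below.mono {n n' : ℕ} (h : n ≤ n') : ∀ {e : Expr}, e.Below n → e.Below n'
  | .const _, _ => trivial
  | .var _, hr => lt_of_lt_of_le hr h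
  | .bin _ _ _, hab => ⟨hab.1.mono h, hab.2.mono h⟩

/-- Three assignments that put the vector `w` into the registers from `k` on.  The second and third
expressions are evaluated after the registers before them have been overwritten. -/
theorem ev_setVec {s : ℕ → ℤ} {k : ℕ} {v : V3 Expr} {Q : (ℕ → ℤ) → List Record → Prop}
    (hk : k + 2 < numVars)
    (hb : v.x.Below numVars ∧ v.y.Below numVars ∧ v.z.Below numVars)
    (hsz : v.x.size ≤ m.S ∧ v.y.size ≤ m.S ∧ v.z.size ≤ m.S)
    {w : V3 ℤ} (hx : v.x.eval s = w.x)
    (hy : ∀ z, v.y.eval (Function.update s k z) = w.y)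
    (hz : ∀ z z', v.z.eval (Function.update (Function.update s k z) (k + 1) z') = w.z)
    (hX : |w.x| ≤ m.X ∧ |w.y| ≤ m.X ∧ |w.z| ≤ m.X)
    (hQ : ∀ t, val k t = w → (∀ x, x < k ∨ k + 2 < x → t x = s x) → Q t []) :
    m.Ev (block (setVec k v)) s (block (setVec k v)).ops Q := by
  refine Budget.Ev.block ⟨⟨by omega, hb.1, hsz.1⟩, by rw [hx]; exact hX.1, ⟨by omega, hb.2.1, hsz.2.1⟩,
    by rw [hy]; exact hX.2.1, ⟨by omega, hb.2.2, hsz.2.2⟩, by rw [hz]; exact hX.2.2, trivial⟩ ?_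
  simp only [setVec, runBlock]
  rw [hz, hy, hx]
  refine hQ _ ?_ ?_
  · simp [val]
  · intro x hx
    rw [Function.update_of_ne (by omega), Function.update_of_ne (by omega),
      Function.update_of_ne (by omega)]

/-- Register `25` holds the multiplier, so that the variables climb two levels of the tower: one for
the multiplier, and one for the differences. -/
theorem ev_reduceBy (h : Scale m Y) {s : ℕ → ℤ} {e : Expr} {k i a : ℕ} (hk : k + 2 < 25)
    (hi : i + 2 < 25) (hik : i + 2 < k) (ha : a + 2 ≤ 6)
    (hs : ∀ x < 25, |s x| ≤ lev Y m.S a) (hb : e.Below 25) (he : e.size ≤ 10000)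
    {Q : (ℕ → ℤ) → List Record → Prop}
    (hQ : ∀ t, val k t = subMul (val k s) (e.eval s) (val i s) →
      (∀ x, x < k ∨ k + 2 < x → x ≠ 25 → t x = s x) →
      (∀ x < 25, |t x| ≤ lev Y m.S (a + 2)) → Q t []) :
    m.Ev (reduceBy e k i) s (reduceBy e k i).ops Q := by
  have hV : numVars = 35 := rfl
  have h1 := h.eval_le hs hb he
  refine Budget.Ev.seq (Q := fun t o => t = Function.update s 25 (e.eval s) ∧ o = [])
    (Budget.Ev.assign (by omega) (hb.mono (by omega)) (he.trans h.size_le) (h.abs_le (by omega) h1)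
    ⟨rfl, rfl⟩) ?_
  rintro _ _ ⟨rfl, rfl⟩
  have h2 : ∀ x < 26, |Function.update s 25 (e.eval s) x| ≤ lev Y m.S (a + 1) := by
    intro x hx
    rw [Function.update_apply]
    split_ifs
    · exact h1
    · exact h.mono (by omega) (hs x (by omega))
  have h3 : ∀ y z, y < 25 → z < 25 → |s y - e.eval s * s z| ≤ lev Y m.S (a + 2) := by
    intro y z hy hz
    have := h.eval_le h2 (e := .var y - .var 25 * .var z)
      ⟨by simp only [Expr.Below]; omega, by simp only [Expr.Below]; omega,
        by simp only [Expr.Below]; omega⟩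
      (by show 1 + (1 + 1 + 1) + 1 ≤ 10000; omega)
    have e1 : y ≠ 25 := by omega
    have e2 : z ≠ 25 := by omega
    simpa [Function.update_apply, e1, e2] using this
  have hsz : ∀ y z, (Expr.var y - Expr.var 25 * Expr.var z).size ≤ m.S := fun y z => by
    have := h.size_le
    show 1 + (1 + 1 + 1) + 1 ≤ m.S
    omega
  have hbl : ∀ y z, y < 25 → z < 25 → (Expr.var y - Expr.var 25 * Expr.var z).Below numVars :=
    fun y z hy hz => ⟨by simp only [Expr.Below]; omega, by simp only [Expr.Below]; omega,
      by simp only [Expr.Below]; omega⟩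
  refine ev_setVec (by omega) ⟨hbl _ _ (by omega) (by omega), hbl _ _ (by omega) (by omega),
    hbl _ _ (by omega) (by omega)⟩ ⟨hsz _ _, hsz _ _, hsz _ _⟩
    (w := subMul (val k s) (e.eval s) (val i s)) ?_ ?_ ?_ ?_ ?_
  · have e1 : k ≠ 25 := by omega
    have e2 : i ≠ 25 := by omega
    simp [subMul, vec, val, e1, e2]
  · intro z
    have e1 : k ≠ 24 := by omega
    have e2 : i ≠ 24 := by omega
    have e3 : i + 1 ≠ k := by omega
    have e4 : 25 ≠ k := by omega
    simp [subMul, vec, val, e1, e2, e3, e4]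
  · intro z z'
    have e1 : k ≠ 23 := by omega
    have e2 : i ≠ 23 := by omega
    have e3 : i + 1 ≠ k := by omega
    have e4 : 25 ≠ k := by omega
    have e5 : i + 2 ≠ k := by omega
    have e6 : k ≠ 24 := by omega
    simp [subMul, vec, val, e1, e2, e3, e4, e5, e6]
  · exact ⟨h.abs_le ha (h3 _ _ (by omega) (by omega)), h.abs_le ha (h3 _ _ (by omega) (by omega)),
      h.abs_le ha (h3 _ _ (by omega) (by omega))⟩
  · intro t hv ht
    have ht' : ∀ x, x < k ∨ k + 2 < x → x ≠ 25 → t x = s x := fun x hx hx' => by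
      rw [ht x hx, Function.update_of_ne hx']
    refine hQ t hv ht' ?_
    intro x hx
    by_cases hxk : x < k ∨ k + 2 < x
    · rw [ht' x hxk (by omega)]
      exact h.mono (by omega) (hs x hx)
    · have h4 : x = k ∨ x = k + 1 ∨ x = k + 2 := by omega
      rcases h4 with rfl | rfl | rfl
      · have := congrArg V3.x hv
        simp only [val, subMul] at this
        rw [this]; exact h3 _ _ (by omega) (by omega)
      · have := congrArg V3.y hv
        simp only [val, subMul] at this
        rw [this]; exact h3 _ _ (by omega) (by omega)
      · have := congrArg V3.z hv
        simp only [val, subMul] at this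
        rw [this]; exact h3 _ _ (by omega) (by omega)

theorem ev_swapReg (hS : 1 ≤ m.S) {s : ℕ → ℤ} {k i : ℕ} (hk : k < 25) (hi : i < 25) (hik : k ≠ i) :
    m.Ev (block (swapReg k i)) s (block (swapReg k i)).ops fun t o =>
      o = [] ∧ t k = s i ∧ t i = s k ∧ ∀ x, x ≠ k → x ≠ i → x ≠ 25 → t x = s x := by
  refine Budget.Ev.of_bounded fun hX => ?_
  have hV : numVars = 35 := rfl
  have e1 : k ≠ 25 := by omega
  have e2 : i ≠ 25 := by omega
  refine Budget.Ev.block ⟨⟨by omega, by simp only [Expr.Below]; omega, hS⟩, hX k (by omega),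
    ⟨by omega, by simp only [Expr.Below]; omega, hS⟩, ?_,
    ⟨by omega, by simp only [Expr.Below]; omega, hS⟩, ?_, trivial⟩ ⟨rfl, ?_, ?_, ?_⟩
  · simpa [Function.update_apply, e2] using hX i (by omega)
  · simpa [Function.update_apply, e1.symm] using hX k (by omega)
  · simp [swapReg, runBlock, Function.update_apply, hik, e2]
  · simp [swapReg, runBlock, Function.update_apply, e1.symm]
  · intro x h1 h2 h3
    simp [swapReg, runBlock, Function.update_apply, h1, h2, h3]

theorem ev_swapVec {s : ℕ → ℤ} {k i : ℕ} (hk : k + 2 < 25) (hi : i + 2 < 25) (hik : k + 2 < i) :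
    m.Ev (swapVec k i) s (swapVec k i).ops fun t o =>
      o = [] ∧ val k t = val i s ∧ val i t = val k s ∧
        ∀ x, (x < k ∨ k + 2 < x) → (x < i ∨ i + 2 < x) → x ≠ 25 → t x = s x := by
  refine Budget.Ev.seq (ev_swapReg m.one_le (by omega) (by omega) (by omega)) ?_
  rintro t _ ⟨rfl, h1, h2, h3⟩
  refine Budget.Ev.seq (ev_swapReg m.one_le (by omega) (by omega) (by omega)) ?_
  rintro t' _ ⟨rfl, h1', h2', h3'⟩
  refine Budget.Ev.mono (ev_swapReg m.one_le (by omega) (by omega) (by omega)) le_rfl ?_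
  rintro t'' _ ⟨rfl, h1'', h2'', h3''⟩
  refine ⟨rfl, ?_, ?_, ?_⟩
  · simp only [val, V3.mk.injEq]
    refine ⟨?_, ?_, ?_⟩
    · rw [h3'' _ (by omega) (by omega) (by omega), h3' _ (by omega) (by omega) (by omega), h1]
    · rw [h3'' _ (by omega) (by omega) (by omega), h1', h3 _ (by omega) (by omega) (by omega)]
    · rw [h1'', h3' _ (by omega) (by omega) (by omega), h3 _ (by omega) (by omega) (by omega)]
  · simp only [val, V3.mk.injEq]
    refine ⟨?_, ?_, ?_⟩
    · rw [h3'' _ (by omega) (by omega) (by omega), h3' _ (by omega) (by omega) (by omega), h2]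
    · rw [h3'' _ (by omega) (by omega) (by omega), h2', h3 _ (by omega) (by omega) (by omega)]
    · rw [h2'', h3' _ (by omega) (by omega) (by omega), h3 _ (by omega) (by omega) (by omega)]
  · intro x hx hx' h25
    rw [h3'' _ (by omega) (by omega) h25, h3' _ (by omega) (by omega) h25,
      h3 _ (by omega) (by omega) h25]

end Reduction

end NearCurve

namespace NearCurve
open V3

theorem V3.gram2_comm {P d s : ℤ} {f g : V3 ℤ} (a b : V3 ℤ) :
    gram2 P d s f g b a = gram2 P d s f g a b := by
  simp only [gram2]; rw [bil_comm b a]; ring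

theorem V3.gramNu_subMul_snd {P d s : ℤ} {f g : V3 ℤ} (a b c : V3 ℤ) (r : ℤ) :
    gramNu P d s f g a b (subMul c r b) = gramNu P d s f g a b c - r * gram2 P d s f g a b := by
  simp only [gramNu, gram2, bil_subMul_right]; ring

theorem V3.gramNu_subMul_fst {P d s : ℤ} {f g : V3 ℤ} (a b c : V3 ℤ) (r : ℤ) :
    gramNu P d s f g a b (subMul c r a) = gramNu P d s f g a b c := by
  simp only [gramNu, bil_subMul_right]; rw [bil_comm b a]; ring

theorem V3.gram2_subMul {P d s : ℤ} {f g : V3 ℤ} (a b : V3 ℤ) (r : ℤ) :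
    gram2 P d s f g a (subMul b r a) = gram2 P d s f g a b := by
  simp only [gram2, bil_subMul_right, bil_subMul_left]; rw [bil_comm b a]; ring

section Reduction

variable {m : Budget} {Y : ℕ} {P d st : ℤ} {f g : V3 ℤ}

theorem AtArc.congr {s t : ℕ → ℤ} (h : AtArc P d st f g s) (hst : ∀ x < 15, t x = s x) :
    AtArc P d st f g t := by
  obtain ⟨h1, h2, h3, h4, h5⟩ := h
  refine ⟨?_, ?_, ?_, ?_, ?_⟩
  · rw [hst 3 (by omega), h1]
  · rw [hst 4 (by omega), h2]
  · rw [hst 5 (by omega), h3]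
  · rw [← h4]; simp only [val]; rw [hst 7 (by omega), hst 8 (by omega), hst 9 (by omega)]
  · rw [← h5]; simp only [val]; rw [hst 10 (by omega), hst 11 (by omega), hst 12 (by omega)]

theorem AtArc.eval_qE {s : ℕ → ℤ} (h : AtArc P d st f g s) (i j : ℕ) :
    (qE (vec i) (vec j)).eval s = bil P d st f g (val i s) (val j s) := by
  obtain ⟨rfl, rfl, rfl, rfl, rfl⟩ := h
  rfl

theorem AtArc.eval_gram2E {s : ℕ → ℤ} (h : AtArc P d st f g s) (i j : ℕ) :
    (gram2E (vec i) (vec j)).eval s = gram2 P d st f g (val i s) (val j s) := by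
  obtain ⟨rfl, rfl, rfl, rfl, rfl⟩ := h
  rfl

theorem AtArc.eval_gramNuE {s : ℕ → ℤ} (h : AtArc P d st f g s) (i j k : ℕ) :
    (gramNuE (vec i) (vec j) (vec k)).eval s =
      gramNu P d st f g (val i s) (val j s) (val k s) := by
  obtain ⟨rfl, rfl, rfl, rfl, rfl⟩ := h
  rfl

/-- The state during lattice reduction: a basis of `ℤ³` whose Gram determinants do not exceed the
initial ones, with all variables in use bounded. -/
structure LatticeState (m : Budget) (Y : ℕ) (P d st : ℤ) (f g : V3 ℤ) (D₁ D₂ : ℤ) (s : ℕ → ℤ) :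
    Prop where
  arc : AtArc P d st f g s
  D₃ : s 14 = P * P * (disc P d st f g * disc P d st f g)
  det : det (val 15 s) (val 18 s) (val 21 s) * det (val 15 s) (val 18 s) (val 21 s) = 1
  fst_le : bil P d st f g (val 15 s) (val 15 s) ≤ D₁
  snd_le : gram2 P d st f g (val 15 s) (val 18 s) ≤ D₂
  bound : ∀ x < 25, |s x| ≤ lev Y m.S 2

theorem val_congr {s t : ℕ → ℤ} {k : ℕ} (h : ∀ x, k ≤ x → x ≤ k + 2 → t x = s x) :
    val k t = val k s := by
  simp only [val]
  rw [h k (by omega) (by omega), h (k + 1) (by omega) (by omega), h (k + 2) (by omega) (by omega)]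

theorem abs_le_of_val {s : ℕ → ℤ} {k : ℕ} {Z : ℤ} {w : V3 ℤ} (h : val k s = w)
    (hw : |w.x| ≤ Z ∧ |w.y| ≤ Z ∧ |w.z| ≤ Z) : ∀ x, k ≤ x → x ≤ k + 2 → |s x| ≤ Z := by
  subst h
  intro x h1 h2
  have h4 : x = k ∨ x = k + 1 ∨ x = k + 2 := by omega
  rcases h4 with rfl | rfl | rfl
  · exact hw.1
  · exact hw.2.1
  · exact hw.2.2

/-- Intermediate values climb to higher levels of the tower, but the new basis vectors are back at
level `2`: they are bounded by the form, hence by the Gram determinants, which do not increase. -/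
theorem ev_sizeReduce (hY : Scale m Y) (hP : 0 < P) (hd : 0 < d) {D₁ D₂ : ℤ}
    (hD : D₁ + D₂ + P * P * (disc P d st f g * disc P d st f g) ≤ lev Y m.S 2) {s : ℕ → ℤ}
    (h : LatticeState m Y P d st f g D₁ D₂ s) :
    m.Ev sizeReduce s sizeReduce.ops fun t o => o = [] ∧ LatticeState m Y P d st f g D₁ D₂ t ∧
      (∀ x < 15, t x = s x) ∧ t 24 = s 24 ∧ val 15 t = val 15 s ∧
      gram2 P d st f g (val 15 t) (val 18 t) = gram2 P d st f g (val 15 s) (val 18 s) ∧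
      SizeReduced P d st f g (val 15 t) (val 18 t) (val 21 t) := by
  have hdet : V3.det (val 15 s) (val 18 s) (val 21 s) ≠ 0 := fun hc => by
    have := h.det
    rw [hc] at this
    simp at this
  obtain ⟨p1, p2⟩ := gram2_pos (s := st) (f := f) (g := g) hP hd hdet
  have p3 := disc_pos (s := st) (f := f) (g := g) hP hd
  have p4 : 0 < P * P * (disc P d st f g * disc P d st f g) := by positivity
  refine Budget.Ev.seq (Q := fun t o => o = [] ∧
    (∀ x, x < 18 ∨ 20 < x → x ≠ 25 → t x = s x) ∧ (∀ x < 25, |t x| ≤ lev Y m.S 2) ∧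
    (∃ r, val 18 t = subMul (val 18 s) r (val 15 s)) ∧
    |2 * bil P d st f g (val 15 s) (val 18 t)| ≤ bil P d st f g (val 15 s) (val 15 s)) ?_ ?_
  · refine ev_reduceBy (a := 2) hY (by omega) (by omega) (by omega) (by omega) h.bound
      (by decide +kernel) (by decide +kernel) ?_
    intro t h1 h2 _
    have e : (roundE (qE (vec 15) (vec 18)) (qE (vec 15) (vec 15))).eval s =
        (2 * bil P d st f g (val 15 s) (val 18 s) + bil P d st f g (val 15 s) (val 15 s)) /
          (2 * bil P d st f g (val 15 s) (val 15 s)) := by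
      simp only [roundE, Expr.eval_div, Expr.eval_add, Expr.eval_mul, Expr.eval_ofNat, h.arc.eval_qE]
    rw [e] at h1
    have h3 : |2 * bil P d st f g (val 15 s) (val 18 t)| ≤
        bil P d st f g (val 15 s) (val 15 s) := by
      rw [h1, bil_subMul_right]
      exact abs_sub_round_le p1
    refine ⟨rfl, h2, ?_, ⟨_, h1⟩, h3⟩
    have e2 : gram2 P d st f g (val 15 s) (val 18 t) = gram2 P d st f g (val 15 s) (val 18 s) := by
      rw [h1, gram2_subMul]
    have h4 := bil_snd_le h3 p1 (by rw [e2]; exact p2)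
    rw [e2] at h4
    intro x hx
    by_cases hx' : x < 18 ∨ 20 < x
    · rw [h2 x hx' (by omega)]; exact h.bound x hx
    · refine abs_le_of_val (k := 18) rfl ?_ x (by omega) (by omega)
      have h5 := abs_le_bil (s := st) (f := f) (g := g) hP hd (val 18 t)
      have h6 : bil P d st f g (val 18 t) (val 18 t) ≤ lev Y m.S 2 := by
        have := h.fst_le; have := h.snd_le
        linarith
      exact ⟨h5.1.trans h6, h5.2.1.trans h6, h5.2.2.trans h6⟩
  rintro t _ ⟨rfl, ht, htb, ⟨r, hr⟩, hab⟩
  have ht15 : ∀ x < 15, t x = s x := fun x hx => ht x (by omega) (by omega)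
  have v15 : val 15 t = val 15 s := val_congr fun x h1 h2 => ht x (by omega) (by omega)
  have v21 : val 21 t = val 21 s := val_congr fun x h1 h2 => ht x (by omega) (by omega)
  have arc := h.arc.congr ht15
  rw [← v15] at hab
  have e2 : gram2 P d st f g (val 15 t) (val 18 t) = gram2 P d st f g (val 15 s) (val 18 s) := by
    rw [hr, v15, gram2_subMul]
  refine Budget.Ev.seq (Q := fun u o => o = [] ∧
    (∀ x, x < 21 ∨ 23 < x → x ≠ 25 → u x = t x) ∧ (∀ x < 25, |u x| ≤ lev Y m.S 4) ∧
    (∃ r, val 21 u = subMul (val 21 t) r (val 18 t)) ∧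
    |2 * gramNu P d st f g (val 15 t) (val 18 t) (val 21 u)| ≤
      gram2 P d st f g (val 15 t) (val 18 t)) ?_ ?_
  · refine ev_reduceBy (a := 2) hY (by omega) (by omega) (by omega) (by omega) htb
      (by decide +kernel) (by decide +kernel) ?_
    intro u h1 h2 hb
    have e : (roundE (gramNuE (vec 15) (vec 18) (vec 21)) (gram2E (vec 15) (vec 18))).eval t =
        (2 * gramNu P d st f g (val 15 t) (val 18 t) (val 21 t) +
          gram2 P d st f g (val 15 t) (val 18 t)) /
          (2 * gram2 P d st f g (val 15 t) (val 18 t)) := by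
      simp only [roundE, Expr.eval_div, Expr.eval_add, Expr.eval_mul, Expr.eval_ofNat,
        arc.eval_gram2E, arc.eval_gramNuE]
    rw [e] at h1
    refine ⟨rfl, h2, hb, ⟨_, h1⟩, ?_⟩
    rw [h1, gramNu_subMul_snd]
    exact abs_sub_round_le (by rw [e2]; exact p2)
  rintro u _ ⟨rfl, hu, hub, ⟨r', hr'⟩, hnu⟩
  have hu15 : ∀ x < 15, u x = s x := fun x hx => by rw [hu x (by omega) (by omega), ht15 x hx]
  have w15 : val 15 u = val 15 s := by
    rw [← v15]; exact val_congr fun x h1 h2 => hu x (by omega) (by omega)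
  have w18 : val 18 u = val 18 t := val_congr fun x h1 h2 => hu x (by omega) (by omega)
  have arc' := h.arc.congr hu15
  refine ev_reduceBy (a := 4) hY (by omega) (by omega) (by omega) (by omega) hub
      (by decide +kernel) (by decide +kernel) ?_
  intro w h1 h2 _
  have e : (roundE (qE (vec 15) (vec 21)) (qE (vec 15) (vec 15))).eval u =
      (2 * bil P d st f g (val 15 s) (val 21 u) + bil P d st f g (val 15 s) (val 15 s)) /
        (2 * bil P d st f g (val 15 s) (val 15 s)) := by
    simp only [roundE, Expr.eval_div, Expr.eval_add, Expr.eval_mul, Expr.eval_ofNat, arc'.eval_qE,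
      w15]
  rw [e, w15] at h1
  have hw15 : ∀ x < 15, w x = s x := fun x hx => by rw [h2 x (by omega) (by omega), hu15 x hx]
  have y15 : val 15 w = val 15 s := by
    rw [← w15]; exact val_congr fun x h1 h3 => h2 x (by omega) (by omega)
  have y18 : val 18 w = val 18 t := by
    rw [← w18]; exact val_congr fun x h1 h3 => h2 x (by omega) (by omega)
  have e3 : gram2 P d st f g (val 15 w) (val 18 w) = gram2 P d st f g (val 15 s) (val 18 s) := by
    rw [y15, y18, ← e2, v15]
  have hred : SizeReduced P d st f g (val 15 w) (val 18 w) (val 21 w) := by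
    refine ⟨?_, ?_, ?_⟩
    · rwa [y15, y18, ← v15]
    · rw [y15, h1, bil_subMul_right]
      exact abs_sub_round_le p1
    · rw [y15, y18, h1, gramNu_subMul_fst, ← v15]
      exact hnu
  have hdet' : V3.det (val 15 w) (val 18 w) (val 21 w) =
      V3.det (val 15 s) (val 18 s) (val 21 s) := by
    rw [y15, y18, h1, hr', hr, v21]
    simp only [V3.det, dot, cross, subMul]; ring
  have e4 : gram3 P d st f g (val 15 w) (val 18 w) (val 21 w) =
      P * P * (disc P d st f g * disc P d st f g) := by
    rw [gram3_eq hP, hdet', h.det, mul_one]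
  refine ⟨rfl, ⟨h.arc.congr hw15, ?_, ?_, ?_, ?_, ?_⟩, hw15, ?_, y15, e3, hred⟩
  · rw [hw15 14 (by omega), h.D₃]
  · rw [hdet', h.det]
  · rw [y15]; exact h.fst_le
  · rw [e3]; exact h.snd_le
  · intro x hx
    by_cases hx' : x < 21 ∨ 23 < x
    · rw [h2 x hx' (by omega), hu x hx' (by omega)]
      exact htb x hx
    · refine abs_le_of_val (k := 21) rfl ?_ x (by omega) (by omega)
      have h5 := abs_le_bil (s := st) (f := f) (g := g) hP hd (val 21 w)
      have h6 := hred.bil_thd_le (by rw [y15]; exact p1) (by rw [e3]; exact p2)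
        (by rw [e4]; exact p4)
      rw [e3, e4, y15] at h6
      have h7 : bil P d st f g (val 21 w) (val 21 w) ≤ lev Y m.S 2 := by
        have := h.fst_le; have := h.snd_le
        linarith
      exact ⟨h5.1.trans h7, h5.2.1.trans h7, h5.2.2.trans h7⟩
  · rw [h2 24 (by omega) (by omega), hu 24 (by omega) (by omega), ht 24 (by omega) (by omega)]

/-- The potential of lattice reduction: the product of the first two Gram determinants. -/
def potential (P d st : ℤ) (f g : V3 ℤ) (s : ℕ → ℤ) : ℤ :=
  bil P d st f g (val 15 s) (val 15 s) * gram2 P d st f g (val 15 s) (val 18 s)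

/-- The Gram determinants of a basis of `ℤ³` are positive, and the third one is the number in
register `14`, whatever the basis. -/
theorem LatticeState.pos (hP : 0 < P) (hd : 0 < d) {D₁ D₂ : ℤ} {s : ℕ → ℤ}
    (h : LatticeState m Y P d st f g D₁ D₂ s) :
    0 < bil P d st f g (val 15 s) (val 15 s) ∧
    0 < gram2 P d st f g (val 15 s) (val 18 s) ∧
    gram3 P d st f g (val 15 s) (val 18 s) (val 21 s) = s 14 ∧ 0 < s 14 := by
  have hdet : V3.det (val 15 s) (val 18 s) (val 21 s) ≠ 0 := fun hc => by
    have := h.det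
    rw [hc] at this
    simp at this
  obtain ⟨p1, p2⟩ := gram2_pos (s := st) (f := f) (g := g) hP hd hdet
  have p3 := disc_pos (s := st) (f := f) (g := g) hP hd
  refine ⟨p1, p2, ?_, ?_⟩
  · rw [gram3_eq hP, h.det, h.D₃, mul_one]
  · rw [h.D₃]; positivity

/-- A round either multiplies the potential by at most `3 / 4` or finds the basis reduced. -/
theorem ev_reduceRound (hY : Scale m Y) (hP : 0 < P) (hd : 0 < d) {D₁ D₂ : ℤ}
    (hD : D₁ + D₂ + P * P * (disc P d st f g * disc P d st f g) ≤ lev Y m.S 2) {s : ℕ → ℤ}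
    (h : LatticeState m Y P d st f g D₁ D₂ s) :
    m.Ev reduceRound s reduceRound.ops fun t o => o = [] ∧
      LatticeState m Y P d st f g D₁ D₂ t ∧ (∀ x < 15, t x = s x) ∧
      (t 24 = s 24 ∧ 4 * potential P d st f g t ≤ 3 * potential P d st f g s ∨
        t 24 = 0 ∧ Reduced P d st f g (val 15 t) (val 18 t) (val 21 t)) := by
  refine Budget.Ev.seq (ev_sizeReduce hY hP hd hD h) ?_
  rintro t _ ⟨rfl, ht, ht15, h24, v15, eg, hred⟩
  obtain ⟨p1, p2, e3, p3⟩ := ht.pos hP hd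
  have hpot : potential P d st f g t = potential P d st f g s := by
    simp only [potential]
    rw [eg, v15]
  have hsz := hY.size_le
  rw [← hpot, ← h24]
  refine Budget.Ev.ifE_ops (by decide +kernel)
    (le_trans (by decide +kernel : _ ≤ 10000) hsz) ?_ ?_
  · intro hc
    simp only [Expr.eval_sub, Expr.eval_mul, Expr.eval_ofNat, ht.arc.eval_qE,
      ht.arc.eval_gram2E] at hc
    have hlt := hred.swap_fst p1 (by linarith)
    refine Budget.Ev.mono (ev_swapVec (by omega) (by omega) (by omega)) le_rfl ?_
    rintro u _ ⟨rfl, h1, h2, h3⟩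
    have hu15 : ∀ x < 15, u x = t x := fun x hx => h3 x (by omega) (by omega) (by omega)
    have v21 : val 21 u = val 21 t := val_congr fun x h1 h2 => h3 x (by omega) (by omega) (by omega)
    have hle : bil P d st f g (val 18 t) (val 18 t) ≤ bil P d st f g (val 15 t) (val 15 t) := by
      linarith
    have eg2 : gram2 P d st f g (val 15 u) (val 18 u) = gram2 P d st f g (val 15 t) (val 18 t) := by
      rw [h1, h2, gram2_comm]
    refine ⟨rfl, ⟨ht.arc.congr hu15, ?_, ?_, ?_, ?_, ?_⟩, fun x hx => by rw [hu15 x hx, ht15 x hx],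
      Or.inl ⟨h3 24 (by omega) (by omega) (by omega), ?_⟩⟩
    · rw [hu15 14 (by omega), ht.D₃]
    · rw [h1, h2, v21, ← ht.det]
      simp only [V3.det, dot, cross]; ring
    · rw [h1]; exact hle.trans ht.fst_le
    · rw [eg2]; exact ht.snd_le
    · intro x hx
      by_cases hx1 : x < 15 ∨ 20 < x
      · rw [h3 x (by omega) (by omega) (by omega)]; exact ht.bound x hx
      · by_cases hx2 : x ≤ 17
        · exact abs_le_of_val h1 ⟨ht.bound 18 (by omega), ht.bound 19 (by omega),
            ht.bound 20 (by omega)⟩ x (by omega) (by omega)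
        · exact abs_le_of_val h2 ⟨ht.bound 15 (by omega), ht.bound 16 (by omega),
            ht.bound 17 (by omega)⟩ x (by omega) (by omega)
    · simp only [potential]
      rw [eg2, h1]
      nlinarith
  intro hc1
  simp only [Expr.eval_sub, Expr.eval_mul, Expr.eval_ofNat, ht.arc.eval_qE,
    ht.arc.eval_gram2E] at hc1
  refine Budget.Ev.ifE_ops (by decide +kernel)
    (le_trans (by decide +kernel : _ ≤ 10000) hsz) ?_ ?_
  · intro hc
    simp only [Expr.eval_sub, Expr.eval_mul, Expr.eval_ofNat, Expr.eval_var, ht.arc.eval_qE,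
      ht.arc.eval_gram2E, ← e3] at hc
    have hlt := hred.swap_snd p2 (by linarith)
    refine Budget.Ev.mono (ev_swapVec (by omega) (by omega) (by omega)) le_rfl ?_
    rintro u _ ⟨rfl, h1, h2, h3⟩
    have hu15 : ∀ x < 15, u x = t x := fun x hx => h3 x (by omega) (by omega) (by omega)
    have v15 : val 15 u = val 15 t := val_congr fun x h1 h2 => h3 x (by omega) (by omega) (by omega)
    refine ⟨rfl, ⟨ht.arc.congr hu15, ?_, ?_, ?_, ?_, ?_⟩, fun x hx => by rw [hu15 x hx, ht15 x hx],
      Or.inl ⟨h3 24 (by omega) (by omega) (by omega), ?_⟩⟩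
    · rw [hu15 14 (by omega), ht.D₃]
    · rw [h1, h2, v15, ← ht.det]
      simp only [V3.det, dot, cross]; ring
    · rw [v15]; exact ht.fst_le
    · rw [h1, v15]
      have := ht.snd_le
      linarith
    · intro x hx
      by_cases hx1 : x < 18 ∨ 23 < x
      · rw [h3 x (by omega) (by omega) (by omega)]; exact ht.bound x hx
      · by_cases hx2 : x ≤ 20
        · exact abs_le_of_val h1 ⟨ht.bound 21 (by omega), ht.bound 22 (by omega),
            ht.bound 23 (by omega)⟩ x (by omega) (by omega)
        · exact abs_le_of_val h2 ⟨ht.bound 18 (by omega), ht.bound 19 (by omega),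
            ht.bound 20 (by omega)⟩ x (by omega) (by omega)
    · simp only [potential]
      rw [h1, v15]
      nlinarith
  · intro hc2
    simp only [Expr.eval_sub, Expr.eval_mul, Expr.eval_ofNat, Expr.eval_var, ht.arc.eval_qE,
      ht.arc.eval_gram2E, ← e3] at hc2
    refine Budget.Ev.assign (by decide) (by decide +kernel) m.one_le (by simp) ?_
    obtain ⟨u, hu, hu24, hudef⟩ : ∃ u : ℕ → ℤ, (∀ x, x ≠ 24 → u x = t x) ∧ u 24 = 0 ∧
        Function.update t 24 ((0 : Expr).eval t) = u :=
      ⟨_, fun x hx => Function.update_of_ne hx _ _, Function.update_self _ _ _, rfl⟩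
    rw [hudef]
    have hu15 : ∀ x < 15, u x = t x := fun x hx => hu x (by omega)
    have v15 : val 15 u = val 15 t := val_congr fun x h1 h2 => hu x (by omega)
    have v18 : val 18 u = val 18 t := val_congr fun x h1 h2 => hu x (by omega)
    have v21 : val 21 u = val 21 t := val_congr fun x h1 h2 => hu x (by omega)
    refine ⟨rfl, ⟨ht.arc.congr hu15, ?_, ?_, ?_, ?_, ?_⟩, fun x hx => by rw [hu15 x hx, ht15 x hx],
      Or.inr ⟨hu24, ?_⟩⟩
    · rw [hu15 14 (by omega), ht.D₃]
    · rw [v15, v18, v21, ht.det]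
    · rw [v15]; exact ht.fst_le
    · rw [v15, v18]; exact ht.snd_le
    · intro x hx
      by_cases h1 : x = 24
      · rw [h1, hu24]; simp
      · rw [hu x h1]; exact ht.bound x hx
    · rw [v15, v18, v21]
      exact ⟨hred, by linarith, by linarith⟩

/-- The loop terminates because the potential is a positive integer. -/
theorem ev_reduceLoop (hY : Scale m Y) (hP : 0 < P) (hd : 0 < d) {D₁ D₂ : ℤ}
    (hD : D₁ + D₂ + P * P * (disc P d st f g * disc P d st f g) ≤ lev Y m.S 2) {s : ℕ → ℤ}
    (h : LatticeState m Y P d st f g D₁ D₂ s) (h24 : 0 < s 24) {k : ℕ}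
    (hk : potential P d st f g s * 3 ^ k < 4 ^ k) :
    m.Ev reduceLoop s ((k + 1) * (reduceRound.ops + 3)) fun t o => o = [] ∧
      LatticeState m Y P d st f g D₁ D₂ t ∧ (∀ x < 15, t x = s x) ∧
      Reduced P d st f g (val 15 t) (val 18 t) (val 21 t) := by
  have hsz := hY.size_le
  refine Budget.Ev.mono (Budget.Ev.whileE (e := .var 24) (n := reduceRound.ops) (by decide)
    m.one_le (I := fun k t acc => acc = [] ∧
      LatticeState m Y P d st f g D₁ D₂ t ∧ (∀ x < 15, t x = s x) ∧
      (0 < t 24 ∧ potential P d st f g t * 3 ^ k < 4 ^ k ∨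
        t 24 = 0 ∧ Reduced P d st f g (val 15 t) (val 18 t) (val 21 t))) ?_ k s
    ⟨rfl, h, fun _ _ => rfl, Or.inl ⟨h24, hk⟩⟩) (by simp [Expr.compile, Program.ops]) ?_
  · rintro k t _ ⟨rfl, ht, ht15, hor⟩ (hpos : 0 < t 24)
    rcases hor with ⟨_, hpot⟩ | ⟨h0, _⟩
    swap
    · omega
    obtain ⟨p1, p2, _, _⟩ := ht.pos hP hd
    have p : 0 < potential P d st f g t := mul_pos p1 p2
    cases k with
    | zero => simp at hpot; omega
    | succ k =>
      refine ⟨k, rfl, Budget.Ev.mono (ev_reduceRound hY hP hd hD ht) le_rfl ?_⟩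
      rintro u _ ⟨rfl, hu, hu15, hor⟩
      refine ⟨rfl, hu, fun x hx => by rw [hu15 x hx, ht15 x hx], ?_⟩
      rcases hor with ⟨h1, h2⟩ | h1
      · refine Or.inl ⟨by rw [h1]; exact hpos, ?_⟩
        have h3 : (0 : ℤ) < 3 ^ k := by positivity
        rw [pow_succ, pow_succ] at hpot
        nlinarith
      · exact Or.inr h1
  · rintro t o ⟨hle, k', rfl, ht, ht15, hor⟩
    refine ⟨rfl, ht, ht15, ?_⟩
    rcases hor with ⟨h1, _⟩ | ⟨_, h1⟩
    · exact absurd hle (not_le.2 h1)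
    · exact h1

end Reduction
end NearCurve

namespace NearCurve
open V3

/-! ### Enumeration of lattice points -/

/-- A vector as a function on `Fin 3`. -/
def V3.fn (w : V3 ℤ) : Fin 3 → ℤ := ![w.x, w.y, w.z]

/-- Write the point with coordinate vector `v` to the output. -/
def emitVec (v : V3 Expr) : Program :=
  .seq (block (setVec 29 v)) (.emitPoint ![29, 30, 31])

/-- The combinations `c₁ b₁ ± c₂ b₂ ± c₃ b₃`, with signs chosen by the arguments. -/
def signedComb (p r : Bool) : V3 Expr :=
  let v := if p then addMul (smul (.var 28) (vec 15)) (.var 27) (vec 18)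
    else subMul (smul (.var 28) (vec 15)) (.var 27) (vec 18)
  if r then addMul v (.var 26) (vec 21) else subMul v (.var 26) (vec 21)

/-- Write the four vectors with coefficients `c₁`, `± c₂`, `± c₃`. -/
def emitAll : Program :=
  .seq (emitVec (signedComb true true)) (.seq (emitVec (signedComb true false))
    (.seq (emitVec (signedComb false true)) (emitVec (signedComb false false))))

/-- Positive exactly if `c₁² D₁ ≤ 16 T`; the summand `1` turns `≤` into `<`. -/
def guard₁ : Expr := 16 * .var 13 - .var 28 * .var 28 * qE (vec 15) (vec 15) + 1
/-- Positive exactly if `c₂² D₂ ≤ 4 T D₁`. -/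
def guard₂ : Expr := 4 * .var 13 * qE (vec 15) (vec 15) -
  .var 27 * .var 27 * gram2E (vec 15) (vec 18) + 1
/-- Positive exactly if `c₃² D₃ ≤ T D₂`. -/
def guard₃ : Expr := .var 13 * gram2E (vec 15) (vec 18) - .var 26 * .var 26 * .var 14 + 1

/-- A pass of the innermost loop, over `c₁`.  The coefficients are nonnegative, and the test
excludes the zero vector. -/
def body₁ : Program :=
  .seq (ifE (.var 28 + .var 27 + .var 26) emitAll (block [])) (assign 28 (.var 28 + 1))
/-- A pass of the middle loop, over `c₂`. -/
def body₂ : Program :=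
  .seq (assign 28 0) (.seq (whileE guard₁ body₁) (assign 27 (.var 27 + 1)))
/-- A pass of the outermost loop, over `c₃`. -/
def body₃ : Program :=
  .seq (assign 27 0) (.seq (whileE guard₂ body₂) (assign 26 (.var 26 + 1)))

/-- Write all combinations of the basis with coefficients `c₃, c₂, c₁` (in registers `26, 27, 28`)
such that `c₃² D₃ ≤ T D₂`, `c₂² D₂ ≤ 4 T D₁` and `c₁² D₁ ≤ 16 T`, up to sign. -/
def enumerate : Program :=
  .seq (assign 25 0) (.seq (assign 26 0) (whileE guard₃ body₃))

/-- The output consists of at most `n` points with nonzero coordinate vectors bounded by `X`. -/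
def PointList (X n : ℕ) (o : List Record) : Prop :=
  o.length ≤ n ∧ ∀ R ∈ o, ∃ w : V3 ℤ, R = .point w.fn ∧ w ≠ ⟨0, 0, 0⟩ ∧
    |w.x| ≤ X ∧ |w.y| ≤ X ∧ |w.z| ≤ X

theorem PointList.append {X n n' : ℕ} {o o' : List Record} (h : PointList X n o)
    (h' : PointList X n' o') : PointList X (n + n') (o ++ o') := by
  refine ⟨by have := h.1; have := h'.1; simp only [List.length_append]; omega, fun R hR => ?_⟩
  rcases List.mem_append.1 hR with hR | hR
  · exact h.2 R hR
  · exact h'.2 R hR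

theorem PointList.flatMap {X n M : ℕ} {os : ℕ → List Record}
    (h : ∀ i < M, PointList X n (os i)) : PointList X (M * n) ((List.range M).flatMap os) := by
  constructor
  · rw [List.length_flatMap]
    refine (List.sum_le_card_nsmul _ n ?_).trans (by simp)
    intro x hx
    obtain ⟨i, hi, rfl⟩ := List.mem_map.1 hx
    exact (h i (List.mem_range.1 hi)).1
  · intro R hR
    obtain ⟨i, hi, hR⟩ := List.mem_flatMap.1 hR
    exact (h i (List.mem_range.1 hi)).2 R hR

/-- The number of passes of a loop with guard `i² b ≤ a`. -/
theorem exists_count {a b : ℤ} (ha : 0 ≤ a) (hb : 0 < b) : ∃ M : ℕ,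
    (∀ i : ℕ, (i : ℤ) * i * b ≤ a ↔ i < M) ∧ 1 ≤ M ∧ (M : ℤ) ≤ a + 1 ∧
      (b ≤ a → (M : ℤ) * M * b ≤ 4 * a) := by
  lift a to ℕ using ha
  lift b to ℕ using hb.le
  have hb' : 0 < b := by exact_mod_cast hb
  have key : ∀ i : ℕ, i * i * b ≤ a ↔ i < Nat.sqrt (a / b) + 1 := fun i => by
    rw [Nat.lt_succ_iff, Nat.le_sqrt, Nat.le_div_iff_mul_le hb']
  refine ⟨Nat.sqrt (a / b) + 1, fun i => ?_, by omega, ?_, ?_⟩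
  · rw [← key i]; norm_cast
  · have h1 := Nat.sqrt_le_self (a / b)
    have h2 := Nat.div_le_self a b
    push_cast
    omega
  · intro hba
    have h1 : 1 ≤ Nat.sqrt (a / b) := by
      rw [Nat.le_sqrt]
      exact Nat.div_pos (by exact_mod_cast hba) hb'
    have h2 := (key (Nat.sqrt (a / b))).2 (by omega)
    generalize Nat.sqrt (a / b) = r at *
    have h3 : (r + 1) * (r + 1) * b ≤ 4 * (r * r * b) := by
      rw [← mul_assoc]
      refine Nat.mul_le_mul_right _ ?_
      nlinarith
    exact_mod_cast h3.trans (by omega)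

section Enumeration

variable {m : Budget} {Y : ℕ} {P d st : ℤ} {f g : V3 ℤ}

/-- If the expressions only read registers below `k`, the order of the assignments does not matter.
-/
theorem ev_setVec_fresh {s : ℕ → ℤ} {k : ℕ} {v : V3 Expr} {Q : (ℕ → ℤ) → List Record → Prop}
    (hk : k + 2 < numVars) (hb : v.x.Below k ∧ v.y.Below k ∧ v.z.Below k)
    (hsz : v.x.size ≤ m.S ∧ v.y.size ≤ m.S ∧ v.z.size ≤ m.S)
    (hX : |v.x.eval s| ≤ m.X ∧ |v.y.eval s| ≤ m.X ∧ |v.z.eval s| ≤ m.X)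
    (hQ : ∀ t, val k t = ⟨v.x.eval s, v.y.eval s, v.z.eval s⟩ →
      (∀ x, x < k ∨ k + 2 < x → t x = s x) → Q t []) :
    m.Ev (block (setVec k v)) s (block (setVec k v)).ops Q := by
  refine ev_setVec hk ⟨hb.1.mono (by omega), hb.2.1.mono (by omega), hb.2.2.mono (by omega)⟩ hsz
    (w := ⟨v.x.eval s, v.y.eval s, v.z.eval s⟩) rfl (fun z => ?_) (fun z z' => ?_) hX hQ
  · exact Expr.eval_congr (fun r hr => Function.update_of_ne (by omega) _ _) _ hb.2.1
  · exact Expr.eval_congr (fun r hr => by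
      rw [Function.update_of_ne (by omega), Function.update_of_ne (by omega)]) _ hb.2.2

theorem ev_emitVec (hY : Scale m Y) {s : ℕ → ℤ} {v : V3 Expr}
    (hs : ∀ x < 29, |s x| ≤ lev Y m.S 3)
    (hb : v.x.Below 29 ∧ v.y.Below 29 ∧ v.z.Below 29)
    (hsz : v.x.size ≤ 10000 ∧ v.y.size ≤ 10000 ∧ v.z.size ≤ 10000) {w : V3 ℤ}
    (hw : w = ⟨v.x.eval s, v.y.eval s, v.z.eval s⟩) (hw0 : w ≠ ⟨0, 0, 0⟩) :
    m.Ev (emitVec v) s (emitVec v).ops fun t o => (∀ x < 29, t x = s x) ∧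
      PointList m.X 1 o ∧ .point w.fn ∈ o := by
  have hX : |w.x| ≤ m.X ∧ |w.y| ≤ m.X ∧ |w.z| ≤ m.X := by
    rw [hw]
    exact ⟨hY.abs_le (by omega) (hY.eval_le hs hb.1 hsz.1),
      hY.abs_le (by omega) (hY.eval_le hs hb.2.1 hsz.2.1),
      hY.abs_le (by omega) (hY.eval_le hs hb.2.2 hsz.2.2)⟩
  have h1 := hY.size_le
  refine Budget.Ev.seq (Q := fun t o => o = [] ∧ val 29 t = w ∧ ∀ x < 29, t x = s x) ?_ ?_
  · refine ev_setVec_fresh (by decide) hb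
      ⟨hsz.1.trans h1, hsz.2.1.trans h1, hsz.2.2.trans h1⟩ ?_ ?_
    · rw [hw] at hX; exact hX
    · intro t h2 h3
      exact ⟨rfl, h2.trans hw.symm, fun x hx => h3 x (by omega)⟩
  · rintro t _ ⟨rfl, h2, h3⟩
    refine Budget.Ev.emitPoint (by intro i; fin_cases i <;> decide) ?_
    have h4 : (fun i => t ((![29, 30, 31] : Fin 3 → ℕ) i)) = w.fn := by
      rw [← h2]
      funext i
      fin_cases i <;> rfl
    rw [h4]
    exact ⟨h3, ⟨by simp, fun R hR => ⟨w, by simpa using hR, hw0, hX⟩⟩, by simp⟩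

theorem comb_ne_zero {a b c : V3 ℤ} (h : V3.det a b c ≠ 0) {i j k : ℤ}
    (hijk : i ≠ 0 ∨ j ≠ 0 ∨ k ≠ 0) : comb i j k a b c ≠ ⟨0, 0, 0⟩ := by
  intro hc
  have h0 : ∀ b c : V3 ℤ, V3.det ⟨0, 0, 0⟩ b c = 0 := fun b c => by simp [V3.det, dot]
  have e1 : V3.det (comb i j k a b c) b c = i * V3.det a b c := by
    simp only [comb, V3.det, dot, cross, addMul, smul]; ring
  have e2 : V3.det (comb i j k a b c) c a = j * V3.det a b c := by
    simp only [comb, V3.det, dot, cross, addMul, smul]; ring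
  have e3 : V3.det (comb i j k a b c) a b = k * V3.det a b c := by
    simp only [comb, V3.det, dot, cross, addMul, smul]; ring
  rw [hc, h0] at e1 e2 e3
  rcases hijk with hi | hi | hi
  · exact mul_ne_zero hi h e1.symm
  · exact mul_ne_zero hi h e2.symm
  · exact mul_ne_zero hi h e3.symm

/-- All combinations of the basis with first coefficient `i` and with second and third coefficients
`± j`, `± k` are in the list, except for the zero vector. -/
def Covers (a b c : V3 ℤ) (i j k : ℕ) (o : List Record) : Prop :=
  ∀ j' k' : ℤ, j'.natAbs = j → k'.natAbs = k → (i ≠ 0 ∨ j ≠ 0 ∨ k ≠ 0) →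
    .point (comb (i : ℤ) j' k' a b c).fn ∈ o

/-- The signs of `c₂` and `c₃` suffice, since a vector and its negative represent the same point. -/
theorem ev_emitAll (hY : Scale m Y) {s : ℕ → ℤ} (hs : ∀ x < 29, |s x| ≤ lev Y m.S 3)
    (hdet : V3.det (val 15 s) (val 18 s) (val 21 s) ≠ 0) {i j k : ℕ} (hi : s 28 = i) (hj : s 27 = j)
    (hk : s 26 = k) (h0 : i ≠ 0 ∨ j ≠ 0 ∨ k ≠ 0) :
    m.Ev emitAll s emitAll.ops fun t o => (∀ x < 29, t x = s x) ∧
      PointList m.X 4 o ∧ Covers (val 15 s) (val 18 s) (val 21 s) i j k o := by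
  have step : ∀ (p r : Bool) (j' k' : ℤ), (j' = if p then (j : ℤ) else -j) →
      (k' = if r then (k : ℤ) else -k) → ∀ t : ℕ → ℤ, (∀ x < 29, t x = s x) →
      m.Ev (emitVec (signedComb p r)) t (emitVec (signedComb p r)).ops fun u o =>
        (∀ x < 29, u x = t x) ∧ PointList m.X 1 o ∧
          .point (comb (i : ℤ) j' k' (val 15 s) (val 18 s) (val 21 s)).fn ∈ o := by
    intro p r j' k' hj' hk' t ht
    have hne := comb_ne_zero hdet (i := i) (j := j') (k := k')
      (by subst hj' hk'; cases p <;> cases r <;> simp <;> omega)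
    refine ev_emitVec hY (fun x hx => by rw [ht x hx]; exact hs x hx)
      (by cases p <;> cases r <;> decide +kernel) (by cases p <;> cases r <;> decide +kernel) ?_ hne
    have v15 : val 15 t = val 15 s := val_congr fun x h1 h2 => ht x (by omega)
    have v18 : val 18 t = val 18 s := val_congr fun x h1 h2 => ht x (by omega)
    have v21 : val 21 t = val 21 s := val_congr fun x h1 h2 => ht x (by omega)
    have e1 := ht 28 (by omega)
    have e2 := ht 27 (by omega)
    have e3 := ht 26 (by omega)
    rw [hi] at e1; rw [hj] at e2; rw [hk] at e3
    rw [← v15, ← v18, ← v21, hj', hk']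
    cases p <;> cases r <;>
    simp only [comb, signedComb, addMul, subMul, smul, Expr.eval_add, Expr.eval_sub, Expr.eval_mul,
      vec, Expr.eval_var, e1, e2, e3, val, if_true, Bool.false_eq_true, if_false, V3.mk.injEq] <;>
    refine ⟨?_, ?_, ?_⟩ <;> ring
  refine Budget.Ev.seq (step true true j k rfl rfl s fun _ _ => rfl) ?_
  rintro t₁ o₁ ⟨f₁, p₁, c₁⟩
  refine Budget.Ev.seq (step true false j (-k) rfl rfl t₁ f₁) ?_
  rintro t₂ o₂ ⟨f₂, p₂, c₂⟩
  have f₂' : ∀ x < 29, t₂ x = s x := fun x hx => by rw [f₂ x hx, f₁ x hx]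
  refine Budget.Ev.seq (step false true (-j) k rfl rfl t₂ f₂') ?_
  rintro t₃ o₃ ⟨f₃, p₃, c₃⟩
  have f₃' : ∀ x < 29, t₃ x = s x := fun x hx => by rw [f₃ x hx, f₂' x hx]
  refine Budget.Ev.mono (step false false (-j) (-k) rfl rfl t₃ f₃') le_rfl ?_
  rintro t₄ o₄ ⟨f₄, p₄, c₄⟩
  refine ⟨fun x hx => by rw [f₄ x hx, f₃' x hx], p₁.append (p₂.append (p₃.append p₄)), ?_⟩
  intro j' k' hj' hk' _
  have hj2 : j' = j ∨ j' = -j := by omega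
  have hk2 : k' = k ∨ k' = -k := by omega
  rcases hj2 with rfl | rfl <;> rcases hk2 with rfl | rfl <;> simp [*]

end Enumeration

end NearCurve

namespace NearCurve
open V3

theorem Covers.mono {a b c : V3 ℤ} {i j k : ℕ} {o o' : List Record} (h : Covers a b c i j k o)
    (ho : o ⊆ o') : Covers a b c i j k o' := fun j' k' h1 h2 h3 => ho (h j' k' h1 h2 h3)

theorem subset_flatMap_range {M i : ℕ} (hi : i < M) (os : ℕ → List Record) :
    os i ⊆ (List.range M).flatMap os :=
  fun _ hR => List.mem_flatMap.2 ⟨i, List.mem_range.2 hi, hR⟩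

/-- The state before the enumeration, with three independent vectors in registers `15` to `23`. -/
structure EnumState (m : Budget) (Y : ℕ) (P d st : ℤ) (f g : V3 ℤ) (s : ℕ → ℤ) : Prop where
  arc : AtArc P d st f g s
  bound : ∀ x < 26, |s x| ≤ lev Y m.S 2
  det : V3.det (val 15 s) (val 18 s) (val 21 s) ≠ 0

theorem Budget.Ev.assign' {m : Budget} {Y : ℕ} (hY : Scale m Y) {s : ℕ → ℤ} {x : ℕ} {e : Expr}
    (hx : x < numVars) (hb : e.Below numVars) (he : e.size ≤ 10000) {z : ℤ} (hz : e.eval s = z)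
    (hX : |z| ≤ m.X) {Q : (ℕ → ℤ) → List Record → Prop}
    (h : ∀ t : ℕ → ℤ, (∀ y, y ≠ x → t y = s y) → t x = z → Q t []) :
    m.Ev (NearCurve.assign x e) s (NearCurve.assign x e).ops Q := by
  subst hz
  exact Budget.Ev.assign hx hb (he.trans hY.size_le) hX
    (h _ (fun y hy => Function.update_of_ne hy _ _) (Function.update_self _ _ _))

section Enumeration

variable {m : Budget} {Y : ℕ} {P d st : ℤ} {f g : V3 ℤ} {s₀ : ℕ → ℤ}

theorem EnumState.congr (E : EnumState m Y P d st f g s₀) {s : ℕ → ℤ}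
    (hs : ∀ x < 26, s x = s₀ x) : AtArc P d st f g s ∧ val 15 s = val 15 s₀ ∧
      val 18 s = val 18 s₀ ∧ val 21 s = val 21 s₀ :=
  ⟨E.arc.congr fun x hx => hs x (by omega), val_congr fun x _ _ => hs x (by omega),
    val_congr fun x _ _ => hs x (by omega), val_congr fun x _ _ => hs x (by omega)⟩

theorem abs_natCast_le {n : ℕ} {a : ℤ} {N : ℕ} (h1 : (n : ℤ) ≤ a) (h2 : |a| ≤ N) :
    |(n : ℤ)| ≤ N := by
  rw [abs_of_nonneg (by positivity)]
  exact h1.trans ((le_abs_self a).trans h2)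

/-- The innermost loop, for given second and third coefficients `j` and `k`; `M` is its number of
passes. -/
theorem ev_loop₁ (hY : Scale m Y) (E : EnumState m Y P d st f g s₀) {M : ℕ}
    (hM : ∀ i : ℕ, (i : ℤ) * i * bil P d st f g (val 15 s₀) (val 15 s₀) ≤ 16 * s₀ 13 ↔ i < M)
    (hM' : (M : ℤ) ≤ 16 * s₀ 13 + 1) {s : ℕ → ℤ} (hs : ∀ x < 26, s x = s₀ x) {j k : ℕ}
    (hj : s 27 = j) (hk : s 26 = k) (hj' : |(j : ℤ)| ≤ lev Y m.S 3)
    (hk' : |(k : ℤ)| ≤ lev Y m.S 3) (h28 : s 28 = 0) :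
    m.Ev (whileE guard₁ body₁) s ((M + 1) * (body₁.ops + (guard₁.compile numVars).ops + 1))
      fun t o => (∀ x < 28, t x = s x) ∧ PointList m.X (M * 4) o ∧
        ∀ i < M, Covers (val 15 s₀) (val 18 s₀) (val 21 s₀) i j k o := by
  have hMX : |16 * s₀ 13 + 1| ≤ lev Y m.S 3 := by
    have := hY.eval_le E.bound (e := 16 * .var 13 + 1) (by decide) (by decide +kernel)
    simpa using this
  refine Budget.Ev.mono (Budget.Ev.count (by decide +kernel)
    (le_trans (by decide +kernel : _ ≤ 10000) hY.size_le) M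
    (I := fun i t => (∀ x < 28, t x = s x) ∧ t 28 = i)
    (Φ := fun i o => PointList m.X 4 o ∧ Covers (val 15 s₀) (val 18 s₀) (val 21 s₀) i j k o)
    ?_ ?_ s ⟨fun _ _ => rfl, by simpa using h28⟩) le_rfl ?_
  · rintro i t ⟨ht, hti⟩ _
    obtain ⟨arc, v15, _, _⟩ := E.congr (s := t) fun x hx => (ht x (by omega)).trans (hs x hx)
    rw [← hM i]
    simp only [guard₁, Expr.eval_add, Expr.eval_sub, Expr.eval_mul, Expr.eval_ofNat, Expr.eval_var,
      Expr.eval_one, arc.eval_qE, v15, hti, ht 13 (by omega), hs 13 (by omega)]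
    omega
  · rintro i t ⟨ht, hti⟩ hiM
    have ht26 : ∀ x < 26, t x = s₀ x := fun x hx => (ht x (by omega)).trans (hs x hx)
    obtain ⟨arc, v15, v18, v21⟩ := E.congr ht26
    have hiX : |((i + 1 : ℕ) : ℤ)| ≤ lev Y m.S 3 := abs_natCast_le (by push_cast; omega) hMX
    have hiX' : |(i : ℤ)| ≤ lev Y m.S 3 := abs_natCast_le (by omega) hMX
    have hb : ∀ x < 29, |t x| ≤ lev Y m.S 3 := by
      intro x hx
      by_cases h1 : x < 26
      · rw [ht26 x h1]; exact hY.mono (by omega) (E.bound x h1)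
      · have h2 : x = 26 ∨ x = 27 ∨ x = 28 := by omega
        rcases h2 with rfl | rfl | rfl
        · rw [ht 26 (by omega), hk]; exact hk'
        · rw [ht 27 (by omega), hj]; exact hj'
        · rw [hti]; exact hiX'
    have htj : t 27 = j := by rw [ht 27 (by omega), hj]
    have htk : t 26 = k := by rw [ht 26 (by omega), hk]
    rw [← v15, ← v18, ← v21]
    refine Budget.Ev.seq (Q := fun u o => (∀ x < 29, u x = t x) ∧ PointList m.X 4 o ∧
      Covers (val 15 t) (val 18 t) (val 21 t) i j k o) ?_ ?_
    · refine Budget.Ev.ifE_ops (by decide) (le_trans (by decide +kernel : _ ≤ 10000) hY.size_le)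
        (fun hpos => ?_) (fun hneg => ?_)
      · refine ev_emitAll hY hb (by rw [v15, v18, v21]; exact E.det) hti htj htk ?_
        simp only [Expr.eval_add, Expr.eval_var, hti, htj, htk] at hpos
        omega
      · refine Budget.Ev.block trivial ⟨fun _ _ => rfl, ⟨by simp, by simp⟩, fun j' k' _ _ h0 => ?_⟩
        simp only [Expr.eval_add, Expr.eval_var, hti, htj, htk] at hneg
        omega
    · rintro u o ⟨hu, hp, hc⟩
      refine Budget.Ev.assign' hY (by decide) (by decide) (by decide +kernel)
        (z := ((i + 1 : ℕ) : ℤ)) ?_ (hY.abs_le (by omega) hiX) ?_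
      · simp [hu 28 (by omega), hti]
      · intro w hw hw28
        refine ⟨⟨fun x hx => ?_, hw28⟩, by simpa using hp, by simpa using hc⟩
        rw [hw x (by omega), hu x (by omega), ht x hx]
  · rintro t o ⟨⟨ht, _⟩, os, rfl, hos⟩
    exact ⟨ht, PointList.flatMap fun i hi => (hos i hi).1,
      fun i hi => (hos i hi).2.mono (subset_flatMap_range hi os)⟩

/-- A bound for the cost of a pass of the middle loop, divided by the number of passes of the
innermost loop. -/
def cost₂ : ℕ := (assign 28 0).ops + 2 * (body₁.ops + (guard₁.compile numVars).ops + 1) +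
  (assign 27 (.var 27 + 1)).ops

/-- The two inner loops, for a given third coefficient `k`. -/
theorem ev_loop₂ (hY : Scale m Y) (E : EnumState m Y P d st f g s₀) {M N : ℕ} (hM1 : 1 ≤ M)
    (hM : ∀ i : ℕ, (i : ℤ) * i * bil P d st f g (val 15 s₀) (val 15 s₀) ≤ 16 * s₀ 13 ↔ i < M)
    (hM' : (M : ℤ) ≤ 16 * s₀ 13 + 1)
    (hN : ∀ i : ℕ, (i : ℤ) * i * gram2 P d st f g (val 15 s₀) (val 18 s₀) ≤
      4 * s₀ 13 * bil P d st f g (val 15 s₀) (val 15 s₀) ↔ i < N)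
    (hN' : (N : ℤ) ≤ 4 * s₀ 13 * bil P d st f g (val 15 s₀) (val 15 s₀) + 1)
    {s : ℕ → ℤ} (hs : ∀ x < 26, s x = s₀ x) {k : ℕ}
    (hk : s 26 = k) (hk' : |(k : ℤ)| ≤ lev Y m.S 3) (h27 : s 27 = 0) :
    m.Ev (whileE guard₂ body₂) s ((N + 1) * (M * cost₂ + (guard₂.compile numVars).ops + 1))
      fun t o => (∀ x < 27, t x = s x) ∧ PointList m.X (N * (M * 4)) o ∧
        ∀ i < M, ∀ j < N, Covers (val 15 s₀) (val 18 s₀) (val 21 s₀) i j k o := by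
  have hNX : |4 * s₀ 13 * bil P d st f g (val 15 s₀) (val 15 s₀) + 1| ≤ lev Y m.S 3 := by
    have := hY.eval_le E.bound (e := 4 * .var 13 * qE (vec 15) (vec 15) + 1) (by decide +kernel)
      (by decide +kernel)
    simpa [E.arc.eval_qE] using this
  refine Budget.Ev.mono (Budget.Ev.count (by decide +kernel)
    (le_trans (by decide +kernel : _ ≤ 10000) hY.size_le) N
    (n := M * cost₂)
    (I := fun i t => (∀ x < 27, t x = s x) ∧ t 27 = i)
    (Φ := fun j o => PointList m.X (M * 4) o ∧
      ∀ i < M, Covers (val 15 s₀) (val 18 s₀) (val 21 s₀) i j k o)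
    ?_ ?_ s ⟨fun _ _ => rfl, by simpa using h27⟩) le_rfl ?_
  · rintro i t ⟨ht, hti⟩ _
    obtain ⟨arc, v15, v18, _⟩ := E.congr (s := t) fun x hx => (ht x (by omega)).trans (hs x hx)
    rw [← hN i]
    simp only [guard₂, Expr.eval_add, Expr.eval_sub, Expr.eval_mul, Expr.eval_ofNat, Expr.eval_var,
      Expr.eval_one, arc.eval_qE, arc.eval_gram2E, v15, v18, hti, ht 13 (by omega), hs 13 (by omega)]
    omega
  · rintro j t ⟨ht, htj⟩ hjN
    have hjX : |((j + 1 : ℕ) : ℤ)| ≤ lev Y m.S 3 := abs_natCast_le (by push_cast; omega) hNX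
    have hjX' : |(j : ℤ)| ≤ lev Y m.S 3 := abs_natCast_le (by omega) hNX
    refine Budget.Ev.mono (n := (assign 28 0).ops +
      ((M + 1) * (body₁.ops + (guard₁.compile numVars).ops + 1) +
        (assign 27 (.var 27 + 1)).ops)) (Budget.Ev.seq
        (Q := fun u o => o = [] ∧ (∀ x, x ≠ 28 → u x = t x) ∧ u 28 = 0) ?_ ?_) ?_ fun _ _ h => h
    · exact Budget.Ev.assign' hY (by decide) (by decide) (by decide) (z := 0) rfl (by simp)
        fun u h1 h2 => ⟨rfl, h1, h2⟩
    · rintro u _ ⟨rfl, hu, hu28⟩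
      refine Budget.Ev.seq (ev_loop₁ hY E hM hM' (j := j) (k := k) (fun x hx => ?_) ?_ ?_ hjX' hk' hu28)
        ?_
      · rw [hu x (by omega), ht x (by omega), hs x hx]
      · rw [hu 27 (by omega), htj]
      · rw [hu 26 (by omega), ht 26 (by omega), hk]
      · rintro v o ⟨hv, hp, hc⟩
        refine Budget.Ev.assign' hY (by decide) (by decide) (by decide +kernel)
          (z := ((j + 1 : ℕ) : ℤ)) ?_ (hY.abs_le (by omega) hjX) ?_
        · simp [hv 27 (by omega), hu 27 (by omega), htj]
        · intro w hw hw27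
          refine ⟨⟨fun x hx => ?_, hw27⟩, by simpa using hp, by simpa using hc⟩
          rw [hw x (by omega), hv x (by omega), hu x (by omega), ht x hx]
    · simp only [cost₂]
      have h1 : (assign 28 0).ops ≤ M * (assign 28 0).ops := Nat.le_mul_of_pos_left _ hM1
      have h2 : (assign 27 (.var 27 + 1)).ops ≤ M * (assign 27 (.var 27 + 1)).ops :=
        Nat.le_mul_of_pos_left _ hM1
      nlinarith
  · rintro t o ⟨⟨ht, _⟩, os, rfl, hos⟩
    exact ⟨ht, PointList.flatMap fun i hi => (hos i hi).1,
      fun i hi j hj => ((hos j hj).2 i hi).mono (subset_flatMap_range hj os)⟩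

/-- A bound for the cost of a pass of the outermost loop, divided by the numbers of passes of the
inner loops. -/
def cost₃ : ℕ := (assign 27 0).ops + 2 * (cost₂ + (guard₂.compile numVars).ops + 1) +
  (assign 26 (.var 26 + 1)).ops

/-- The three loops.  Their numbers of passes `M`, `N`, `L` do not depend on the coefficients. -/
theorem ev_loop₃ (hY : Scale m Y) (E : EnumState m Y P d st f g s₀) {M N L : ℕ} (hM1 : 1 ≤ M)
    (hN1 : 1 ≤ N)
    (hM : ∀ i : ℕ, (i : ℤ) * i * bil P d st f g (val 15 s₀) (val 15 s₀) ≤ 16 * s₀ 13 ↔ i < M)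
    (hM' : (M : ℤ) ≤ 16 * s₀ 13 + 1)
    (hN : ∀ i : ℕ, (i : ℤ) * i * gram2 P d st f g (val 15 s₀) (val 18 s₀) ≤
      4 * s₀ 13 * bil P d st f g (val 15 s₀) (val 15 s₀) ↔ i < N)
    (hN' : (N : ℤ) ≤ 4 * s₀ 13 * bil P d st f g (val 15 s₀) (val 15 s₀) + 1)
    (hL : ∀ i : ℕ, (i : ℤ) * i * s₀ 14 ≤
      s₀ 13 * gram2 P d st f g (val 15 s₀) (val 18 s₀) ↔ i < L)
    (hL' : (L : ℤ) ≤ s₀ 13 * gram2 P d st f g (val 15 s₀) (val 18 s₀) + 1)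
    {s : ℕ → ℤ} (hs : ∀ x < 26, s x = s₀ x) (h26 : s 26 = 0) :
    m.Ev (whileE guard₃ body₃) s ((L + 1) * (N * M * cost₃ + (guard₃.compile numVars).ops + 1))
      fun t o => (∀ x < 26, t x = s x) ∧ PointList m.X (L * (N * (M * 4))) o ∧
        ∀ i < M, ∀ j < N, ∀ k < L, Covers (val 15 s₀) (val 18 s₀) (val 21 s₀) i j k o := by
  have hLX : |s₀ 13 * gram2 P d st f g (val 15 s₀) (val 18 s₀) + 1| ≤ lev Y m.S 3 := by
    have := hY.eval_le E.bound (e := .var 13 * gram2E (vec 15) (vec 18) + 1) (by decide +kernel)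
      (by decide +kernel)
    simpa [E.arc.eval_gram2E] using this
  refine Budget.Ev.mono (Budget.Ev.count (by decide +kernel)
    (le_trans (by decide +kernel : _ ≤ 10000) hY.size_le) L
    (n := N * M * cost₃)
    (I := fun i t => (∀ x < 26, t x = s x) ∧ t 26 = i)
    (Φ := fun k o => PointList m.X (N * (M * 4)) o ∧
      ∀ i < M, ∀ j < N, Covers (val 15 s₀) (val 18 s₀) (val 21 s₀) i j k o)
    ?_ ?_ s ⟨fun _ _ => rfl, by simpa using h26⟩) le_rfl ?_
  · rintro i t ⟨ht, hti⟩ _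
    obtain ⟨arc, v15, v18, _⟩ := E.congr (s := t) fun x hx => (ht x (by omega)).trans (hs x hx)
    rw [← hL i]
    simp only [guard₃, Expr.eval_add, Expr.eval_sub, Expr.eval_mul, Expr.eval_var,
      Expr.eval_one, arc.eval_gram2E, v15, v18, hti, ht 13 (by omega), hs 13 (by omega),
      ht 14 (by omega), hs 14 (by omega)]
    omega
  · rintro k t ⟨ht, htk⟩ hkL
    have hkX : |((k + 1 : ℕ) : ℤ)| ≤ lev Y m.S 3 := abs_natCast_le (by push_cast; omega) hLX
    have hkX' : |(k : ℤ)| ≤ lev Y m.S 3 := abs_natCast_le (by omega) hLX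
    refine Budget.Ev.mono (n := (assign 27 0).ops +
      ((N + 1) * (M * cost₂ + (guard₂.compile numVars).ops + 1) +
        (assign 26 (.var 26 + 1)).ops)) (Budget.Ev.seq
        (Q := fun u o => o = [] ∧ (∀ x, x ≠ 27 → u x = t x) ∧ u 27 = 0) ?_ ?_) ?_ fun _ _ h => h
    · exact Budget.Ev.assign' hY (by decide) (by decide) (by decide) (z := 0) rfl (by simp)
        fun u h1 h2 => ⟨rfl, h1, h2⟩
    · rintro u _ ⟨rfl, hu, hu27⟩
      refine Budget.Ev.seq (ev_loop₂ hY E hM1 hM hM' hN hN' (k := k) (fun x hx => ?_) ?_ hkX' hu27)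
        ?_
      · rw [hu x (by omega), ht x (by omega), hs x hx]
      · rw [hu 26 (by omega), htk]
      · rintro v o ⟨hv, hp, hc⟩
        refine Budget.Ev.assign' hY (by decide) (by decide) (by decide +kernel)
          (z := ((k + 1 : ℕ) : ℤ)) ?_ (hY.abs_le (by omega) hkX) ?_
        · simp [hv 26 (by omega), hu 26 (by omega), htk]
        · intro w hw hw26
          refine ⟨⟨fun x hx => ?_, hw26⟩, by simpa using hp, by simpa using hc⟩
          rw [hw x (by omega), hv x (by omega), hu x (by omega), ht x hx]
    · have hNM : 1 ≤ N * M := Nat.mul_pos hN1 hM1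
      simp only [cost₃]
      have h1 : (assign 27 0).ops ≤ N * M * (assign 27 0).ops := Nat.le_mul_of_pos_left _ hNM
      have h2 : (assign 26 (.var 26 + 1)).ops ≤ N * M * (assign 26 (.var 26 + 1)).ops :=
        Nat.le_mul_of_pos_left _ hNM
      have h3 : (N + 1) * (M * cost₂ + (guard₂.compile numVars).ops + 1) ≤
          2 * N * (M * (cost₂ + (guard₂.compile numVars).ops + 1)) := by
        gcongr
        · omega
        · nlinarith
      nlinarith
  · rintro t o ⟨⟨ht, _⟩, os, rfl, hos⟩
    exact ⟨ht, PointList.flatMap fun i hi => (hos i hi).1,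
      fun i hi j hj k hk => ((hos k hk).2 i hi j hj).mono (subset_flatMap_range hk os)⟩

/-- Cramer's rule in a basis of `ℤ³`. -/
theorem exists_eq_comb {a b c : V3 ℤ} (h : V3.det a b c * V3.det a b c = 1) (w : V3 ℤ) :
    ∃ i j k : ℤ, w = comb i j k a b c := by
  refine ⟨V3.det a b c * V3.det w b c, V3.det a b c * V3.det a w c,
    V3.det a b c * V3.det a b w, ?_⟩
  ext
  · calc w.x = V3.det a b c * V3.det a b c * w.x := by rw [h, one_mul]
      _ = _ := by simp only [comb, V3.det, dot, cross, addMul, smul]; ring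
  · calc w.y = V3.det a b c * V3.det a b c * w.y := by rw [h, one_mul]
      _ = _ := by simp only [comb, V3.det, dot, cross, addMul, smul]; ring
  · calc w.z = V3.det a b c * V3.det a b c * w.z := by rw [h, one_mul]
      _ = _ := by simp only [comb, V3.det, dot, cross, addMul, smul]; ring

/-- A bound for the cost of the enumeration, divided by the number of combinations up to
signs. -/
def costEnum : ℕ := (assign 25 0).ops + (assign 26 0).ops +
  2 * (cost₃ + (guard₃.compile numVars).ops + 1)

/-- All integral vectors below the threshold `T` are written, up to sign, if `D₃ ≤ T D₂`.  In this
case the three ranges of coefficients are not trivial, so that the number `n` of combinations is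
comparable to the volume `T^(3/2) D₃^(-1/2)` of the region and the cost is `O(n)`. -/
theorem ev_enumerate (hY : Scale m Y) (hP : 0 < P) (hd : 0 < d) {D₁ D₂ : ℤ} {s : ℕ → ℤ}
    (h : LatticeState m Y P d st f g D₁ D₂ s)
    (hr : Reduced P d st f g (val 15 s) (val 18 s) (val 21 s))
    (hc : s 14 ≤ s 13 * gram2 P d st f g (val 15 s) (val 18 s)) :
    ∃ n : ℕ, 1 ≤ n ∧ (n : ℤ) ^ 2 * s 14 ≤ 4096 * s 13 ^ 3 ∧
      m.Ev enumerate s (n * costEnum) fun t o => (∀ x < 25, t x = s x) ∧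
        PointList m.X (n * 4) o ∧ ∀ w : V3 ℤ, w ≠ ⟨0, 0, 0⟩ → bil P d st f g w w ≤ s 13 →
          .point w.fn ∈ o ∨ .point (smul (-1) w).fn ∈ o := by
  obtain ⟨p1, p2, e3, p3⟩ := h.pos hP hd
  have hT : 0 < s 13 := pos_of_mul_pos_left (lt_of_lt_of_le p3 hc) p2.le
  have r1 := hr.fst
  have r2 := hr.snd
  rw [e3] at r2
  have hcoord : ∀ {i j k : ℤ}, _ → _ := fun {i j k} =>
    hr.coord_le p1 p2 (by rw [e3]; exact p3) (T := s 13) (i := i) (j := j) (k := k)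
  rw [e3] at hcoord
  obtain ⟨M, hM, hM1, hM', hM4⟩ := exists_count (a := 16 * s 13)
    (b := bil P d st f g (val 15 s) (val 15 s)) (by positivity) p1
  obtain ⟨N, hN, hN1, hN', hN4⟩ := exists_count
    (a := 4 * s 13 * bil P d st f g (val 15 s) (val 15 s))
    (b := gram2 P d st f g (val 15 s) (val 18 s)) (by positivity) p2
  obtain ⟨L, hL, hL1, hL', hL4⟩ := exists_count
    (a := s 13 * gram2 P d st f g (val 15 s) (val 18 s)) (b := s 14) (by positivity) p3
  refine ⟨L * (N * M), Nat.mul_pos hL1 (Nat.mul_pos hN1 hM1), ?_, ?_⟩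
  -- In a reduced basis `D₃ ≤ T D₂` implies `D₂ ≤ 2 T D₁` and `D₁ ≤ 4 T`.  So no range of
  -- coefficients is trivial, and `M`, `N`, `L` are at most twice the square roots of the quotients.
  · replace hL4 := hL4 hc
    have hd2 : gram2 P d st f g (val 15 s) (val 18 s) ≤
        2 * s 13 * bil P d st f g (val 15 s) (val 15 s) := by
      refine le_of_mul_le_mul_left (?_ : gram2 P d st f g (val 15 s) (val 18 s) * _ ≤
        gram2 P d st f g (val 15 s) (val 18 s) * _) p2
      nlinarith
    have hd1 : bil P d st f g (val 15 s) (val 15 s) ≤ 4 * s 13 := by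
      refine le_of_mul_le_mul_left (?_ : bil P d st f g (val 15 s) (val 15 s) * _ ≤
        bil P d st f g (val 15 s) (val 15 s) * _) p1
      nlinarith
    replace hN4 := hN4 (by nlinarith)
    replace hM4 := hM4 (by linarith)
    generalize bil P d st f g (val 15 s) (val 15 s) = A at *
    generalize gram2 P d st f g (val 15 s) (val 18 s) = D at *
    refine le_of_mul_le_mul_left (?_ : A * D * _ ≤ A * D * _) (mul_pos p1 p2)
    calc A * D * (((L * (N * M) : ℕ) : ℤ) ^ 2 * s 14)
        = (L * L * s 14) * ((N * N * D) * (M * M * A)) := by push_cast; ring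
      _ ≤ (4 * (s 13 * D)) * ((4 * (4 * s 13 * A)) * (4 * (16 * s 13))) := by
          gcongr
      _ = A * D * (4096 * s 13 ^ 3) := by ring
  refine Budget.Ev.mono (n := (assign 25 0).ops + ((assign 26 0).ops +
    (L + 1) * (N * M * cost₃ + (guard₃.compile numVars).ops + 1))) (Budget.Ev.seq
      (Q := fun u o => o = [] ∧ (∀ x, x ≠ 25 → u x = s x) ∧ u 25 = 0) ?_ ?_) ?_ fun _ _ h => h
  · exact Budget.Ev.assign' hY (by decide) (by decide) (by decide) (z := 0) rfl (by simp)
        fun u h1 h2 => ⟨rfl, h1, h2⟩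
  · rintro t _ ⟨rfl, ht, ht25⟩
    refine Budget.Ev.seq (Q := fun u o => o = [] ∧ (∀ x, x ≠ 26 → u x = t x) ∧ u 26 = 0)
      (Budget.Ev.assign' hY (by decide) (by decide) (by decide) (z := 0) rfl (by simp)
        fun u h1 h2 => ⟨rfl, h1, h2⟩) ?_
    rintro u _ ⟨rfl, hu, hu26⟩
    have v15 : val 15 t = val 15 s := val_congr fun x _ _ => ht x (by omega)
    have v18 : val 18 t = val 18 s := val_congr fun x _ _ => ht x (by omega)
    have v21 : val 21 t = val 21 s := val_congr fun x _ _ => ht x (by omega)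
    have hdet : V3.det (val 15 t) (val 18 t) (val 21 t) *
        V3.det (val 15 t) (val 18 t) (val 21 t) = 1 := by rw [v15, v18, v21]; exact h.det
    have E : EnumState m Y P d st f g t := by
      refine ⟨h.arc.congr fun x hx => ht x (by omega), fun x hx => ?_, fun hc => ?_⟩
      · by_cases h1 : x = 25
        · rw [h1, ht25]; simp
        · rw [ht x h1]; exact h.bound x (by omega)
      · rw [hc] at hdet; simp at hdet
    refine Budget.Ev.mono (ev_loop₃ (s₀ := t) hY E (M := M) (N := N) (L := L) hM1 hN1 ?_ ?_ ?_ ?_ ?_ ?_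
      (s := u) (fun x hx => hu x (by omega)) hu26) le_rfl ?_
    iterate 6 simpa only [v15, v18, ht 13 (by omega), ht 14 (by omega)]
    rintro v o ⟨hv, hp, hcov⟩
    rw [v15, v18, v21] at hcov
    refine ⟨fun x hx => by rw [hv x (by omega), hu x (by omega), ht x (by omega)], ?_, ?_⟩
    · have e : L * (N * M) * 4 = L * (N * (M * 4)) := by ring
      rw [e]
      exact hp
    · intro w hw hwT
      obtain ⟨i, j, k, rfl⟩ := exists_eq_comb h.det w
      obtain ⟨c1, c2, c3⟩ := hcoord hwT
      have n1 : i.natAbs < M := (hM _).1 (by rw [Int.natAbs_mul_self']; exact c3)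
      have n2 : j.natAbs < N := (hN _).1 (by rw [Int.natAbs_mul_self']; exact c2)
      have n3 : k.natAbs < L := (hL _).1 (by rw [Int.natAbs_mul_self']; exact c1)
      have h0 : i.natAbs ≠ 0 ∨ j.natAbs ≠ 0 ∨ k.natAbs ≠ 0 := by
        by_contra hc0
        apply hw
        have hi : i = 0 := by omega
        have hj : j = 0 := by omega
        have hk : k = 0 := by omega
        subst hi hj hk
        simp [comb, addMul, smul]
      have hcv := hcov _ n1 _ n2 _ n3
      rcases le_total 0 i with hi | hi
      · left
        have := hcv j k rfl rfl h0
        rwa [Int.natAbs_of_nonneg hi] at this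
      · right
        have := hcv (-j) (-k) (by simp) (by simp) h0
        have e : comb (i.natAbs : ℤ) (-j) (-k) (val 15 s) (val 18 s) (val 21 s) =
            smul (-1) (comb i j k (val 15 s) (val 18 s) (val 21 s)) := by
          rw [Int.ofNat_natAbs_of_nonpos hi]
          ext <;> simp only [comb, addMul, smul] <;> ring
        rwa [e] at this
  · have h1 : 1 ≤ L * (N * M) := Nat.mul_pos hL1 (Nat.mul_pos hN1 hM1)
    have hNM : 1 ≤ N * M := Nat.mul_pos hN1 hM1
    have h3 : (L + 1) * (N * M * cost₃ + (guard₃.compile numVars).ops + 1) ≤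
          2 * L * (N * M * (cost₃ + (guard₃.compile numVars).ops + 1)) := by
        gcongr
        · omega
        · nlinarith
    simp only [costEnum]
    have h4 : (assign 25 0).ops ≤ L * (N * M) * (assign 25 0).ops := Nat.le_mul_of_pos_left _ h1
    have h5 : (assign 26 0).ops ≤ L * (N * M) * (assign 26 0).ops := Nat.le_mul_of_pos_left _ h1
    nlinarith

end Enumeration

end NearCurve

namespace NearCurve
open V3

/-! ### Integral vectors near an arc -/

theorem projDist_le_pi_div_two (p q : RP2) : projDist p q ≤ Real.pi / 2 :=
  Real.arccos_le_pi_div_two.2 (by positivity)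

/-- A vector whose line has angle at most `δ` with the line of `u` is close to a multiple of `u`. -/
theorem exists_smul_near {u v : E3} (hu : u ≠ 0) (hv : v ≠ 0) {δ : ℝ}
    (h : projDist (Projectivization.mk ℝ v hv) (Projectivization.mk ℝ u hu) ≤ δ) :
    ∃ l : ℝ, |l| * ‖u‖ ≤ ‖v‖ ∧ ‖v - l • u‖ ≤ ‖v‖ * min δ 2 := by
  have hu' : 0 < ‖u‖ := norm_pos_iff.2 hu
  have hv' : 0 < ‖v‖ := norm_pos_iff.2 hv
  have h2 : projDist (Projectivization.mk ℝ v hv) (Projectivization.mk ℝ u hu) ≤ min δ 2 :=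
    le_min h ((projDist_le_pi_div_two _ _).trans (by linarith [Real.pi_le_four]))
  rw [projDist_mk] at h2
  have hc : |inner ℝ v u| ≤ ‖v‖ * ‖u‖ := abs_real_inner_le_norm v u
  refine ⟨inner ℝ v u / ‖u‖ ^ 2, ?_, ?_⟩
  · rw [abs_div, abs_of_pos (by positivity : 0 < ‖u‖ ^ 2), div_mul_eq_mul_div,
      div_le_iff₀ (by positivity)]
    nlinarith
  · set c : ℝ := |inner ℝ v u| / (‖v‖ * ‖u‖) with hcdef
    have hsin : Real.sin (Real.arccos c) ≤ min δ 2 :=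
      (Real.sin_le (Real.arccos_nonneg _)).trans h2
    rw [Real.sin_arccos] at hsin
    refine le_trans ?_ (mul_le_mul_of_nonneg_left hsin hv'.le)
    refine (sq_le_sq₀ (norm_nonneg _) (by positivity)).1 ?_
    have hc1 : c ≤ 1 := by rw [hcdef, div_le_one (by positivity)]; exact hc
    have hc0 : 0 ≤ c := by positivity
    rw [mul_pow, Real.sq_sqrt (by nlinarith), norm_sub_sq_real, norm_smul, inner_smul_right,
      Real.norm_eq_abs, mul_pow, sq_abs]
    have e1 : c ^ 2 = (inner ℝ v u) ^ 2 / (‖v‖ ^ 2 * ‖u‖ ^ 2) := by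
      rw [hcdef, div_pow, sq_abs, mul_pow]
    rw [e1]
    apply le_of_eq
    field_simp
    ring

/-- First order approximation of a curve with bounded second derivative. -/
theorem BoundedLift.norm_sub_le {φ : unitInterval → RP2} {F dF ddF : ℝ → E3} {B : ℕ}
    (h : BoundedLift φ F dF ddF B) {a t : ℝ} (ha : 0 ≤ a) (hat : a ≤ t) (ht : t ≤ 1) :
    ‖F t - F a - (t - a) • dF a‖ ≤ B * (t - a) ^ 2 := by
  have hsub : Set.Icc a t ⊆ Set.Icc (0 : ℝ) 1 := Set.Icc_subset_Icc ha ht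
  have h1 : ∀ x ∈ Set.Icc a t, ‖dF x - dF a‖ ≤ B * (t - a) := by
    intro x hx
    have := (convex_Icc a t).norm_image_sub_le_of_norm_hasDerivWithin_le (f := dF) (f' := ddF)
      (C := B) (fun y hy => (h.hasSecondDeriv y (hsub hy)).mono hsub)
      (fun y hy => h.norm_secondDeriv_le y (hsub hy)) (Set.left_mem_Icc.2 hat) hx
    refine this.trans ?_
    rw [Real.norm_eq_abs, abs_of_nonneg (by linarith [hx.1])]
    have := hx.2
    gcongr
  have h2 := (convex_Icc a t).norm_image_sub_le_of_norm_hasDerivWithin_le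
    (f := fun x => F x - x • dF a) (f' := fun x => dF x - dF a) (C := B * (t - a))
    (fun y hy => ((h.hasDeriv y (hsub hy)).mono hsub).sub
      (by simpa using ((hasDerivAt_id y).smul_const (dF a)).hasDerivWithinAt))
    h1 (Set.left_mem_Icc.2 hat) (Set.right_mem_Icc.2 hat)
  rw [Real.norm_eq_abs, abs_of_nonneg (by linarith)] at h2
  calc ‖F t - F a - (t - a) • dF a‖ = ‖F t - t • dF a - (F a - a • dF a)‖ := by
        congr 1; rw [sub_smul]; abel
    _ ≤ _ := h2
    _ = _ := by ring

theorem norm_sq_eq (x : E3) : ‖x‖ ^ 2 = x 0 ^ 2 + x 1 ^ 2 + x 2 ^ 2 := by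
  rw [EuclideanSpace.real_norm_sq_eq, Fin.sum_univ_three]

theorem norm_le_two_of_coord {x : E3} (h : ∀ i, |x i| ≤ 1) : ‖x‖ ≤ 2 := by
  refine (sq_le_sq₀ (norm_nonneg _) (by norm_num)).1 ?_
  rw [norm_sq_eq]
  have h0 := sq_le_sq' (neg_le_of_abs_le (h 0)) (le_of_abs_le (h 0))
  have h1 := sq_le_sq' (neg_le_of_abs_le (h 1)) (le_of_abs_le (h 1))
  have h2 := sq_le_sq' (neg_le_of_abs_le (h 2)) (le_of_abs_le (h 2))
  linarith

/-- The numerical data of the subdivision of the curve: height bound `N`, working height `H`,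
precision `P`, and distance `d` and step `s` in units of `1 / P`.  The constant `113` makes the
threshold large enough in `GridData.coeff_sq_le` and the angles small enough in `cone_arith`. -/
structure GridData (B : ℕ) (N δ : ℝ) (H P d s : ℤ) : Prop where
  B_pos : 1 ≤ B
  N_gt : 1 < N
  H_ge : 113 * (B : ℝ) ^ 2 * N ≤ H
  P_ge : H ^ 2 ≤ P
  d_pos : 1 ≤ d
  dist_le : min δ 2 * P ≤ d
  d_ge : (P : ℝ) ≤ d * H ^ 2
  d_le : d ≤ 4 * P
  le_s : d ≤ s
  s_le : s * H ≤ d * H + P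

/-- The vectors `f` and `g` approximate `P F` and `P F'` at the start `j / P` of an arc. -/
structure ArcData (F dF : ℝ → E3) (P j : ℤ) (f g : V3 ℤ) : Prop where
  f_near : ‖intVec f.fn - (P : ℝ) • F (j / P)‖ ≤ 2
  g_near : ‖intVec g.fn - (P : ℝ) • dF (j / P)‖ ≤ 2

section Arc

variable {B : ℕ} {N δ : ℝ} {H P d s : ℤ}

theorem GridData.H_pos (D : GridData B N δ H P d s) : (113 : ℝ) ≤ H := by
  have h1 : (1 : ℝ) ≤ B := by exact_mod_cast D.B_pos
  have := D.H_ge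
  have := D.N_gt
  nlinarith [one_le_pow₀ (n := 2) h1]

theorem GridData.H_pos' (D : GridData B N δ H P d s) : 113 ≤ H := by exact_mod_cast D.H_pos

theorem GridData.P_pos (D : GridData B N δ H P d s) : 113 ≤ P := by
  have := D.H_pos'
  have := D.P_ge
  nlinarith

/-- Arcs are as long as the width of the neighbourhood allows: over a parameter interval of length
`d / P + 1 / H` the curve departs from its tangent by `O(d / P)`, since `1 / H² ≤ d / P ≤ 4`. -/
theorem GridData.step_le (D : GridData B N δ H P d s) :
    (s : ℝ) / P ≤ d / P + 1 / H := by
  have hP : (0 : ℝ) < P := by have := D.P_pos; exact_mod_cast (by omega : 0 < P)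
  have hH : (0 : ℝ) < H := by linarith [D.H_pos]
  have h : (s : ℝ) * H ≤ d * H + P := by exact_mod_cast D.s_le
  rw [div_add_div _ _ hP.ne' hH.ne', div_le_div_iff₀ hP (by positivity)]
  nlinarith

/-- Coordinate vectors of points near an arc are nearly combinations of the data of the arc: the
error is made up of the distance to the curve, the distance of the curve from its tangent, and the
errors of the approximations, all of which are `O(d / P)` times the length. -/
theorem exists_arc_decomposition {φ : unitInterval → RP2} {F dF ddF : ℝ → E3}
    (hF : BoundedLift φ F dF ddF B) (D : GridData B N δ H P d s) {j : ℤ} {f g : V3 ℤ}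
    (hA : ArcData F dF P j f g) (hj : 0 ≤ j) {t : unitInterval} (ht : (j : ℝ) / P ≤ t)
    (ht' : (t : ℝ) ≤ (j + s) / P) {v : E3} (hv : v ≠ 0)
    (h : projDist (Projectivization.mk ℝ v hv) (φ t) ≤ δ) :
    ∃ (α β : ℝ) (ε : E3), v = α • intVec f.fn + (β * (s / P)) • intVec g.fn + ε ∧
      |α| ≤ B * ‖v‖ / P ∧ |β| ≤ B * ‖v‖ / P ∧ ‖ε‖ ≤ 23 * B ^ 2 * ‖v‖ / P * d := by
  have hP : (1 : ℝ) ≤ P := by have := D.P_pos; exact_mod_cast (by omega : 1 ≤ P)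
  have hB : (1 : ℝ) ≤ B := by exact_mod_cast D.B_pos
  have hH : (113 : ℝ) ≤ H := D.H_pos
  have hd : (1 : ℝ) ≤ d := by exact_mod_cast D.d_pos
  have hs : (1 : ℝ) ≤ s := hd.trans (by exact_mod_cast D.le_s)
  have hj' : (0 : ℝ) ≤ j := by exact_mod_cast hj
  rw [hF.lift t] at h
  obtain ⟨l, hl, hlv⟩ := exists_smul_near (hF.ne_zero t) hv h
  have hl' : |l| ≤ B * ‖v‖ := by
    have h1 := hF.le_norm t t.2
    have : |l| * 1 ≤ |l| * (B * ‖F t‖) := mul_le_mul_of_nonneg_left h1 (abs_nonneg l)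
    nlinarith
  set a : ℝ := j / P with ha
  have ha0 : 0 ≤ a := by positivity
  obtain ⟨τ, hτ⟩ : ∃ τ : ℝ, τ = t - a := ⟨_, rfl⟩
  have hτ0 : 0 ≤ τ := by linarith
  have hτs : τ ≤ s / P := by
    rw [add_div] at ht'
    linarith
  have hr := hF.norm_sub_le ha0 ht t.2.2
  rw [← hτ] at hr
  have e1 : ‖F a - (1 / (P : ℝ)) • intVec f.fn‖ ≤ 2 / P := by
    have : F a - (1 / (P : ℝ)) • intVec f.fn =
        (-(1 / (P : ℝ))) • (intVec f.fn - (P : ℝ) • F a) := by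
      rw [smul_sub, smul_smul]
      have : -(1 / (P : ℝ)) * P = -1 := by field_simp
      rw [this]
      simp only [neg_smul, one_smul]
      abel
    rw [this, norm_smul, norm_neg, Real.norm_of_nonneg (by positivity), div_mul_eq_mul_div, one_mul]
    exact div_le_div_of_nonneg_right hA.f_near (by positivity)
  have e2 : ‖dF a - (1 / (P : ℝ)) • intVec g.fn‖ ≤ 2 / P := by
    have : dF a - (1 / (P : ℝ)) • intVec g.fn =
        (-(1 / (P : ℝ))) • (intVec g.fn - (P : ℝ) • dF a) := by
      rw [smul_sub, smul_smul]
      have : -(1 / (P : ℝ)) * P = -1 := by field_simp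
      rw [this]
      simp only [neg_smul, one_smul]
      abel
    rw [this, norm_smul, norm_neg, Real.norm_of_nonneg (by positivity), div_mul_eq_mul_div, one_mul]
    exact div_le_div_of_nonneg_right hA.g_near (by positivity)
  refine ⟨l / P, l * τ / s, l • (F a - (1 / (P : ℝ)) • intVec f.fn) +
    (l * τ) • (dF a - (1 / (P : ℝ)) • intVec g.fn) + l • (F t - F a - τ • dF a) + (v - l • F t),
    ?_, ?_, ?_, ?_⟩
  · have c1 : l * τ / s * (s / P) = l * τ * (1 / P) := by field_simp
    have c2 : l / P = l * (1 / P) := by ring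
    rw [c1, c2]
    module
  · rw [abs_div, abs_of_pos (by linarith : (0 : ℝ) < P)]
    gcongr
  · rw [abs_div, abs_mul, abs_of_nonneg hτ0, abs_of_pos (by linarith : (0 : ℝ) < s),
      div_le_div_iff₀ (by linarith) (by linarith)]
    rw [le_div_iff₀ (by linarith)] at hτs
    have := mul_le_mul hl' hτs (by positivity) (by positivity)
    nlinarith
  · have hdP : (0 : ℝ) < d / P := by positivity
    obtain ⟨x, hx⟩ : ∃ x : ℝ, x = d / P := ⟨_, rfl⟩
    have hstep := D.step_le
    have hx4 : x ≤ 4 := by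
      rw [hx, div_le_iff₀ (by linarith)]
      exact_mod_cast D.d_le
    have hxP : 1 / P ≤ x := by rw [hx]; gcongr
    have hHx : (1 / (H : ℝ)) ^ 2 ≤ x := by
      rw [hx, div_pow, one_pow, div_le_div_iff₀ (by positivity) (by linarith), one_mul]
      exact D.d_ge
    have hH1 : 1 / (H : ℝ) ≤ 1 := by rw [div_le_one (by linarith)]; linarith
    have hH0 : 0 < 1 / (H : ℝ) := by positivity
    have hδx : min δ 2 ≤ x := by
      rw [hx, le_div_iff₀ (by linarith)]
      exact D.dist_le
    rw [← hx] at hstep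
    have hτx : τ ≤ x + 1 / H := hτs.trans hstep
    have hτ5 : τ ≤ 5 := by linarith
    have hτ2 : τ ^ 2 ≤ 10 * x := by
      have : τ ^ 2 ≤ (x + 1 / H) ^ 2 := by gcongr
      nlinarith [sq_nonneg (x - 1 / H)]
    have hx0 : 0 ≤ x := by linarith
    have hB2 : (B : ℝ) ≤ B ^ 2 := by nlinarith
    have hv0 := norm_nonneg v
    calc _ ≤ |l| * (2 / P) + |l| * τ * (2 / P) + |l| * (B * τ ^ 2) + ‖v‖ * min δ 2 := by
          refine (norm_add_le _ _).trans (add_le_add ((norm_add_le _ _).trans (add_le_add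
            ((norm_add_le _ _).trans (add_le_add ?_ ?_)) ?_)) hlv)
          · rw [norm_smul, Real.norm_eq_abs]; gcongr
          · rw [norm_smul, Real.norm_eq_abs, abs_mul, abs_of_nonneg hτ0]; gcongr
          · rw [norm_smul, Real.norm_eq_abs]; gcongr
      _ ≤ (B * ‖v‖) * (2 * x) + (B * ‖v‖) * 5 * (2 * x) + (B * ‖v‖) * (B * (10 * x)) + ‖v‖ * x := by
          have h2 : 2 / (P : ℝ) ≤ 2 * x := by
            calc 2 / (P : ℝ) = 2 * (1 / P) := by ring
              _ ≤ _ := by linarith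
          gcongr
      _ = (12 * B + 10 * B ^ 2 + 1) * (‖v‖ * x) := by ring
      _ ≤ (23 * B ^ 2) * (‖v‖ * x) := by
          refine mul_le_mul_of_nonneg_right ?_ (by positivity)
          nlinarith
      _ = _ := by rw [hx]; ring

end Arc

end NearCurve

namespace NearCurve
open V3

/-- An integral vector as a triple of real numbers. -/
def V3.cast (w : V3 ℤ) : V3 ℝ := ⟨w.x, w.y, w.z⟩

/-- A vector of Euclidean space as a triple of real numbers. -/
def toV3 (x : E3) : V3 ℝ := ⟨x 0, x 1, x 2⟩

theorem toV3_intVec (w : V3 ℤ) : toV3 (intVec w.fn) = w.cast := rfl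

theorem dot_toV3_self (x : E3) : dot (toV3 x) (toV3 x) = ‖x‖ ^ 2 := by
  rw [norm_sq_eq]; simp only [dot, toV3]; ring

theorem V3.cast_dot (a b : V3 ℤ) : dot a.cast b.cast = (dot a b : ℤ) := by
  simp only [dot, V3.cast]; push_cast; ring

theorem V3.cast_cross (a b : V3 ℤ) : cross a.cast b.cast = (cross a b).cast := by
  simp only [cross, V3.cast, V3.mk.injEq]; push_cast; exact ⟨rfl, rfl, rfl⟩

theorem V3.cast_bil (P d s : ℤ) (f g a b : V3 ℤ) :
    bil (P : ℝ) d s f.cast g.cast a.cast b.cast = (bil P d s f g a b : ℤ) := by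
  simp only [bil, V3.det, dot, cross, V3.cast]; push_cast; ring

theorem V3.cast_disc (P d s : ℤ) (f g : V3 ℤ) :
    disc (P : ℝ) d s f.cast g.cast = (disc P d s f g : ℤ) := by
  simp only [disc, dot, cross, V3.cast]; push_cast; ring

theorem norm_intVec_sq (w : V3 ℤ) : ‖intVec w.fn‖ ^ 2 = (dot w w : ℤ) := by
  rw [← dot_toV3_self, toV3_intVec, V3.cast_dot]

namespace V3

theorem dot_self_nonneg' (a : V3 ℝ) : 0 ≤ dot a a := by
  simp only [dot]; nlinarith [mul_self_nonneg a.x, mul_self_nonneg a.y, mul_self_nonneg a.z]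

/-- Lagrange's identity as an inequality. -/
theorem dot_cross_self_le (a b : V3 ℝ) : dot (cross a b) (cross a b) ≤ dot a a * dot b b := by
  have h : dot a a * dot b b - dot (cross a b) (cross a b) = dot a b * dot a b := by
    simp only [dot, cross]; ring
  nlinarith [mul_self_nonneg (dot a b)]

theorem dot_mul_self_le (a b : V3 ℝ) : dot a b * dot a b ≤ dot a a * dot b b := by
  have h : dot a a * dot b b - dot (cross a b) (cross a b) = dot a b * dot a b := by
    simp only [dot, cross]; ring
  nlinarith [dot_self_nonneg' (cross a b)]

theorem dot_addMul_self_le (a b : V3 ℝ) (r : ℝ) :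
    dot (addMul a r b) (addMul a r b) ≤ 2 * dot a a + 2 * (r * r * dot b b) := by
  have h : 2 * dot a a + 2 * (r * r * dot b b) - dot (addMul a r b) (addMul a r b) =
      dot (subMul a r b) (subMul a r b) := by
    simp only [dot, addMul, subMul]; ring
  nlinarith [dot_self_nonneg' (subMul a r b)]

/-- The quadratic form is `O(Δ)` on combinations of `f`, `(s / P) g` and a vector of length `d` with
bounded coefficients, `Δ` being `disc`. -/
theorem bil_le_of_decomposition {P d s E : ℝ} (hP : 0 < P) {f g ε : V3 ℝ}
    {α β : ℝ} (hα : |α| ≤ E) (hβ : |β| ≤ E) (hε : dot ε ε ≤ E * E * (d * d)) {x : V3 ℝ}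
    (hx : x = addMul (addMul ε α f) (β * (s / P)) g) :
    bil P d s f g x x ≤ 6 * (E * E) * disc P d s f g := by
  have hα' : α * α ≤ E * E := by
    rw [← abs_mul_abs_self α]; exact mul_self_le_mul_self (abs_nonneg _) hα
  have hβ' : β * β ≤ E * E := by
    rw [← abs_mul_abs_self β]; exact mul_self_le_mul_self (abs_nonneg _) hβ
  have hf := dot_self_nonneg' f
  have hg := dot_self_nonneg' g
  have hw := dot_self_nonneg' (cross f g)
  have hE : 0 ≤ E * E := mul_self_nonneg E
  have hss : 0 ≤ s * s := mul_self_nonneg s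
  have hdd : 0 ≤ d * d := mul_self_nonneg d
  have hPP : 0 < P * P := by positivity
  -- The components of `x` along `f` and `g` drop out of the vector products and the determinant;
  -- each of the four terms of the form is then compared with the terms of `disc`.
  have t1 : V3.det x f g * V3.det x f g ≤ E * E * (d * d) * dot (cross f g) (cross f g) := by
    have e : V3.det x f g = dot ε (cross f g) := by
      rw [hx]; simp only [V3.det, dot, cross, addMul]; ring
    rw [e]
    exact (dot_mul_self_le _ _).trans (mul_le_mul_of_nonneg_right hε hw)
  have t2 : P * P * dot (cross x f) (cross x f) ≤
      2 * (E * E) * (P * P * (d * d) * dot f f + s * s * dot (cross f g) (cross f g)) := by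
    have e : cross x f = addMul (cross ε f) (-(β * (s / P))) (cross f g) := by
      rw [hx]; simp only [cross, addMul, V3.mk.injEq]; refine ⟨?_, ?_, ?_⟩ <;> ring
    have h1 := dot_addMul_self_le (cross ε f) (cross f g) (-(β * (s / P)))
    have h2 := (dot_cross_self_le ε f).trans (mul_le_mul_of_nonneg_right hε hf)
    have h3 : P * P * (-(β * (s / P)) * -(β * (s / P)) * dot (cross f g) (cross f g)) =
        β * β * (s * s * dot (cross f g) (cross f g)) := by field_simp
    have h4 : β * β * (s * s * dot (cross f g) (cross f g)) ≤
        E * E * (s * s * dot (cross f g) (cross f g)) :=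
      mul_le_mul_of_nonneg_right hβ' (mul_nonneg hss hw)
    rw [e]
    have h5 := mul_le_mul_of_nonneg_left h1 hPP.le
    have h6 := mul_le_mul_of_nonneg_left h2 hPP.le
    linarith
  have t3 : dot (cross x g) (cross x g) ≤
      2 * (E * E) * (d * d * dot g g + dot (cross f g) (cross f g)) := by
    have e : cross x g = addMul (cross ε g) α (cross f g) := by
      rw [hx]; simp only [cross, addMul, V3.mk.injEq]; refine ⟨?_, ?_, ?_⟩ <;> ring
    have h1 := dot_addMul_self_le (cross ε g) (cross f g) α
    have h2 := (dot_cross_self_le ε g).trans (mul_le_mul_of_nonneg_right hε hg)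
    have h4 := mul_le_mul_of_nonneg_right hα' hw
    rw [e]
    linarith
  have t4 : P * P * dot x x ≤ 4 * (E * E) * (P * P * (d * d) + P * P * dot f f + s * s * dot g g) := by
    have h1 := dot_addMul_self_le (addMul ε α f) g (β * (s / P))
    have h2 := dot_addMul_self_le ε f α
    have h3 : P * P * (β * (s / P) * (β * (s / P)) * dot g g) = β * β * (s * s * dot g g) := by
      field_simp
    have h4 : β * β * (s * s * dot g g) ≤ E * E * (s * s * dot g g) :=
      mul_le_mul_of_nonneg_right hβ' (mul_nonneg hss hg)
    have h5 := mul_le_mul_of_nonneg_right hα' hf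
    rw [← hx] at h1
    have h6 := mul_le_mul_of_nonneg_left h1 hPP.le
    have h7 := mul_le_mul_of_nonneg_left h2 hPP.le
    have h8 := mul_le_mul_of_nonneg_left h5 hPP.le
    have h9 := mul_le_mul_of_nonneg_left hε hPP.le
    have : 0 ≤ E * E * (s * s * dot g g) := mul_nonneg hE (mul_nonneg hss hg)
    linarith
  have m1 := mul_le_mul_of_nonneg_left t1 hss
  have m2 := mul_le_mul_of_nonneg_left t2 hdd
  have m3 := mul_le_mul_of_nonneg_left t3 (mul_nonneg hdd hss)
  have m4 := mul_le_mul_of_nonneg_left t4 (mul_nonneg hdd hdd)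
  have n1 : 0 ≤ E * E * (d * d * (s * s) * dot (cross f g) (cross f g)) := by positivity
  have n2 : 0 ≤ E * E * (d * d * (d * d) * (P * P) * dot f f) := by positivity
  have n3 : 0 ≤ E * E * (d * d * (d * d) * (s * s) * dot g g) := by positivity
  have n4 : 0 ≤ E * E * (d * d * (d * d) * (d * d) * (P * P)) := by positivity
  simp only [bil, disc]
  linarith

end V3

/-- The threshold for the quadratic form of an arc.  The integral division is harmless, as the form
takes integral values on integral vectors. -/
def threshold (H P d s : ℤ) (f g : V3 ℤ) : ℤ := H * H * disc P d s f g / (P * P)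

section Arc

variable {B : ℕ} {N δ : ℝ} {H P d s : ℤ}

/-- The factor `6` comes from the bound for the form in terms of `disc`, and `23 B²` from the
errors of the decomposition; `N` bounds the coordinates, hence `√3 N` the length, and `6 · 3 · 23²
< 113²`. -/
theorem GridData.coeff_sq_le (D : GridData B N δ H P d s) {w : V3 ℤ} (hN : |(w.x : ℝ)| ≤ N ∧
    |(w.y : ℝ)| ≤ N ∧ |(w.z : ℝ)| ≤ N) :
    6 * (23 * B ^ 2 * ‖intVec w.fn‖) ^ 2 ≤ (H : ℝ) ^ 2 := by
  have h1 : ‖intVec w.fn‖ ^ 2 ≤ 3 * N ^ 2 := by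
    rw [norm_intVec_sq]
    have hx := sq_le_sq' (neg_le_of_abs_le hN.1) (le_of_abs_le hN.1)
    have hy := sq_le_sq' (neg_le_of_abs_le hN.2.1) (le_of_abs_le hN.2.1)
    have hz := sq_le_sq' (neg_le_of_abs_le hN.2.2) (le_of_abs_le hN.2.2)
    simp only [dot]
    push_cast
    linarith
  have h2 : (113 * (B : ℝ) ^ 2 * N) ^ 2 ≤ (H : ℝ) ^ 2 :=
    pow_le_pow_left₀ (by have := D.N_gt; positivity) D.H_ge 2
  have h3 : (0 : ℝ) ≤ (B : ℝ) ^ 4 := by positivity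
  nlinarith [mul_le_mul_of_nonneg_left h1 h3, mul_nonneg h3 (sq_nonneg N)]

end Arc
end NearCurve

namespace NearCurve
open V3

section Arc

variable {B : ℕ} {N δ : ℝ} {H P d s : ℤ}

/-- The decomposition in coordinates, with the bounds in the form in which they enter the estimate
of the quadratic form. -/
theorem exists_arc_decomposition' {φ : unitInterval → RP2} {F dF ddF : ℝ → E3}
    (hF : BoundedLift φ F dF ddF B) (D : GridData B N δ H P d s) {j : ℤ} {f g : V3 ℤ}
    (hA : ArcData F dF P j f g) (hj : 0 ≤ j) {t : unitInterval} (ht : (j : ℝ) / P ≤ t)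
    (ht' : (t : ℝ) ≤ (j + s) / P) {w : V3 ℤ} (hw : intVec w.fn ≠ 0)
    (h : projDist (Projectivization.mk ℝ _ hw) (φ t) ≤ δ) :
    ∃ (α β : ℝ) (ε : V3 ℝ), w.cast = addMul (addMul ε α f.cast) (β * (s / P)) g.cast ∧
      |α| ≤ 23 * B ^ 2 * ‖intVec w.fn‖ / P ∧ |β| ≤ B * ‖intVec w.fn‖ / P ∧
      dot ε ε ≤ (23 * B ^ 2 * ‖intVec w.fn‖ / P) * (23 * B ^ 2 * ‖intVec w.fn‖ / P) * (d * d) := by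
  obtain ⟨α, β, ε, e, hα, hβ, hε⟩ := exists_arc_decomposition hF D hA hj ht ht' hw h
  have hB : (1 : ℝ) ≤ B := by exact_mod_cast D.B_pos
  have hP : (0 : ℝ) < P := by have := D.P_pos; exact_mod_cast (by omega : 0 < P)
  refine ⟨α, β, toV3 ε, ?_, hα.trans ?_, hβ, ?_⟩
  · rw [← toV3_intVec, ← toV3_intVec, ← toV3_intVec, e]
    simp only [toV3, addMul, V3.mk.injEq, PiLp.add_apply, PiLp.smul_apply, smul_eq_mul]
    refine ⟨?_, ?_, ?_⟩ <;> ring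
  · have := norm_nonneg (intVec w.fn)
    gcongr
    nlinarith
  · rw [dot_toV3_self]
    calc ‖ε‖ ^ 2 ≤ (23 * B ^ 2 * ‖intVec w.fn‖ / P * d) ^ 2 := by gcongr
      _ = _ := by ring

/-- The quadratic form of an arc is below the threshold at all integral vectors near the arc. -/
theorem bil_le_threshold {φ : unitInterval → RP2} {F dF ddF : ℝ → E3}
    (hF : BoundedLift φ F dF ddF B) (D : GridData B N δ H P d s) {j : ℤ} {f g : V3 ℤ}
    (hA : ArcData F dF P j f g) (hj : 0 ≤ j) {t : unitInterval} (ht : (j : ℝ) / P ≤ t)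
    (ht' : (t : ℝ) ≤ (j + s) / P) {w : V3 ℤ} (hw : intVec w.fn ≠ 0)
    (hN : |(w.x : ℝ)| ≤ N ∧ |(w.y : ℝ)| ≤ N ∧ |(w.z : ℝ)| ≤ N)
    (h : projDist (Projectivization.mk ℝ _ hw) (φ t) ≤ δ) :
    bil P d s f g w w ≤ threshold H P d s f g := by
  obtain ⟨α, β, ε, e, hα, hβ, hε⟩ := exists_arc_decomposition' hF D hA hj ht ht' hw h
  have hB : (1 : ℝ) ≤ B := by exact_mod_cast D.B_pos
  have hP0 : 0 < P := by have := D.P_pos; omega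
  have hP : (0 : ℝ) < P := by exact_mod_cast hP0
  have hβ' : |β| ≤ 23 * B ^ 2 * ‖intVec w.fn‖ / P := by
    refine hβ.trans ?_
    have := norm_nonneg (intVec w.fn)
    gcongr
    nlinarith
  have h1 := bil_le_of_decomposition hP hα hβ' hε e
  have h2 := D.coeff_sq_le hN
  rw [V3.cast_bil, V3.cast_disc] at h1
  have hΔ : (0 : ℝ) ≤ (disc P d s f g : ℤ) := by
    exact_mod_cast (disc_pos hP0 (by have := D.d_pos; omega)).le
  rw [threshold, Int.le_ediv_iff_mul_le (by positivity)]
  have h3 : (bil P d s f g w w : ℤ) * ((P : ℝ) * P) ≤ (H : ℝ) * H * (disc P d s f g : ℤ) := by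
    calc ((bil P d s f g w w : ℤ) : ℝ) * ((P : ℝ) * P)
        ≤ 6 * (23 * B ^ 2 * ‖intVec w.fn‖ / P * (23 * B ^ 2 * ‖intVec w.fn‖ / P)) *
          (disc P d s f g : ℤ) * (P * P) := mul_le_mul_of_nonneg_right h1 (by positivity)
      _ = 6 * (23 * B ^ 2 * ‖intVec w.fn‖) ^ 2 * (disc P d s f g : ℤ) := by field_simp
      _ ≤ (H : ℝ) ^ 2 * (disc P d s f g : ℤ) := mul_le_mul_of_nonneg_right h2 hΔ
      _ = _ := by ring
  exact_mod_cast h3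

theorem GridData.B_le (D : GridData B N δ H P d s) : 113 * (B : ℝ) ≤ P := by
  have hB : (1 : ℝ) ≤ B := by exact_mod_cast D.B_pos
  have h1 := D.H_ge
  have h2 := D.N_gt
  have h3 := D.H_pos
  have h4 : (H : ℝ) ^ 2 ≤ P := by exact_mod_cast D.P_ge
  have h5 : (B : ℝ) ≤ B ^ 2 := by nlinarith
  have h6 : (B : ℝ) ^ 2 ≤ B ^ 2 * N := le_mul_of_one_le_right (by positivity) h2.le
  nlinarith

/-- The data of an arc have the expected size. -/
theorem ArcData.norm_bounds {φ : unitInterval → RP2} {F dF ddF : ℝ → E3}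
    (hF : BoundedLift φ F dF ddF B) (D : GridData B N δ H P d s) {j : ℤ} {f g : V3 ℤ}
    (hA : ArcData F dF P j f g) (hj : 0 ≤ j) (hjP : j ≤ P) :
    ‖intVec f.fn‖ ≤ 2 * B * P ∧ ‖intVec g.fn‖ ≤ 2 * B * P ∧ 0 < ‖intVec f.fn‖ := by
  have hP : (113 : ℝ) ≤ P := by exact_mod_cast D.P_pos
  have hB : (1 : ℝ) ≤ B := by exact_mod_cast D.B_pos
  have hBP := D.B_le
  have hj' : (0 : ℝ) ≤ j := by exact_mod_cast hj
  have hmem : (j : ℝ) / P ∈ Set.Icc (0 : ℝ) 1 :=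
    ⟨by positivity, by rw [div_le_one (by linarith)]; exact_mod_cast hjP⟩
  have key : ∀ x y : E3, ‖x - (P : ℝ) • y‖ ≤ 2 → ‖y‖ ≤ B → ‖x‖ ≤ 2 * B * P := by
    intro x y h1 h2
    have h3 := norm_sub_norm_le x ((P : ℝ) • y)
    rw [norm_smul, Real.norm_of_nonneg (by linarith)] at h3
    nlinarith
  refine ⟨key _ _ hA.f_near (hF.norm_le _ hmem), key _ _ hA.g_near (hF.norm_deriv_le _ hmem), ?_⟩
  have h3 := norm_sub_norm_le ((P : ℝ) • F (j / P)) (intVec f.fn)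
  rw [norm_sub_rev, norm_smul, Real.norm_of_nonneg (by linarith)] at h3
  have h4 := hF.le_norm _ hmem
  have h5 := hA.f_near
  have h6 : (P : ℝ) ≤ B * (P * ‖F (j / P)‖) := by nlinarith
  by_contra hc
  have h7 : (P : ℝ) * ‖F (j / P)‖ ≤ 2 := by linarith
  nlinarith

/-- A bound for the tangent of a small angle from one for its sine: here `q` is the product of two
squared lengths, `c` the squared length of a vector product and `z` the square of an inner product.
-/
theorem cone_arith {H b c z q : ℝ} (hb : 0 < b) (hH : 113 * b ≤ H)
    (h : H * H * c ≤ 1090 * b ^ 2 * q) (hcz : c + z = q) (hc : 0 ≤ c) (hq : 0 < q) :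
    H * H * c ≤ 1600 * b ^ 2 * z ∧ 0 < z := by
  have hb2 : 0 < b ^ 2 := by positivity
  have h1 : 12769 * b ^ 2 ≤ H * H := by
    have := mul_self_le_mul_self (by positivity) hH
    linarith [this, (by ring : 113 * b * (113 * b) = 12769 * b ^ 2)]
  have h2 : 12769 * c ≤ 1090 * q := by
    refine le_of_mul_le_mul_left (a := b ^ 2) ?_ hb2
    linarith [mul_le_mul_of_nonneg_right h1 hc]
  have h3 : 9 * q ≤ 10 * z := by linarith
  have h4 := mul_le_mul_of_nonneg_left h3 hb2.le
  have h5 : 0 ≤ b ^ 2 * z := mul_nonneg hb2.le (by linarith)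
  exact ⟨by linarith, by linarith⟩

/-- When the neighbourhood is thin, integral vectors near the arc have a small angle with `f`. -/
theorem cone_of_near {φ : unitInterval → RP2} {F dF ddF : ℝ → E3}
    (hF : BoundedLift φ F dF ddF B) (D : GridData B N δ H P d s) (hthin : d * H ≤ P)
    {j : ℤ} {f g : V3 ℤ}
    (hA : ArcData F dF P j f g) (hj : 0 ≤ j) (hjP : j ≤ P) {t : unitInterval}
    (ht : (j : ℝ) / P ≤ t) (ht' : (t : ℝ) ≤ (j + s) / P) {w : V3 ℤ} (hw : intVec w.fn ≠ 0)
    (h : projDist (Projectivization.mk ℝ _ hw) (φ t) ≤ δ) :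
    H * H * dot (cross w f) (cross w f) ≤ (40 * B * B) ^ 2 * (dot w f * dot w f) ∧
      dot w f ≠ 0 := by
  obtain ⟨α, β, ε, e, hα, hβ, hε⟩ := exists_arc_decomposition' hF D hA hj ht ht' hw h
  obtain ⟨-, hg, hf⟩ := hA.norm_bounds hF D hj hjP
  have hB : (1 : ℝ) ≤ B := by exact_mod_cast D.B_pos
  have hP : (0 : ℝ) < P := by have := D.P_pos; exact_mod_cast (by omega : 0 < P)
  have hH := D.H_pos
  have hd : (0 : ℝ) < d := by have := D.d_pos; exact_mod_cast (by omega : 0 < d)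
  have hs : (0 : ℝ) < s := hd.trans_le (by exact_mod_cast D.le_s)
  have hw0 : 0 < ‖intVec w.fn‖ := norm_pos_iff.2 hw
  have hdP : (d : ℝ) / P ≤ 1 / H := by
    rw [div_le_div_iff₀ hP (by linarith)]
    exact_mod_cast (by linarith : d * H ≤ 1 * P)
  have hsP : (s : ℝ) / P ≤ 2 / H := by
    have := D.step_le
    have : (2 : ℝ) / H = 1 / H + 1 / H := by ring
    linarith
  obtain ⟨v, hv⟩ : ∃ v, v = ‖intVec w.fn‖ := ⟨_, rfl⟩
  have e1 : cross w.cast f.cast =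
      addMul (cross ε f.cast) (β * (s / P)) (cross g.cast f.cast) := by
    rw [e]; simp only [cross, addMul, V3.mk.injEq]; refine ⟨?_, ?_, ?_⟩ <;> ring
  have h1 := dot_addMul_self_le (cross ε f.cast) (cross g.cast f.cast) (β * (s / P))
  rw [← e1] at h1
  have hff := dot_self_nonneg' f.cast
  have h2 := (dot_cross_self_le ε f.cast).trans (mul_le_mul_of_nonneg_right hε hff)
  have h3 := dot_cross_self_le g.cast f.cast
  rw [← hv] at hβ h2
  have h4 : β * (s / P) * (β * (s / P)) * dot g.cast g.cast ≤ (4 * B ^ 2 * v / H) ^ 2 := by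
    have : dot g.cast g.cast = ‖intVec g.fn‖ ^ 2 := by rw [norm_intVec_sq, V3.cast_dot]
    rw [this]
    calc β * (s / P) * (β * (s / P)) * ‖intVec g.fn‖ ^ 2 = (|β| * (s / P) * ‖intVec g.fn‖) ^ 2 := by
          rw [mul_pow, mul_pow, sq_abs]; ring
      _ ≤ (B * v / P * (2 / H) * (2 * B * P)) ^ 2 := by
          have : 0 ≤ v := by rw [hv]; positivity
          gcongr
      _ = _ := by field_simp; ring
  have h5 : 23 * (B : ℝ) ^ 2 * v / P * (23 * B ^ 2 * v / P) * (d * d) ≤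
      (23 * B ^ 2 * v / H) ^ 2 := by
    calc 23 * (B : ℝ) ^ 2 * v / P * (23 * B ^ 2 * v / P) * (d * d) =
        (23 * B ^ 2 * v * (d / P)) ^ 2 := by ring
      _ ≤ (23 * B ^ 2 * v * (1 / H)) ^ 2 := by
          have : 0 ≤ v := by rw [hv]; positivity
          gcongr
      _ = _ := by ring
  have h6 : (H : ℝ) * H * dot (cross w.cast f.cast) (cross w.cast f.cast) ≤
      1090 * (B : ℝ) ^ 4 * v ^ 2 * dot f.cast f.cast := by
    have k1 : dot (cross w.cast f.cast) (cross w.cast f.cast) ≤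
        2 * ((23 * B ^ 2 * v / H) ^ 2 * dot f.cast f.cast) +
        2 * ((4 * B ^ 2 * v / H) ^ 2 * dot f.cast f.cast) := by
      have k2 := mul_le_mul_of_nonneg_right h5 hff
      have k3 := mul_le_mul_of_nonneg_right h4 hff
      have k4 := mul_le_mul_of_nonneg_left h3 (mul_self_nonneg (β * (s / P)))
      nlinarith
    calc _ ≤ (H : ℝ) * H * (2 * ((23 * B ^ 2 * v / H) ^ 2 * dot f.cast f.cast) +
        2 * ((4 * B ^ 2 * v / H) ^ 2 * dot f.cast f.cast)) := by gcongr
      _ = _ := by field_simp; ring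
  have hff' : 0 < dot f.cast f.cast := by
    rw [V3.cast_dot, ← norm_intVec_sq]; positivity
  have hww : dot w.cast w.cast = v ^ 2 := by rw [V3.cast_dot, ← norm_intVec_sq, hv]
  have hlag : dot (cross w.cast f.cast) (cross w.cast f.cast) +
      dot w.cast f.cast * dot w.cast f.cast = v ^ 2 * dot f.cast f.cast := by
    rw [← hww]; simp only [dot, cross]; ring
  have hHB : 113 * (B : ℝ) ^ 2 ≤ H := by
    have := D.H_ge
    have := D.N_gt
    have : (113 : ℝ) * B ^ 2 ≤ 113 * B ^ 2 * N := le_mul_of_one_le_right (by positivity) this.le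
    linarith
  have hv0 : 0 < v ^ 2 := by rw [hv]; positivity
  have hlast := cone_arith (b := (B : ℝ) ^ 2) (q := v ^ 2 * dot f.cast f.cast) (by positivity) hHB
    (h6.trans_eq (by ring)) hlag (dot_self_nonneg' _) (mul_pos hv0 hff')
  rw [V3.cast_cross, V3.cast_dot, V3.cast_dot] at hlast
  obtain ⟨h7, h8⟩ := hlast
  constructor
  · have h9 : (1600 : ℝ) * ((B : ℝ) ^ 2) ^ 2 = (40 * B * B) ^ 2 := by ring
    rw [h9] at h7
    exact_mod_cast h7
  · intro h0
    rw [h0] at h8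
    simp at h8

end Arc

end NearCurve

namespace NearCurve
open V3

/-! ### The segment that replaces a thin cone -/

/-- The vector `|n|² f - (n · f) n`, which spans the projection of `f` to the plane `n^⊥`. -/
def V3.proj {α : Type} [Add α] [Sub α] [Mul α] (n f : V3 α) : V3 α := cross (cross n f) n

theorem V3.eq_zero_of_dot_self {a : V3 ℤ} (h : dot a a = 0) : a = ⟨0, 0, 0⟩ := by
  by_contra hc
  have := bil_self_pos (P := 1) (d := 1) (s := 0) (f := ⟨0, 0, 0⟩) (g := ⟨0, 0, 0⟩) (by norm_num)
    (by norm_num) hc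
  simp [bil, det, dot, cross] at this h
  omega

theorem V3.dot_self_pos {a : V3 ℤ} (h : a ≠ ⟨0, 0, 0⟩) : 0 < dot a a :=
  lt_of_le_of_ne (dot_self_nonneg a) fun hc => h (eq_zero_of_dot_self hc.symm)

/-- The two factors of the vector product that defines `proj` are orthogonal. -/
theorem dot_proj_self (n f : V3 ℤ) :
    dot (proj n f) (proj n f) = dot n n * dot (cross n f) (cross n f) := by
  simp only [proj, dot, cross]; ring

/-- In a plane that contains a vector with a small angle to `f`, the normal is not a multiple
of `f`. -/
theorem cross_ne_zero_of_dot {w n f : V3 ℤ} (hn : dot w n = 0) (hn0 : n ≠ ⟨0, 0, 0⟩)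
    (hf : dot w f ≠ 0) : cross n f ≠ ⟨0, 0, 0⟩ := by
  intro hc
  have h1 : dot n n * dot w f = dot n f * dot w n + dot w (cross (cross n f) n) := by
    simp only [dot, cross]; ring
  rw [hc, hn] at h1
  have h2 := dot_self_pos hn0
  have h3 : dot n n * dot w f = 0 := by rw [h1]; simp [dot, cross]
  rcases mul_eq_zero.1 h3 with h | h
  · omega
  · exact hf h

/-- A plane vector in terms of the two ends `H p - S g` and `H p + S g` of the segment, where
`g = n × f` and `p = g × n` form an orthogonal basis of the plane. -/
theorem smul_eq_ends {w n f : V3 ℤ} (hn : dot w n = 0) (H S : ℤ) :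
    smul (2 * H * S * dot (cross n f) (cross n f)) w =
      addMul (smul (S * dot w f - H * dot w (cross n f))
          (subMul (smul H (proj n f)) S (cross n f)))
        (S * dot w f + H * dot w (cross n f)) (addMul (smul H (proj n f)) S (cross n f)) := by
  have key : ∀ a b c : ℤ, a - b = c * dot w n → a = b := fun a b c h => by
    rw [hn] at h; linarith
  ext
  · apply key _ _ (2 * H * S * (dot f f * n.x - dot n f * f.x))
    simp only [smul, addMul, subMul, proj, dot, cross]; ring
  · apply key _ _ (2 * H * S * (dot f f * n.y - dot n f * f.y))
    simp only [smul, addMul, subMul, proj, dot, cross]; ring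
  · apply key _ _ (2 * H * S * (dot f f * n.z - dot n f * f.z))
    simp only [smul, addMul, subMul, proj, dot, cross]; ring

theorem V3.intVec_ne_zero {w : V3 ℤ} : intVec w.fn ≠ 0 ↔ w ≠ ⟨0, 0, 0⟩ := by
  rw [not_iff_not]
  constructor
  · intro h
    have h1 := norm_intVec_sq w
    rw [h] at h1
    simp only [norm_zero] at h1
    refine eq_zero_of_dot_self ?_
    have : ((dot w w : ℤ) : ℝ) = 0 := by rw [← h1]; norm_num
    exact_mod_cast this
  · rintro rfl
    ext i
    fin_cases i <;> simp [intVec, V3.fn]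

theorem V3.fn_ne_zero {w : V3 ℤ} (h : w ≠ ⟨0, 0, 0⟩) : w.fn ≠ 0 := by
  intro hc
  apply h
  have h0 := congrFun hc 0
  have h1 := congrFun hc 1
  have h2 := congrFun hc 2
  simp [V3.fn] at h0 h1 h2
  ext <;> assumption

/-- Membership in a projective segment from an integral relation between coordinate vectors. -/
theorem mem_projSegment {w u v : V3 ℤ} (hw : intVec w.fn ≠ 0) {c a b : ℤ} (hc : c ≠ 0)
    (ha : 0 ≤ a) (hb : 0 ≤ b) (h : smul c w = addMul (smul a u) b v) :
    Projectivization.mk ℝ (intVec w.fn) hw ∈ projSegment (intVec u.fn) (intVec v.fn) := by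
  have e : (a : ℝ) • intVec u.fn + (b : ℝ) • intVec v.fn = (c : ℝ) • intVec w.fn := by
    obtain ⟨h1, h2, h3⟩ := V3.mk.inj h
    simp only [smul] at h1 h2 h3
    ext i
    fin_cases i
    · simp [intVec, V3.fn]; exact_mod_cast h1.symm
    · simp [intVec, V3.fn]; exact_mod_cast h2.symm
    · simp [intVec, V3.fn]; exact_mod_cast h3.symm
  have hc' : (c : ℝ) ≠ 0 := by exact_mod_cast hc
  refine ⟨a, b, by exact_mod_cast ha, by exact_mod_cast hb, ?_, ?_⟩
  · rw [e]; exact smul_ne_zero hc' hw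
  · rw [Projectivization.mk_eq_mk_iff']
    refine ⟨(c : ℝ)⁻¹, ?_⟩
    rw [e, smul_smul, inv_mul_cancel₀ hc', one_smul]

/-- In the plane `n^⊥`, the points whose angle with `f` has tangent at most `C / H` lie on the
segment.  The number `N₁` stands for an integral upper bound of the length of `n`, which need not
be an integer. -/
theorem projSegment_contains {w n f : V3 ℤ} (hw : intVec w.fn ≠ 0) (hn : dot w n = 0)
    (hn0 : n ≠ ⟨0, 0, 0⟩) (hf : dot w f ≠ 0) {H C N₁ : ℤ} (hH : 0 < H) (hC : 0 < C) (hN : 0 ≤ N₁)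
    (hN₁ : dot n n ≤ N₁ * N₁)
    (h : H * H * dot (cross w f) (cross w f) ≤ C ^ 2 * (dot w f * dot w f)) :
    Projectivization.mk ℝ (intVec w.fn) hw ∈
      projSegment (intVec (subMul (smul H (proj n f)) (C * N₁) (cross n f)).fn)
        (intVec (addMul (smul H (proj n f)) (C * N₁) (cross n f)).fn) := by
  have hG := dot_self_pos (cross_ne_zero_of_dot hn hn0 hf)
  have hnn := dot_self_pos hn0
  have hN0 : 0 < N₁ := by
    rcases hN.lt_or_eq with h | h
    · exact h
    · rw [← h] at hN₁; linarith
  have h1 : dot w (cross n f) * dot w (cross n f) ≤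
      dot n n * dot (cross w f) (cross w f) := by
    have e : dot n n * dot (cross w f) (cross w f) = dot w (cross n f) * dot w (cross n f) +
        dot (cross n (cross w f)) (cross n (cross w f)) := by
      simp only [dot, cross]; ring
    have := dot_self_nonneg (cross n (cross w f))
    linarith
  have h2 : (H * dot w (cross n f)) ^ 2 ≤ (C * N₁ * dot w f) ^ 2 := by
    calc (H * dot w (cross n f)) ^ 2 = H * H * (dot w (cross n f) * dot w (cross n f)) := by ring
      _ ≤ H * H * (dot n n * dot (cross w f) (cross w f)) :=
          mul_le_mul_of_nonneg_left h1 (by positivity)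
      _ = dot n n * (H * H * dot (cross w f) (cross w f)) := by ring
      _ ≤ dot n n * (C ^ 2 * (dot w f * dot w f)) := mul_le_mul_of_nonneg_left h hnn.le
      _ ≤ N₁ * N₁ * (C ^ 2 * (dot w f * dot w f)) :=
          mul_le_mul_of_nonneg_right hN₁ (mul_nonneg (sq_nonneg _) (mul_self_nonneg _))
      _ = _ := by ring
  have h3 := sq_le_sq.1 h2
  have h4 := smul_eq_ends (f := f) hn H (C * N₁)
  have h5 : 2 * H * (C * N₁) * dot (cross n f) (cross n f) ≠ 0 := by positivity
  -- If `w` points away from `f`, then `-w` is a nonnegative combination of the ends.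
  rcases lt_or_gt_of_ne hf with h6 | h6
  · have h7 : C * N₁ * dot w f < 0 := mul_neg_of_pos_of_neg (by positivity) h6
    rw [abs_of_neg h7, abs_le] at h3
    refine mem_projSegment hw (c := -(2 * H * (C * N₁) * dot (cross n f) (cross n f)))
      (a := -(C * N₁ * dot w f - H * dot w (cross n f)))
      (b := -(C * N₁ * dot w f + H * dot w (cross n f))) (by omega) (by linarith) (by linarith) ?_
    obtain ⟨k1, k2, k3⟩ := V3.mk.inj h4
    simp only [smul] at k1 k2 k3
    ext
    · simp only [smul, addMul] at *; linarith
    · simp only [smul, addMul] at *; linarith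
    · simp only [smul, addMul] at *; linarith
  · have h7 : 0 < C * N₁ * dot w f := by positivity
    rw [abs_of_pos h7, abs_le] at h3
    exact mem_projSegment hw h5 (by linarith) (by linarith) h4

/-- Both ends have a positive inner product with the projection of `f`. -/
theorem ends_ne_zero {n f : V3 ℤ} (hg : cross n f ≠ ⟨0, 0, 0⟩) {H : ℤ} (hH : 0 < H) (S : ℤ) :
    subMul (smul H (proj n f)) S (cross n f) ≠ ⟨0, 0, 0⟩ ∧
      addMul (smul H (proj n f)) S (cross n f) ≠ ⟨0, 0, 0⟩ := by
  have hn0 : n ≠ ⟨0, 0, 0⟩ := by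
    rintro rfl
    exact hg (by simp [cross])
  have h1 : 0 < H * dot (proj n f) (proj n f) := by
    have := dot_self_pos hg
    have := dot_self_pos hn0
    rw [dot_proj_self]
    positivity
  have e1 : dot (subMul (smul H (proj n f)) S (cross n f)) (proj n f) =
      H * dot (proj n f) (proj n f) := by
    simp only [dot, subMul, smul, proj, cross]; ring
  have e2 : dot (addMul (smul H (proj n f)) S (cross n f)) (proj n f) =
      H * dot (proj n f) (proj n f) := by
    simp only [dot, addMul, smul, proj, cross]; ring
  constructor
  · intro hc
    rw [hc] at e1
    simp only [dot, zero_mul, add_zero] at e1 h1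
    omega
  · intro hc
    rw [hc] at e2
    simp only [dot, zero_mul, add_zero] at e2 h1
    omega

theorem angle_sub_add_le {x z : E3} (h : inner ℝ x z = 0) (hx : x ≠ 0) :
    InnerProductGeometry.angle (x - z) (x + z) ≤ 2 * (‖z‖ / ‖x‖) := by
  have h1 := InnerProductGeometry.angle_le_angle_add_angle (x - z) x (x + z)
  have h2 := InnerProductGeometry.angle_add_eq_arctan_of_inner_eq_zero h hx
  have h3 := InnerProductGeometry.angle_add_eq_arctan_of_inner_eq_zero (x := x) (y := -z)
    (by rw [inner_neg_right, h, neg_zero]) hx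
  rw [← sub_eq_add_neg, norm_neg] at h3
  rw [InnerProductGeometry.angle_comm (x - z) x, h2, h3] at h1
  have h4 : Real.arctan (‖z‖ / ‖x‖) ≤ ‖z‖ / ‖x‖ := by
    have := Real.le_tan (Real.arctan_nonneg.2 (by positivity)) (Real.arctan_lt_pi_div_two (‖z‖ / ‖x‖))
    rwa [Real.tan_arctan] at this
  linarith

/-- The ends have coordinates `H |n|` and `± C N₁` in an orthogonal basis of vectors of equal
length, so that the tangent of half the angle is at most `2 C / H`. -/
theorem angle_ends_le {n f : V3 ℤ} (hg : cross n f ≠ ⟨0, 0, 0⟩) {H C N₁ : ℤ} (hH : 0 < H)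
    (hC : 0 < C) (hN : 0 ≤ N₁) (hN₁ : N₁ * N₁ ≤ 4 * dot n n) :
    InnerProductGeometry.angle (intVec (subMul (smul H (proj n f)) (C * N₁) (cross n f)).fn)
      (intVec (addMul (smul H (proj n f)) (C * N₁) (cross n f)).fn) ≤ 4 * C / H := by
  have hn0 : n ≠ ⟨0, 0, 0⟩ := by
    rintro rfl
    exact hg (by simp [cross])
  have hG := dot_self_pos hg
  have hnn := dot_self_pos hn0
  have hp : proj n f ≠ ⟨0, 0, 0⟩ := by
    intro hc
    have := dot_proj_self n f
    rw [hc] at this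
    have : 0 < dot n n * dot (cross n f) (cross n f) := by positivity
    simp [dot] at *
    omega
  have hH' : (0 : ℝ) < H := by exact_mod_cast hH
  have hC' : (0 : ℝ) < C := by exact_mod_cast hC
  have hN' : (0 : ℝ) ≤ N₁ := by exact_mod_cast hN
  have e1 : intVec (subMul (smul H (proj n f)) (C * N₁) (cross n f)).fn =
      (H : ℝ) • intVec (proj n f).fn - ((C : ℝ) * N₁) • intVec (cross n f).fn := by
    ext i; fin_cases i <;> simp [intVec, V3.fn, subMul, smul]
  have e2 : intVec (addMul (smul H (proj n f)) (C * N₁) (cross n f)).fn =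
      (H : ℝ) • intVec (proj n f).fn + ((C : ℝ) * N₁) • intVec (cross n f).fn := by
    ext i; fin_cases i <;> simp [intVec, V3.fn, addMul, smul]
  rw [e1, e2]
  have hp' := V3.intVec_ne_zero.2 hp
  refine (angle_sub_add_le ?_ (smul_ne_zero hH'.ne' hp')).trans ?_
  · rw [inner_smul_left, inner_smul_right]
    have : inner ℝ (intVec (proj n f).fn) (intVec (cross n f).fn) = 0 := by
      have e : dot (proj n f) (cross n f) = 0 := by simp only [dot, proj, cross]; ring
      have e' : ((dot (proj n f) (cross n f) : ℤ) : ℝ) = 0 := by rw [e]; simp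
      rw [← e']
      simp [intVec, V3.fn, PiLp.inner_apply, Fin.sum_univ_three, dot]
      ring
    rw [this]; simp
  · rw [norm_smul, norm_smul, Real.norm_of_nonneg hH'.le, Real.norm_of_nonneg (by positivity)]
    have hpn : 0 < ‖intVec (proj n f).fn‖ := norm_pos_iff.2 hp'
    have key : (N₁ : ℝ) * ‖intVec (cross n f).fn‖ ≤ 2 * ‖intVec (proj n f).fn‖ := by
      refine (sq_le_sq₀ (by positivity) (by positivity)).1 ?_
      rw [mul_pow, mul_pow, norm_intVec_sq, norm_intVec_sq, dot_proj_self]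
      have := mul_le_mul_of_nonneg_right hN₁ hG.le
      have h2 : ((N₁ * N₁ * dot (cross n f) (cross n f) : ℤ) : ℝ) ≤
        (4 * dot n n * dot (cross n f) (cross n f) : ℤ) := by exact_mod_cast this
      push_cast at h2 ⊢
      linarith
    rw [show (2 : ℝ) * (C * N₁ * ‖intVec (cross n f).fn‖ / (H * ‖intVec (proj n f).fn‖)) =
      2 * C * (N₁ * ‖intVec (cross n f).fn‖) / (H * ‖intVec (proj n f).fn‖) by ring,
      div_le_div_iff₀ (by positivity) hH']
    have := mul_le_mul_of_nonneg_left key (by positivity : 0 ≤ 2 * (C : ℝ) * H)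
    linarith

/-- The sum of the absolute values of the coordinates. -/
def V3.l1 (n : V3 ℤ) : ℤ := |n.x| + |n.y| + |n.z|

theorem V3.l1_nonneg (n : V3 ℤ) : 0 ≤ l1 n := by unfold l1; positivity

theorem V3.dot_self_le_l1 (n : V3 ℤ) : dot n n ≤ l1 n * l1 n := by
  have h1 := abs_mul_abs_self n.x
  have h2 := abs_mul_abs_self n.y
  have h3 := abs_mul_abs_self n.z
  have h4 := mul_nonneg (abs_nonneg n.x) (abs_nonneg n.y)
  have h5 := mul_nonneg (abs_nonneg n.x) (abs_nonneg n.z)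
  have h6 := mul_nonneg (abs_nonneg n.y) (abs_nonneg n.z)
  simp only [dot, l1]
  nlinarith

theorem V3.l1_le_dot_self (n : V3 ℤ) : l1 n * l1 n ≤ 4 * dot n n := by
  have h1 := abs_mul_abs_self n.x
  have h2 := abs_mul_abs_self n.y
  have h3 := abs_mul_abs_self n.z
  have h4 := mul_self_nonneg (|n.x| - |n.y|)
  have h5 := mul_self_nonneg (|n.x| - |n.z|)
  have h6 := mul_self_nonneg (|n.y| - |n.z|)
  have h7 := dot_self_nonneg n
  simp only [dot, l1] at *
  nlinarith

end NearCurve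

namespace NearCurve
open V3

/-! ### The output of a run -/

/-- The output consists of at most `p` points and `q` segments, represented by nonzero vectors; the
segments have length at most `ℓ`, and no record takes more digits than a segment with coordinates
at most `X`. -/
structure Output (X : ℕ) (ℓ : ℝ) (p q : ℕ) (o : List Record) : Prop where
  points : o.countP Record.isPoint ≤ p
  segments : o.countP Record.isSegment ≤ q
  valid : ∀ R ∈ o, R.Valid
  length_le : ∀ R ∈ o, R.length ≤ ℓ
  bits_le : ∀ R ∈ o, R.bits ≤ 7 * (1 + X.size)

theorem Output.nil {X : ℕ} {ℓ : ℝ} : Output X ℓ 0 0 [] :=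
  ⟨by simp, by simp, by simp, by simp, by simp⟩

theorem Output.append {X : ℕ} {ℓ : ℝ} {p q p' q' : ℕ} {o o' : List Record} (h : Output X ℓ p q o)
    (h' : Output X ℓ p' q' o') : Output X ℓ (p + p') (q + q') (o ++ o') := by
  have key : ∀ {S : Record → Prop}, (∀ R ∈ o, S R) → (∀ R ∈ o', S R) → ∀ R ∈ o ++ o', S R :=
    fun h1 h2 R hR => (List.mem_append.1 hR).elim (h1 R) (h2 R)
  exact ⟨by rw [List.countP_append]; exact Nat.add_le_add h.points h'.points,
    by rw [List.countP_append]; exact Nat.add_le_add h.segments h'.segments,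
    key h.valid h'.valid, key h.length_le h'.length_le, key h.bits_le h'.bits_le⟩

theorem Output.mono {X : ℕ} {ℓ : ℝ} {p q p' q' : ℕ} {o : List Record} (h : Output X ℓ p q o)
    (hp : p ≤ p') (hq : q ≤ q') : Output X ℓ p' q' o :=
  ⟨h.points.trans hp, h.segments.trans hq, h.valid, h.length_le, h.bits_le⟩

theorem intBits_le_size {X : ℕ} {z : ℤ} (h : |z| ≤ X) : intBits z ≤ X.size := by
  refine Nat.size_le_size ?_
  rw [Int.abs_eq_natAbs] at h
  exact_mod_cast h

theorem sum_fn_bits_le {X : ℕ} {w : V3 ℤ} (h : |w.x| ≤ X ∧ |w.y| ≤ X ∧ |w.z| ≤ X) :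
    ∑ i, (1 + intBits (w.fn i)) ≤ 3 * (1 + X.size) := by
  have h1 := intBits_le_size h.1
  have h2 := intBits_le_size h.2.1
  have h3 := intBits_le_size h.2.2
  rw [Fin.sum_univ_three]
  simp only [V3.fn, Matrix.cons_val_zero, Matrix.cons_val_one, Matrix.cons_val]
  omega

theorem PointList.output {X n : ℕ} {ℓ : ℝ} (hℓ : 0 ≤ ℓ) {o : List Record} (h : PointList X n o) :
    Output X ℓ n 0 o := by
  refine ⟨List.countP_le_length.trans h.1, ?_, ?_, ?_, ?_⟩
  · rw [Nat.le_zero, List.countP_eq_zero]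
    intro R hR
    obtain ⟨w, rfl, -⟩ := h.2 R hR
    simp [Record.isSegment]
  · intro R hR
    obtain ⟨w, rfl, hw, -⟩ := h.2 R hR
    exact fn_ne_zero hw
  · intro R hR
    obtain ⟨w, rfl, -⟩ := h.2 R hR
    exact hℓ
  · intro R hR
    obtain ⟨w, rfl, -, hX⟩ := h.2 R hR
    have := sum_fn_bits_le hX
    simp only [Record.bits]
    omega

theorem Output.segment {X : ℕ} {ℓ : ℝ} {u v : V3 ℤ} (hu : u ≠ ⟨0, 0, 0⟩) (hv : v ≠ ⟨0, 0, 0⟩)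
    (hX : (|u.x| ≤ X ∧ |u.y| ≤ X ∧ |u.z| ≤ X) ∧ |v.x| ≤ X ∧ |v.y| ≤ X ∧ |v.z| ≤ X)
    (h : InnerProductGeometry.angle (intVec u.fn) (intVec v.fn) ≤ ℓ) :
    Output X ℓ 0 1 [.segment u.fn v.fn] := by
  have h1 := sum_fn_bits_le hX.1
  have h2 := sum_fn_bits_le hX.2
  refine ⟨by simp [Record.isPoint], by simp [Record.isSegment], ?_, ?_, ?_⟩
  · simpa using ⟨fn_ne_zero hu, fn_ne_zero hv⟩
  · intro R hR
    rw [List.mem_singleton.1 hR]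
    exact h
  · simp only [List.mem_singleton, forall_eq, Record.bits]
    omega

/-- The output contains the point represented by `w`. -/
def Contains (o : List Record) (w : V3 ℤ) : Prop :=
  ∀ hw : intVec w.fn ≠ 0, ∃ R ∈ o, Projectivization.mk ℝ (intVec w.fn) hw ∈ R.carrier

theorem Contains.of_subset {o o' : List Record} {w : V3 ℤ} (h : Contains o w) (ho : o ⊆ o') :
    Contains o' w := fun hw => by
  obtain ⟨R, hR, h⟩ := h hw
  exact ⟨R, ho hR, h⟩

theorem contains_of_point {o : List Record} {w : V3 ℤ}
    (h : .point w.fn ∈ o ∨ .point (smul (-1) w).fn ∈ o) : Contains o w := by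
  intro hw
  rcases h with h | h
  · exact ⟨_, h, hw, rfl⟩
  · have e : intVec (smul (-1) w).fn = (-1 : ℝ) • intVec w.fn := by
      ext i; fin_cases i <;> simp [intVec, V3.fn, smul]
    refine ⟨_, h, by rw [e]; exact smul_ne_zero (by norm_num) hw, ?_⟩
    rw [Projectivization.mk_eq_mk_iff']
    exact ⟨-1, by rw [e, smul_smul]; norm_num⟩

/-! ### Arcs with a long third basis vector -/

section Thin

variable {P d s : ℤ} {f g a b c : V3 ℤ}

theorem dot_comb_cross (a b c : V3 ℤ) (i j k : ℤ) :
    dot (comb i j k a b c) (cross a b) = k * det a b c := by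
  simp only [comb, dot, det, cross, addMul, smul]; ring

/-- If the third vector of a reduced basis is long, then all short vectors lie in the plane of the
other two. -/
theorem V3.Reduced.dot_cross_eq_zero (h : Reduced P d s f g a b c) (hdet : det a b c * det a b c = 1)
    (h1 : 0 < bil P d s f g a a) (h2 : 0 < gram2 P d s f g a b)
    (h3 : 0 < gram3 P d s f g a b c) {T : ℤ}
    (hT : T * gram2 P d s f g a b < gram3 P d s f g a b c) {w : V3 ℤ}
    (hw : bil P d s f g w w ≤ T) : dot w (cross a b) = 0 := by
  obtain ⟨i, j, k, rfl⟩ := exists_eq_comb hdet w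
  have h4 := (h.coord_le h1 h2 h3 hw).1
  rw [dot_comb_cross]
  suffices k = 0 by rw [this, zero_mul]
  by_contra hk
  have h5 : 1 ≤ k * k := by
    have : 0 < k * k := mul_self_pos.2 hk
    omega
  have := le_mul_of_one_le_left h3.le h5
  omega

/-- If the third vector of a reduced basis is long, then the neighbourhood is thin: otherwise the
unit vectors would be short. -/
theorem V3.Reduced.thin (h : Reduced P d s f g a b c) (hdet : det a b c * det a b c = 1)
    (h1 : 0 < bil P d s f g a a) (h2 : 0 < gram2 P d s f g a b)
    (h3 : 0 < gram3 P d s f g a b c) (hP : 0 < P) (hd : 0 < d) {H : ℤ} (hH : 0 < H)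
    (hT : threshold H P d s f g * gram2 P d s f g a b < gram3 P d s f g a b c) : d * H ≤ P := by
  by_contra! hc
  have unit : ∀ w : V3 ℤ, dot w w = 1 → dot w (cross a b) = 0 := by
    intro w hw
    refine h.dot_cross_eq_zero hdet h1 h2 h3 hT ?_
    rw [threshold, Int.le_ediv_iff_mul_le (by positivity)]
    have h4 := bil_le_disc (P := P) (d := d) (s := s) (f := f) (g := g) w
    rw [hw, mul_one] at h4
    have h5 : 0 ≤ bil P d s f g w w := by
      have := dot_le_bil (s := s) (f := f) (g := g) hP hd w
      omega
    have h6 : P * P ≤ d * H * (d * H) := mul_self_le_mul_self hP.le hc.le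
    calc bil P d s f g w w * (P * P) ≤ bil P d s f g w w * (d * H * (d * H)) :=
          mul_le_mul_of_nonneg_left h6 h5
      _ = H * H * (d * d * bil P d s f g w w) := by ring
      _ ≤ H * H * disc P d s f g := mul_le_mul_of_nonneg_left h4 (by positivity)
  have hx := unit ⟨1, 0, 0⟩ (by simp [dot])
  have hy := unit ⟨0, 1, 0⟩ (by simp [dot])
  have hz := unit ⟨0, 0, 1⟩ (by simp [dot])
  have : det a b c = 0 := by
    have e : det a b c = c.x * dot ⟨1, 0, 0⟩ (cross a b) + c.y * dot ⟨0, 1, 0⟩ (cross a b) +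
        c.z * dot ⟨0, 0, 1⟩ (cross a b) := by
      simp only [det, dot, cross]; ring
    rw [e, hx, hy, hz]; ring
  rw [this] at hdet
  simp at hdet

end Thin

/-! ### Writing the segment -/

/-- The absolute value of `e`: the quotient of `e` by `e² + 1`, rounded down, is `-1` if `e` is
negative, and `0` otherwise. -/
def absE (e : Expr) : Expr := e * (1 + 2 * (e / (e * e + 1)))

theorem eval_absE (e : Expr) (s : ℕ → ℤ) : (absE e).eval s = |e.eval s| := by
  simp only [absE, Expr.eval_mul, Expr.eval_add, Expr.eval_one, Expr.eval_ofNat, Expr.eval_div]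
  generalize e.eval s = z
  rcases le_or_gt 0 z with h | h
  · have : z / (z * z + 1) = 0 := Int.ediv_eq_zero_of_lt h (by nlinarith)
    rw [this, abs_of_nonneg h]; ring
  · have : z / (z * z + 1) = -1 := by
      rw [Int.ediv_eq_iff_of_pos (by nlinarith)]
      constructor <;> nlinarith
    rw [this, abs_of_neg h]; ring

/-- The normal of the plane spanned by the first two basis vectors. -/
def normalE : V3 Expr := cross (vec 15) (vec 18)

/-- The multiple `40 B² |n|₁` of the orthogonal vector in the ends of the segment.  The sum `|n|₁`
of the absolute values of the coordinates replaces the length of the normal `n`, and `40 B² / H` is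
the tangent of the angle of the cone in `cone_of_near`. -/
def widthE : Expr :=
  40 * .var 0 * .var 0 * (absE normalE.x + absE normalE.y + absE normalE.z)

/-- One end of the segment: `H` times a multiple of the projection of the vector at `7` to the
plane, minus `widthE` times the vector `n × f` of the plane, which is orthogonal to the projection.
-/
def leftE : V3 Expr :=
  subMul (smul (.var 1) (proj normalE (vec 7))) widthE (cross normalE (vec 7))
/-- The other end of the segment, where `widthE` times `n × f` is added. -/
def rightE : V3 Expr :=
  addMul (smul (.var 1) (proj normalE (vec 7))) widthE (cross normalE (vec 7))

/-- Write the segment in the plane of the first two basis vectors around the vector at `7`. -/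
def emitCone : Program :=
  ifE (dot (cross normalE (vec 7)) (cross normalE (vec 7)))
    (.seq (block (setVec 29 leftE)) (.seq (block (setVec 32 rightE))
      (.emitSegment ![29, 30, 31] ![32, 33, 34])))
    (block [])

section Cone

variable {m : Budget} {Y : ℕ} {n f : V3 ℤ}

/-- The segment is left out only if the normal `n` is zero or proportional to `f`, and then no
vector of the plane is in the cone around `f`. -/
theorem ev_emitCone (hY : Scale m Y) {s : ℕ → ℤ} (hs : ∀ x < 25, |s x| ≤ lev Y m.S 2)
    (h0 : 0 < s 0) (h1 : 0 < s 1) (hf : val 7 s = f) (hn : cross (val 15 s) (val 18 s) = n) :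
    m.Ev emitCone s emitCone.ops fun t o => (∀ x < 25, t x = s x) ∧
      Output m.X (160 * s 0 ^ 2 / s 1) 0 1 o ∧
      ∀ w : V3 ℤ, dot w n = 0 → n ≠ ⟨0, 0, 0⟩ → dot w f ≠ 0 →
        s 1 * s 1 * dot (cross w f) (cross w f) ≤ (40 * s 0 * s 0) ^ 2 * (dot w f * dot w f) →
        Contains o w := by
  have hV : numVars = 35 := rfl
  have hsz := hY.size_le
  obtain ⟨u, hu⟩ : ∃ u, u = subMul (smul (s 1) (proj n f)) (40 * s 0 * s 0 * l1 n) (cross n f) :=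
    ⟨_, rfl⟩
  obtain ⟨v, hv⟩ : ∃ v, v = addMul (smul (s 1) (proj n f)) (40 * s 0 * s 0 * l1 n) (cross n f) :=
    ⟨_, rfl⟩
  have ew : widthE.eval s = 40 * s 0 * s 0 * l1 n := by
    simp only [widthE, Expr.eval_mul, Expr.eval_add, Expr.eval_ofNat, Expr.eval_var, eval_absE,
      ← hn]
    rfl
  have eu : (⟨leftE.x.eval s, leftE.y.eval s, leftE.z.eval s⟩ : V3 ℤ) = u := by
    subst hn hf
    simp only [hu, leftE, subMul, Expr.eval_sub, Expr.eval_mul, ew]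
    rfl
  have ev : (⟨rightE.x.eval s, rightE.y.eval s, rightE.z.eval s⟩ : V3 ℤ) = v := by
    subst hn hf
    simp only [hv, rightE, addMul, Expr.eval_add, Expr.eval_mul, ew]
    rfl
  have eg : (dot (cross normalE (vec 7)) (cross normalE (vec 7))).eval s =
      dot (cross n f) (cross n f) := by
    subst hn hf
    rfl
  have hC : 0 < 40 * s 0 * s 0 := by positivity
  have hul : ∀ e : Expr, e.Below 25 → e.size ≤ 10000 → |e.eval s| ≤ m.X := fun e h1 h2 =>
    hY.abs_le (by omega) (hY.eval_le hs h1 h2)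
  refine Budget.Ev.ifE_ops (by decide +kernel) (le_trans (by decide +kernel : _ ≤ 10000) hsz)
    (fun hpos => ?_) (fun hneg => ?_)
  · rw [eg] at hpos
    have hg : cross n f ≠ ⟨0, 0, 0⟩ := by
      intro hc
      rw [hc] at hpos
      simp [dot] at hpos
    have hne := ends_ne_zero hg h1 (40 * s 0 * s 0 * l1 n)
    rw [← hu, ← hv] at hne
    have hXu : |u.x| ≤ m.X ∧ |u.y| ≤ m.X ∧ |u.z| ≤ m.X := by
      rw [← eu]
      exact ⟨hul _ (by decide +kernel) (by decide +kernel),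
        hul _ (by decide +kernel) (by decide +kernel), hul _ (by decide +kernel) (by decide +kernel)⟩
    have hXv : |v.x| ≤ m.X ∧ |v.y| ≤ m.X ∧ |v.z| ≤ m.X := by
      rw [← ev]
      exact ⟨hul _ (by decide +kernel) (by decide +kernel),
        hul _ (by decide +kernel) (by decide +kernel), hul _ (by decide +kernel) (by decide +kernel)⟩
    refine Budget.Ev.seq (Q := fun t o => o = [] ∧ val 29 t = u ∧ ∀ x < 29, t x = s x) ?_ ?_
    · refine ev_setVec_fresh (by decide) (by decide +kernel)
        ⟨le_trans (by decide +kernel : _ ≤ 10000) hsz, le_trans (by decide +kernel : _ ≤ 10000) hsz,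
          le_trans (by decide +kernel : _ ≤ 10000) hsz⟩ ?_ ?_
      · rw [← eu] at hXu; exact hXu
      · intro t h2 h3
        exact ⟨rfl, h2.trans eu, fun x hx => h3 x (by omega)⟩
    rintro t _ ⟨rfl, ht, hts⟩
    have ev' : (⟨rightE.x.eval t, rightE.y.eval t, rightE.z.eval t⟩ : V3 ℤ) = v := by
      rw [← ev]
      congr 1
      · exact Expr.eval_congr (m := 25) (fun r hr => hts r (by omega)) _ (by decide +kernel)
      · exact Expr.eval_congr (m := 25) (fun r hr => hts r (by omega)) _ (by decide +kernel)
      · exact Expr.eval_congr (m := 25) (fun r hr => hts r (by omega)) _ (by decide +kernel)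
    refine Budget.Ev.seq (Q := fun t o => o = [] ∧ val 29 t = u ∧ val 32 t = v ∧
      ∀ x < 29, t x = s x) ?_ ?_
    · refine ev_setVec_fresh (by decide) (by decide +kernel)
        ⟨le_trans (by decide +kernel : _ ≤ 10000) hsz, le_trans (by decide +kernel : _ ≤ 10000) hsz,
          le_trans (by decide +kernel : _ ≤ 10000) hsz⟩ ?_ ?_
      · rw [← ev'] at hXv; exact hXv
      · intro t' h2 h3
        refine ⟨rfl, ?_, h2.trans ev', fun x hx => by rw [h3 x (by omega), hts x hx]⟩
        rw [← ht]
        exact val_congr fun x h4 h5 => h3 x (by omega)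
    rintro t' _ ⟨rfl, hu', hv', hts'⟩
    refine Budget.Ev.emitSegment (by intro i; fin_cases i <;> decide)
      (by intro i; fin_cases i <;> decide) ?_
    have e1 : (fun i => t' ((![29, 30, 31] : Fin 3 → ℕ) i)) = u.fn := by
      rw [← hu']; funext i; fin_cases i <;> rfl
    have e2 : (fun i => t' ((![32, 33, 34] : Fin 3 → ℕ) i)) = v.fn := by
      rw [← hv']; funext i; fin_cases i <;> rfl
    rw [e1, e2]
    refine ⟨fun x hx => hts' x (by omega), Output.segment hne.1 hne.2 ⟨hXu, hXv⟩ ?_, ?_⟩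
    · rw [hu, hv]
      refine (angle_ends_le hg h1 hC (l1_nonneg n) (l1_le_dot_self n)).trans (le_of_eq ?_)
      push_cast
      ring
    · intro w hwn hn0 hwf hcone hw
      refine ⟨.segment u.fn v.fn, by simp, ?_⟩
      rw [hu, hv]
      exact projSegment_contains hw hwn hn0 hwf h1 hC (l1_nonneg n) (dot_self_le_l1 n) hcone
  · refine Budget.Ev.block trivial ⟨fun _ _ => rfl, Output.nil.mono le_rfl zero_le_one, ?_⟩
    rw [eg] at hneg
    intro w hwn hn0 hwf _
    have := dot_self_pos (cross_ne_zero_of_dot hwn hn0 hwf)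
    omega

end Cone

end NearCurve

namespace NearCurve
open V3

/-! ### The treatment of one arc -/

/-- Ask for the three quantities `q` at the parameter in register `6`. -/
def queryVec (k : ℕ) (q : Fin 3 → Quantity) : Program :=
  .seq (.query k (q 0) 2 6) (.seq (.query (k + 1) (q 1) 2 6) (.query (k + 2) (q 2) 2 6))

/-- The expression for the threshold of the current arc. -/
def thresholdE : Expr := .var 1 * .var 1 * discE / (.var 3 * .var 3)
/-- The Gram determinant of any basis of `ℤ³`, as an expression. -/
def gram3E : Expr := .var 3 * .var 3 * (discE * discE)

/-- Put the standard basis in registers `15` to `23`, and raise the flag. -/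
def initBasis : List (ℕ × Expr) :=
  [(15, 1), (16, 0), (17, 0), (18, 0), (19, 1), (20, 0), (21, 0), (22, 0), (23, 1), (24, 1)]

/-- Write points and segments for the arc that starts at the parameter in register `6`. -/
def treatArc : Program :=
  .seq (queryVec 7 .curve) (.seq (queryVec 10 .deriv) (.seq (assign 13 thresholdE)
    (.seq (assign 14 gram3E) (.seq (block initBasis) (.seq reduceLoop
      (ifE (.var 14 - .var 13 * gram2E (vec 15) (vec 18)) emitCone enumerate))))))

/-- The cost of an arc, for registers of `L` digits, and without the enumeration. -/
def costArc (L : ℕ) : ℕ :=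
  3 + (3 + ((assign 13 thresholdE).ops + ((assign 14 gram3E).ops + ((block initBasis).ops +
    ((3 * L + 1) * (reduceRound.ops + 3) +
      (((Expr.var 14 - .var 13 * gram2E (vec 15) (vec 18)).compile numVars).ops + 1 +
        emitCone.ops))))))

section TreatArc

variable {m : Budget} {Y : ℕ}

theorem ev_queryVec {s : ℕ → ℤ} {k : ℕ} {q : Fin 3 → Quantity} (hk : 6 < k) (hk' : k + 2 < numVars)
    (hp : (s 2).toNat ≤ m.digits) {w : V3 ℤ}
    (hw : w = ⟨m.A (q 0) (s 2).toNat (s 6), m.A (q 1) (s 2).toNat (s 6),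
      m.A (q 2) (s 2).toNat (s 6)⟩) (hX : |w.x| ≤ m.X ∧ |w.y| ≤ m.X ∧ |w.z| ≤ m.X) :
    m.Ev (queryVec k q) s 3 fun t o => o = [] ∧ val k t = w ∧
      ∀ x, x < k ∨ k + 2 < x → t x = s x := by
  have hV : numVars = 35 := rfl
  obtain ⟨w₁, w₂, w₃⟩ := w
  obtain ⟨e1, e2, e3⟩ := V3.mk.inj hw
  have upd : ∀ (t : ℕ → ℤ) (i : ℕ) (z : ℤ) (x : ℕ), x ≠ i → Function.update t i z x = t x :=
    fun t i z x h => Function.update_of_ne h _ _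
  refine Budget.Ev.seq (n := 1) (n' := 1 + 1) (Q := fun t o => o = [] ∧ t k = w₁ ∧
    ∀ x, x ≠ k → t x = s x) ?_ ?_
  · refine Budget.Ev.query (by omega) (by omega) (by omega) hp (by rw [← e1]; exact hX.1)
      ⟨rfl, ?_, fun x hx => upd _ _ _ _ hx⟩
    rw [Function.update_self, e1]
  rintro t _ ⟨rfl, ht1, ht⟩
  refine Budget.Ev.seq (n := 1) (n' := 1) (Q := fun t o => o = [] ∧ t k = w₁ ∧ t (k + 1) = w₂ ∧
    ∀ x, x ≠ k → x ≠ k + 1 → t x = s x) ?_ ?_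
  · have h2 : t 2 = s 2 := ht 2 (by omega)
    have h6 : t 6 = s 6 := ht 6 (by omega)
    refine Budget.Ev.query (by omega) (by omega) (by omega) (by rw [h2]; exact hp)
      (by rw [h2, h6, ← e2]; exact hX.2.1) ⟨rfl, ?_, ?_, fun x hx hx' => ?_⟩
    · rw [upd _ _ _ _ (by omega), ht1]
    · rw [Function.update_self, h2, h6, e2]
    · rw [upd _ _ _ _ hx', ht x hx]
  rintro t _ ⟨rfl, ht1, ht2, ht⟩
  have h2 : t 2 = s 2 := ht 2 (by omega) (by omega)
  have h6 : t 6 = s 6 := ht 6 (by omega) (by omega)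
  refine Budget.Ev.query (by omega) (by omega) (by omega) (by rw [h2]; exact hp)
    (by rw [h2, h6, ← e3]; exact hX.2.2) ⟨rfl, ?_, fun x hx => ?_⟩
  · simp only [val, V3.mk.injEq]
    refine ⟨?_, ?_, ?_⟩
    · rw [upd _ _ _ _ (by omega), ht1]
    · rw [upd _ _ _ _ (by omega), ht2]
    · rw [Function.update_self, h2, h6, e3]
  · rw [upd _ _ _ _ (by omega), ht x (by omega) (by omega)]

theorem Budget.lt_two_pow_digits (m : Budget) {z : ℤ} (h : |z| ≤ m.X) : z < 2 ^ m.digits := by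
  have h1 : m.X ≤ m.X ^ m.S :=
    Nat.le_self_pow (by have := m.one_le; omega) _
  have h2 : m.X ^ m.S < 2 ^ m.digits := Nat.lt_size_self _
  have h3 : (m.X : ℤ) < 2 ^ m.digits := by exact_mod_cast h1.trans_lt h2
  exact ((le_abs_self z).trans h).trans_lt h3

/-- Three rounds multiply the potential by at most `27 / 64 < 1 / 2`, so that three rounds for each
binary digit are enough. -/
theorem potential_lt {z : ℤ} {L : ℕ} (hL : 1 ≤ L) (h : z < 2 ^ L) :
    z * 3 ^ (3 * L) < 4 ^ (3 * L) := by
  have e1 : (3 : ℤ) ^ (3 * L) = 27 ^ L := by rw [pow_mul]; norm_num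
  have e2 : (4 : ℤ) ^ (3 * L) = 64 ^ L := by rw [pow_mul]; norm_num
  rw [e1, e2]
  calc z * 27 ^ L < 2 ^ L * 27 ^ L := by gcongr
    _ = 54 ^ L := by rw [← mul_pow]; norm_num
    _ < 64 ^ L := pow_lt_pow_left₀ (by norm_num) (by norm_num) (by omega)

/-- The registers `15` to `23` hold the standard basis afterwards, and the flag is raised. -/
theorem ev_initBasis (hY : Scale m Y) {s : ℕ → ℤ} (hs : ∀ x < 15, |s x| ≤ lev Y m.S 2) :
    m.Ev (block initBasis) s (block initBasis).ops fun t o => o = [] ∧ (∀ x < 15, t x = s x) ∧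
      val 15 t = ⟨1, 0, 0⟩ ∧ val 18 t = ⟨0, 1, 0⟩ ∧ val 21 t = ⟨0, 0, 1⟩ ∧ t 24 = 1 ∧
      ∀ x < 25, |t x| ≤ lev Y m.S 2 := by
  have hX : (1 : ℤ) ≤ m.X := by have := m.two_le; omega
  have hS := m.one_le
  have h1 : ∀ e : Expr, e = 1 ∨ e = 0 → e.size ≤ m.S := by
    rintro e (rfl | rfl) <;> exact hS
  have hL : (1 : ℤ) ≤ lev Y m.S 2 := by
    have := two_le_lev (S := m.S) 2 hY.two_le hS
    omega
  refine Budget.Ev.block ?_ ?_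
  · simp only [initBasis, OkBlock, Expr.eval_one, Expr.eval_zero, abs_one, abs_zero]
    have h0 : (0 : ℤ) ≤ m.X := by omega
    have : numVars = 35 := rfl
    simp only [hX, h0, h1 1 (Or.inl rfl), h1 0 (Or.inr rfl), this, true_and, and_true]
    decide
  · obtain ⟨t, ht, hsame, hval⟩ : ∃ t, runBlock initBasis s = t ∧ (∀ x < 15, t x = s x) ∧
        (t 15 = 1 ∧ t 16 = 0 ∧ t 17 = 0 ∧ t 18 = 0 ∧ t 19 = 1 ∧ t 20 = 0 ∧ t 21 = 0 ∧ t 22 = 0 ∧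
          t 23 = 1 ∧ t 24 = 1) := by
      refine ⟨_, rfl, fun x hx => ?_, ?_⟩
      · simp only [initBasis, runBlock]
        repeat rw [Function.update_of_ne (by omega)]
      · simp [initBasis, runBlock]
    rw [ht]
    obtain ⟨a1, a2, a3, a4, a5, a6, a7, a8, a9, a10⟩ := hval
    refine ⟨rfl, hsame, by simp [val, *], by simp [val, *], by simp [val, *], a10, ?_⟩
    intro x hx
    by_cases h15 : x < 15
    · rw [hsame x h15]; exact hs x h15
    · have : t x = 0 ∨ t x = 1 := by
        interval_cases x <;> simp_all
      rcases this with h | h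
      · rw [h, abs_zero]; omega
      · rw [h, abs_one]; exact hL

theorem exists_max_sq_mul_le {a b : ℤ} (ha : 0 ≤ a) (hb : 0 < b) :
    ∃ n : ℕ, (n : ℤ) ^ 2 * b ≤ a ∧ ∀ k : ℕ, (k : ℤ) ^ 2 * b ≤ a → k ≤ n := by
  refine ⟨Nat.sqrt (a / b).toNat, ?_, fun k hk => ?_⟩
  · rw [← Int.le_ediv_iff_mul_le hb, ← Int.toNat_of_nonneg (Int.ediv_nonneg ha hb.le)]
    exact_mod_cast Nat.sqrt_le' _
  · rw [← Int.le_ediv_iff_mul_le hb, ← Int.toNat_of_nonneg (Int.ediv_nonneg ha hb.le)] at hk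
    rw [Nat.le_sqrt']
    exact_mod_cast hk

variable {P d st H B : ℤ} {f g : V3 ℤ}

/-- All vectors below the threshold that lie in the cone around `f`, in case the neighbourhood is
thin, are covered by one segment or by at most `4 n` points.  The number `n` depends only on the
data of the arc, not on the course of the lattice reduction. -/
theorem ev_treatArc (hY : Scale m Y) {s : ℕ → ℤ} (hs : ∀ x < 7, |s x| ≤ Y) (h0 : 0 < s 0)
    (h1 : 0 < s 1) (h3 : s 3 = P) (hP : 0 < P) (h4 : s 4 = d) (hd : 0 < d) (h5 : s 5 = st)
    (hp : (s 2).toNat ≤ m.digits)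
    (hf : f = ⟨m.A (.curve 0) (s 2).toNat (s 6), m.A (.curve 1) (s 2).toNat (s 6),
      m.A (.curve 2) (s 2).toNat (s 6)⟩)
    (hg : g = ⟨m.A (.deriv 0) (s 2).toNat (s 6), m.A (.deriv 1) (s 2).toNat (s 6),
      m.A (.deriv 2) (s 2).toNat (s 6)⟩)
    (hfY : |f.x| ≤ Y ∧ |f.y| ≤ Y ∧ |f.z| ≤ Y) (hgY : |g.x| ≤ Y ∧ |g.y| ≤ Y ∧ |g.z| ≤ Y) :
    ∃ n : ℕ, (n : ℤ) ^ 2 * (P * P * (disc P d st f g * disc P d st f g)) ≤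
        4096 * threshold (s 1) P d st f g ^ 3 ∧
      m.Ev treatArc s (costArc m.digits + n * costEnum) fun t o => (∀ x < 7, t x = s x) ∧
        Output m.X (160 * s 0 ^ 2 / s 1) (4 * n) 1 o ∧
        ∀ w : V3 ℤ, w ≠ ⟨0, 0, 0⟩ → bil P d st f g w w ≤ threshold (s 1) P d st f g →
          (d * s 1 ≤ P → dot w f ≠ 0 ∧
            s 1 * s 1 * dot (cross w f) (cross w f) ≤ (40 * s 0 * s 0) ^ 2 * (dot w f * dot w f)) →
          Contains o w := by
  have hsz := hY.size_le
  have hV : numVars = 35 := rfl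
  have hS2 : ∀ e : Expr, e.size ≤ 10000 → e.size ≤ m.S := fun e he => he.trans hsz
  have hΔ := disc_pos (s := st) (f := f) (g := g) hP hd
  obtain ⟨T, hT⟩ : ∃ T, T = threshold (s 1) P d st f g := ⟨_, rfl⟩
  obtain ⟨D₃, hD₃⟩ : ∃ D, D = P * P * (disc P d st f g * disc P d st f g) := ⟨_, rfl⟩
  have hT0 : 0 ≤ T := by
    rw [hT, threshold]
    exact Int.ediv_nonneg (by positivity) (by positivity)
  have hD0 : 0 < D₃ := by rw [hD₃]; positivity
  -- The time bound must be fixed before the reduced basis is known, so `n` is the largest number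
  -- that the volume bound for the enumeration admits.
  obtain ⟨n, hn, hn'⟩ := exists_max_sq_mul_le (a := 4096 * T ^ 3) (by positivity) hD0
  rw [← hT, ← hD₃]
  refine ⟨n, hn, ?_⟩
  have hY0 : lev Y m.S 0 = Y := by simp [lev]
  have hYX : ∀ {z : ℤ}, |z| ≤ Y → |z| ≤ m.X := fun {z} h =>
    hY.abs_le (i := 0) (by omega) (by rw [hY0]; exact h)
  have hbits : 1 ≤ m.digits := by
    have := m.lt_two_pow_digits (z := 1) (by have := m.two_le; simp; omega)
    by_contra hc
    have : m.digits = 0 := by omega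
    simp [this] at *
  rw [costArc, add_assoc, add_assoc, add_assoc, add_assoc, add_assoc, add_assoc, add_assoc]
  refine Budget.Ev.seq (ev_queryVec (by omega) (by omega) hp hf
    ⟨hYX hfY.1, hYX hfY.2.1, hYX hfY.2.2⟩) ?_
  rintro s₁ _ ⟨rfl, hs₁f, hs₁⟩
  refine Budget.Ev.seq (Q := fun t o => o = [] ∧ val 7 t = f ∧ val 10 t = g ∧
    ∀ x < 7, t x = s x) (Budget.Ev.mono (ev_queryVec (w := g) (by omega) (by omega)
      (by rw [hs₁ 2 (by omega)]; exact hp) (by rw [hs₁ 2 (by omega), hs₁ 6 (by omega)]; exact hg)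
      ⟨hYX hgY.1, hYX hgY.2.1, hYX hgY.2.2⟩) le_rfl ?_) ?_
  · rintro t _ ⟨rfl, htg, ht⟩
    refine ⟨rfl, ?_, htg, fun x hx => by rw [ht x (by omega), hs₁ x (by omega)]⟩
    rw [← hs₁f]
    exact val_congr fun x _ _ => ht x (by omega)
  rintro s₂ _ ⟨rfl, hs₂f, hs₂g, hs₂⟩
  have hs₂Y : ∀ x < 13, |s₂ x| ≤ lev Y m.S 0 := by
    rw [hY0]
    intro x hx
    by_cases h7 : x < 7
    · rw [hs₂ x h7]; exact hs x h7
    · by_cases h10 : x < 10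
      · exact abs_le_of_val hs₂f hfY x (by omega) (by omega)
      · exact abs_le_of_val hs₂g hgY x (by omega) (by omega)
  have arc₂ : AtArc P d st f g s₂ :=
    ⟨by rw [hs₂ 3 (by omega), h3], by rw [hs₂ 4 (by omega), h4], by rw [hs₂ 5 (by omega), h5],
      hs₂f, hs₂g⟩
  have h21 : s₂ 1 = s 1 := hs₂ 1 (by omega)
  have eT : thresholdE.eval s₂ = T := by
    rw [hT, ← h21]
    obtain ⟨rfl, rfl, rfl, rfl, rfl⟩ := arc₂
    rfl
  have hTX : |T| ≤ lev Y m.S 1 := by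
    rw [← eT]; exact hY.eval_le hs₂Y (by decide +kernel) (by decide +kernel)
  have e3 : ∀ t : ℕ → ℤ, AtArc P d st f g t → gram3E.eval t = D₃ := by
    rintro t ⟨rfl, rfl, rfl, rfl, rfl⟩
    rw [hD₃]
    rfl
  have h3X : |D₃| ≤ lev Y m.S 1 := by
    rw [← e3 _ arc₂]; exact hY.eval_le hs₂Y (by decide +kernel) (by decide +kernel)
  obtain ⟨D₁, hD₁⟩ : ∃ D, D = bil P d st f g ⟨1, 0, 0⟩ ⟨1, 0, 0⟩ := ⟨_, rfl⟩
  obtain ⟨D₂, hD₂⟩ : ∃ D, D = gram2 P d st f g ⟨1, 0, 0⟩ ⟨0, 1, 0⟩ := ⟨_, rfl⟩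
  have hDsum : |D₁ + D₂ + D₃| ≤ lev Y m.S 1 := by
    -- As values of expressions these sums and products are one level up in the tower.
    have : (qE ⟨1, 0, 0⟩ ⟨1, 0, 0⟩ + gram2E ⟨1, 0, 0⟩ ⟨0, 1, 0⟩ + gram3E).eval s₂ =
        D₁ + D₂ + D₃ := by
      rw [hD₁, hD₂, hD₃]
      obtain ⟨rfl, rfl, rfl, rfl, rfl⟩ := arc₂
      rfl
    rw [← this]; exact hY.eval_le hs₂Y (by decide +kernel) (by decide +kernel)
  have hDprod : |D₁ * D₂| ≤ lev Y m.S 1 := by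
    have : (qE ⟨1, 0, 0⟩ ⟨1, 0, 0⟩ * gram2E ⟨1, 0, 0⟩ ⟨0, 1, 0⟩).eval s₂ = D₁ * D₂ := by
      rw [hD₁, hD₂]
      obtain ⟨rfl, rfl, rfl, rfl, rfl⟩ := arc₂
      rfl
    rw [← this]; exact hY.eval_le hs₂Y (by decide +kernel) (by decide +kernel)
  refine Budget.Ev.seq (Q := fun t o => o = [] ∧ (∀ x, x ≠ 13 → t x = s₂ x) ∧ t 13 = T)
    (Budget.Ev.assign' hY (by decide) (by decide +kernel) (by decide +kernel) eT
      (hY.abs_le (by omega) hTX) fun t h1 h2 => ⟨rfl, h1, h2⟩) ?_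
  rintro s₃ _ ⟨rfl, hs₃, hs₃T⟩
  have arc₃ : AtArc P d st f g s₃ :=
    ⟨by rw [hs₃ 3 (by omega), arc₂.P], by rw [hs₃ 4 (by omega), arc₂.d],
      by rw [hs₃ 5 (by omega), arc₂.st],
      by rw [← arc₂.f]; exact val_congr fun x _ _ => hs₃ x (by omega),
      by rw [← arc₂.g]; exact val_congr fun x _ _ => hs₃ x (by omega)⟩
  refine Budget.Ev.seq (Q := fun t o => o = [] ∧ (∀ x, x ≠ 14 → t x = s₃ x) ∧ t 14 = D₃)
    (Budget.Ev.assign' hY (by decide) (by decide +kernel) (by decide +kernel) (e3 _ arc₃)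
      (hY.abs_le (by omega) h3X) fun t h1 h2 => ⟨rfl, h1, h2⟩) ?_
  rintro s₄ _ ⟨rfl, hs₄, hs₄D⟩
  have hs₄s : ∀ x < 13, s₄ x = s₂ x := fun x hx => by rw [hs₄ x (by omega), hs₃ x (by omega)]
  have hs₄T : s₄ 13 = T := by rw [hs₄ 13 (by omega), hs₃T]
  have hs₄b : ∀ x < 15, |s₄ x| ≤ lev Y m.S 2 := by
    intro x hx
    by_cases h13 : x < 13
    · rw [hs₄s x h13]; exact hY.mono (by omega) (hs₂Y x h13)
    · have : x = 13 ∨ x = 14 := by omega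
      rcases this with rfl | rfl
      · rw [hs₄T]; exact hY.mono (by omega) hTX
      · rw [hs₄D]; exact hY.mono (by omega) h3X
  refine Budget.Ev.seq (ev_initBasis hY hs₄b) ?_
  rintro s₅ _ ⟨rfl, hs₅, v15, v18, v21, hs₅24, hs₅b⟩
  have arc₅ : AtArc P d st f g s₅ := by
    obtain ⟨k1, k2, k3, k4, k5⟩ := arc₂
    have e : ∀ x < 13, s₅ x = s₂ x := fun x hx => by rw [hs₅ x (by omega), hs₄s x hx]
    refine ⟨by rw [e 3 (by omega), k1], by rw [e 4 (by omega), k2], by rw [e 5 (by omega), k3], ?_, ?_⟩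
    · rw [← k4]; exact val_congr fun x _ _ => e x (by omega)
    · rw [← k5]; exact val_congr fun x _ _ => e x (by omega)
  have L₅ : LatticeState m Y P d st f g D₁ D₂ s₅ := by
    refine ⟨arc₅, by rw [hs₅ 14 (by omega), hs₄D, hD₃], ?_, ?_, ?_, hs₅b⟩
    · rw [v15, v18, v21]; simp [V3.det, dot, cross]
    · rw [v15, hD₁]
    · rw [v15, v18, hD₂]
  refine Budget.Ev.seq (ev_reduceLoop hY hP hd (k := 3 * m.digits) ?_ L₅ (by rw [hs₅24]; norm_num) ?_) ?_
  · rw [← hD₃]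
    exact (le_abs_self _).trans (hY.mono (by omega) hDsum)
  · refine potential_lt hbits (m.lt_two_pow_digits ?_)
    simp only [potential]
    rw [v15, v18, ← hD₁, ← hD₂]
    exact hY.abs_le (by omega) hDprod
  rintro s₆ _ ⟨rfl, L₆, hs₆, hred⟩
  obtain ⟨p1, p2, e3', p3⟩ := L₆.pos hP hd
  have h613 : s₆ 13 = T := by rw [hs₆ 13 (by omega), hs₅ 13 (by omega), hs₄T]
  have h614 : s₆ 14 = D₃ := by rw [L₆.D₃, hD₃]
  have hs₆s : ∀ x < 7, s₆ x = s x := fun x hx => by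
    rw [hs₆ x (by omega), hs₅ x (by omega), hs₄s x (by omega), hs₂ x hx]
  refine Budget.Ev.mono (Budget.Ev.ifE (n := emitCone.ops) (n' := n * costEnum) (by decide +kernel)
    (le_trans (by decide +kernel : _ ≤ 10000) hsz) (fun hpos => ?_) (fun hneg => ?_)) (by omega)
    fun _ _ h => h
  · simp only [Expr.eval_sub, Expr.eval_mul, Expr.eval_var, L₆.arc.eval_gram2E, h613, h614] at hpos
    have h6lt : threshold (s 1) P d st f g * gram2 P d st f g (val 15 s₆) (val 18 s₆) <
        gram3 P d st f g (val 15 s₆) (val 18 s₆) (val 21 s₆) := by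
      rw [e3', h614, ← hT]; omega
    have h60 : s₆ 0 = s 0 := hs₆s 0 (by omega)
    have h61 : s₆ 1 = s 1 := hs₆s 1 (by omega)
    have h6p : 0 < gram3 P d st f g (val 15 s₆) (val 18 s₆) (val 21 s₆) := by rw [e3']; exact p3
    refine Budget.Ev.mono (ev_emitCone (n := cross (val 15 s₆) (val 18 s₆)) hY L₆.bound
      (by rw [h60]; exact h0) (by rw [h61]; exact h1) L₆.arc.f rfl) le_rfl ?_
    rintro t o ⟨ht, hout, hcon⟩
    rw [h60, h61] at hout hcon
    refine ⟨fun x hx => by rw [ht x (by omega), hs₆s x hx], hout.mono (by omega) le_rfl, ?_⟩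
    intro w hw hwT hthin
    obtain ⟨k1, k2⟩ := hthin (hred.thin L₆.det p1 p2 h6p hP hd h1 h6lt)
    refine hcon w (hred.dot_cross_eq_zero L₆.det p1 p2 h6p h6lt (by rw [← hT]; exact hwT)) ?_ k1 k2
    intro hc
    have := L₆.det
    rw [V3.det_cyclic, V3.det_cyclic, V3.det, hc] at this
    simp [dot] at this
  · simp only [Expr.eval_sub, Expr.eval_mul, Expr.eval_var, L₆.arc.eval_gram2E] at hneg
    obtain ⟨n', _, hn'', hev⟩ := ev_enumerate hY hP hd L₆ hred (by linarith)
    rw [h613, h614] at hn''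
    have hle := hn' n' hn''
    refine Budget.Ev.mono hev (Nat.mul_le_mul_right _ hle) ?_
    rintro t o ⟨ht, hpl, hcov⟩
    have hℓ : (0 : ℝ) ≤ 160 * (s 0 : ℝ) ^ 2 / s 1 := by
      have : (0 : ℝ) < s 1 := by exact_mod_cast h1
      positivity
    refine ⟨fun x hx => by rw [ht x (by omega), hs₆s x hx],
      (hpl.output hℓ).mono (by omega) (by omega), ?_⟩
    intro w hw hwT _
    exact contains_of_point (hcov w hw (by rw [h613]; exact hwT))

end TreatArc

end NearCurve

namespace NearCurve
open V3

/-! ### The number of points on an arc -/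

/-- For data of the size of those of an arc, `disc` is `O(P⁴ (s d)²)`, since `f`, `g`, `d` and `s`
are `O(P)` and `d ≤ s`. -/
theorem disc_le {P d s b : ℤ} {f g : V3 ℤ} (hb : 1 ≤ b) (hd : 0 ≤ d) (hds : d ≤ s) (hd' : d ≤ 4 * P)
    (hs : s ≤ 5 * P) (hf : dot f f ≤ 4 * b ^ 2 * P ^ 2) (hg : dot g g ≤ 4 * b ^ 2 * P ^ 2) :
    disc P d s f g ≤ 256 * b ^ 4 * P ^ 4 * (s * d) ^ 2 := by
  have hP : 0 ≤ P := by omega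
  have hs0 : 0 ≤ s := hd.trans hds
  have hff := dot_self_nonneg f
  have hgg := dot_self_nonneg g
  have hb2 : 1 ≤ b ^ 2 := one_le_pow₀ hb
  have hb4 : b ^ 2 ≤ b ^ 4 := pow_le_pow_right₀ hb (by norm_num)
  have h1 : dot (cross f g) (cross f g) ≤ 16 * b ^ 4 * P ^ 4 := by
    have e : dot (cross f g) (cross f g) = dot f f * dot g g - dot f g * dot f g := by
      simp only [dot, cross]; ring
    have := mul_self_nonneg (dot f g)
    have := mul_le_mul hf hg hgg (by positivity)
    calc dot (cross f g) (cross f g) ≤ dot f f * dot g g := by omega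
      _ ≤ 4 * b ^ 2 * P ^ 2 * (4 * b ^ 2 * P ^ 2) := this
      _ = _ := by ring
  have h2 : P * P * dot f f + s * s * dot g g ≤ 104 * b ^ 4 * P ^ 4 := by
    calc P * P * dot f f + s * s * dot g g
        ≤ P * P * (4 * b ^ 2 * P ^ 2) + 5 * P * (5 * P) * (4 * b ^ 2 * P ^ 2) := by gcongr
      _ = 104 * b ^ 2 * P ^ 4 := by ring
      _ ≤ _ := by gcongr
  have h3 : d * d * (d * d) ≤ (s * d) ^ 2 := by
    calc d * d * (d * d) ≤ s * s * (d * d) := by gcongr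
      _ = _ := by ring
  have h4 : P * P * (d * d * (d * d) * (d * d)) ≤ 16 * b ^ 4 * P ^ 4 * (s * d) ^ 2 := by
    calc P * P * (d * d * (d * d) * (d * d)) ≤ P * P * ((s * d) ^ 2 * (4 * P * (4 * P))) := by gcongr
      _ = 16 * 1 * P ^ 4 * (s * d) ^ 2 := by ring
      _ ≤ 16 * b ^ 4 * P ^ 4 * (s * d) ^ 2 := by
          gcongr
          exact one_le_pow₀ hb
  have h5 : s * s * (d * d) * dot (cross f g) (cross f g) ≤ 16 * b ^ 4 * P ^ 4 * (s * d) ^ 2 := by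
    calc s * s * (d * d) * dot (cross f g) (cross f g) ≤ s * s * (d * d) * (16 * b ^ 4 * P ^ 4) := by
          gcongr
      _ = _ := by ring
  have h6 : d * d * (d * d) * (P * P * dot f f + s * s * dot g g) ≤
      (s * d) ^ 2 * (104 * b ^ 4 * P ^ 4) := by
    have : 0 ≤ P * P * dot f f + s * s * dot g g := by positivity
    gcongr
  have h7 : 0 ≤ b ^ 4 * P ^ 4 * (s * d) ^ 2 := by positivity
  simp only [disc]
  linarith

/-- The volume bound for the number of lattice points: the bound `n² D₃ ≤ 4096 T³` in terms of the
lattice becomes `n = O(H³ (s / P) (d / P))`. -/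
theorem count_le {P d s b H n : ℤ} {f g : V3 ℤ} (hb : 1 ≤ b) (hP : 0 < P) (hd : 0 < d) (hds : d ≤ s)
    (hd' : d ≤ 4 * P) (hs : s ≤ 5 * P) (hf : dot f f ≤ 4 * b ^ 2 * P ^ 2)
    (hg : dot g g ≤ 4 * b ^ 2 * P ^ 2) (hH : 0 ≤ H)
    (h : n ^ 2 * (P * P * (disc P d s f g * disc P d s f g)) ≤
      4096 * threshold H P d s f g ^ 3) :
    n * P ^ 2 ≤ 1024 * H ^ 3 * b ^ 2 * (s * d) := by
  have hΔ := disc_pos (s := s) (f := f) (g := g) hP hd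
  have hΔ' := disc_le hb hd.le hds hd' hs hf hg
  have hT : threshold H P d s f g * (P * P) ≤ H * H * disc P d s f g :=
    Int.ediv_mul_le _ (by positivity)
  have hT0 : 0 ≤ threshold H P d s f g := Int.ediv_nonneg (by positivity) (by positivity)
  generalize threshold H P d s f g = T at *
  generalize disc P d s f g = D at *
  have h1 : (n * P ^ 2) ^ 2 ≤ (1024 * H ^ 3 * b ^ 2 * (s * d)) ^ 2 := by
    refine le_of_mul_le_mul_right (a := P ^ 4 * D ^ 2) ?_ (by positivity)
    calc (n * P ^ 2) ^ 2 * (P ^ 4 * D ^ 2) = n ^ 2 * (P * P * (D * D)) * P ^ 6 := by ring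
      _ ≤ 4096 * T ^ 3 * P ^ 6 := by gcongr
      _ = 4096 * (T * (P * P)) ^ 3 := by ring
      _ ≤ 4096 * (H * H * D) ^ 3 := by gcongr
      _ = 4096 * H ^ 6 * D ^ 2 * D := by ring
      _ ≤ 4096 * H ^ 6 * D ^ 2 * (256 * b ^ 4 * P ^ 4 * (s * d) ^ 2) := by gcongr
      _ = _ := by ring
  have hs0 : 0 < s := hd.trans_le hds
  exact (abs_le_of_sq_le_sq' h1 (by positivity)).2

/-! ### The search program -/

/-- Increase the precision `p` in register `2` by one, with `2 ^ p` in register `3`. -/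
def doubling : Program := block [(3, .var 3 + .var 3), (2, .var 2 + 1)]

/-- Choose the height `H = 113 B² (a + 1)`, where `a` is within `1` of `N`, the precision, the
width and the step `s = d + P / H`.  The first question reads the registers `2` and `6` while they
are `0`, and so asks for precision `0`. -/
def setup : Program :=
  .seq (.query 1 .heightBound 2 6) (.seq (block [(1, 113 * .var 0 * .var 0 * (.var 1 + 1)), (3, 1)])
    (.seq (whileE (.var 1 * .var 1 - .var 3) doubling)
      (.seq (.query 4 .distBound 2 6)
        (block [(4, .var 4 + 1), (5, .var 4 + .var 3 / .var 1)]))))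

/-- Treat an arc, and proceed to the start of the next one. -/
def step : Program := .seq treatArc (assign 6 (.var 6 + .var 5))

/-- Cover the curve by arcs, and treat one after the other. -/
def searchProgram : Program := .seq setup (whileE (.var 3 + 1 - .var 6) step)

/-- The cost of the choice of the parameters, for precision `p`. -/
def costSetup (p : ℕ) : ℕ :=
  1 + ((block [(1, 113 * Expr.var 0 * .var 0 * (.var 1 + 1)), (3, 1)]).ops +
    ((p + 1) * (doubling.ops + ((Expr.var 1 * .var 1 - .var 3).compile numVars).ops + 1) +
      (1 + (block [(4, Expr.var 4 + 1), (5, .var 4 + .var 3 / .var 1)]).ops)))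

section Main

variable {m : Budget} {Y : ℕ} {H d st : ℤ} {p : ℕ}

/-- The registers that describe the subdivision. -/
structure GridState (b H : ℤ) (p : ℕ) (d st j : ℤ) (s : ℕ → ℤ) : Prop where
  r₀ : s 0 = b
  r₁ : s 1 = H
  r₂ : s 2 = p
  r₃ : s 3 = 2 ^ p
  r₄ : s 4 = d
  r₅ : s 5 = st
  r₆ : s 6 = j

/-- The number of doublings is the least `p` with `H² ≤ 2 ^ p`. -/
theorem ev_setup {s : ℕ → ℤ} (hY : Scale m Y) {b a : ℤ} (h0 : s 0 = b) (h2 : s 2 = 0) (h6 : s 6 = 0)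
    (ha : m.A .heightBound 0 0 = a) (haX : |a| ≤ m.X) (hH : 113 * b * b * (a + 1) = H)
    (hHX : |H| ≤ m.X) (hp : ∀ i : ℕ, (2 : ℤ) ^ i < H * H ↔ i < p) (hpX : (2 : ℤ) ^ p ≤ m.X)
    (hpd : p ≤ m.digits) (hd : m.A .distBound p 0 + 1 = d) (hdX : |d - 1| ≤ m.X) (hdX' : |d| ≤ m.X)
    (hst : d + 2 ^ p / H = st) (hsX : |st| ≤ m.X) :
    m.Ev setup s (costSetup p) fun t o => o = [] ∧ GridState b H p d st 0 t := by
  have hX : (2 : ℤ) ≤ m.X := by exact_mod_cast m.two_le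
  have hV : numVars = 35 := rfl
  have hsz := hY.size_le
  refine Budget.Ev.seq (Q := fun t o => o = [] ∧ t 1 = a ∧ ∀ x, x ≠ 1 → t x = s x) ?_ ?_
  · refine Budget.Ev.query (by omega) (by omega) (by omega) (by rw [h2]; simp)
      (by rw [h2, h6]; simpa [ha] using haX) ⟨rfl, ?_, fun x hx => Function.update_of_ne hx _ _⟩
    rw [Function.update_self, h2, h6]
    simpa using ha
  rintro t _ ⟨rfl, ht1, ht⟩
  refine Budget.Ev.seq (Q := fun u o => o = [] ∧ u 0 = b ∧ u 1 = H ∧ u 2 = 0 ∧ u 3 = 1 ∧ u 6 = 0)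
    ?_ ?_
  · have e : (113 * Expr.var 0 * .var 0 * (.var 1 + 1) : Expr).eval t = H := by
      simp only [Expr.eval_mul, Expr.eval_add, Expr.eval_ofNat, Expr.eval_var, Expr.eval_one, ht1,
        ht 0 (by omega), h0, hH]
    refine Budget.Ev.block ⟨⟨by omega, by decide +kernel, le_trans (by decide +kernel : _ ≤ 10000) hsz⟩,
      by rw [e]; exact hHX, ⟨by omega, trivial, le_trans (by decide +kernel : _ ≤ 10000) hsz⟩, ?_,
      trivial⟩ ?_
    · simp only [Expr.eval_one, abs_one]; omega
    · simp only [runBlock, e]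
      simp [ht, h0, h2, h6]
  rintro u _ ⟨rfl, hu0, hu1, hu2, hu3, hu6⟩
  refine Budget.Ev.seq (Q := fun v o => o = [] ∧ v 0 = b ∧ v 1 = H ∧ v 2 = p ∧ v 3 = 2 ^ p ∧ v 6 = 0)
    ?_ ?_
  · refine Budget.Ev.mono (Budget.Ev.count (by decide +kernel)
      (le_trans (by decide +kernel : _ ≤ 10000) hsz) p
      (I := fun i v => v 0 = b ∧ v 1 = H ∧ v 2 = i ∧ v 3 = 2 ^ i ∧ v 6 = 0)
      (Φ := fun _ o => o = []) ?_ ?_ u ⟨hu0, hu1, by simpa using hu2, by simpa using hu3, hu6⟩)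
      le_rfl ?_
    · rintro i v ⟨-, hv1, -, hv3, -⟩ -
      rw [← hp i]
      simp only [Expr.eval_sub, Expr.eval_mul, Expr.eval_var, hv1, hv3]
      omega
    · rintro i v ⟨hv0, hv1, hv2, hv3, hv6⟩ hi
      have e1 : (2 : ℤ) ^ i + 2 ^ i = 2 ^ (i + 1) := by ring
      have e2 : (2 : ℤ) ^ (i + 1) ≤ m.X :=
        (pow_le_pow_right₀ (by norm_num) (by omega)).trans hpX
      have e3 : ((i : ℤ) + 1) ≤ 2 ^ (i + 1) := by
        exact_mod_cast (Nat.lt_two_pow_self (n := i + 1)).le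
      refine Budget.Ev.block ⟨⟨by omega, by decide +kernel, le_trans (by decide +kernel : _ ≤ 10000) hsz⟩,
        ?_, ⟨by omega, by decide +kernel, le_trans (by decide +kernel : _ ≤ 10000) hsz⟩, ?_,
        trivial⟩ ?_
      · simp only [Expr.eval_add, Expr.eval_var, hv3, e1]
        rwa [abs_of_nonneg (by positivity)]
      · simp only [Expr.eval_add, Expr.eval_var, Expr.eval_one]
        rw [Function.update_of_ne (by omega), hv2, abs_of_nonneg (by positivity)]
        omega
      · simp [runBlock, hv0, hv1, hv2, hv3, hv6, e1]
    · rintro v o ⟨hv, os, rfl, hos⟩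
      refine ⟨?_, hv⟩
      rw [List.flatMap_eq_nil_iff]
      exact fun i hi => hos i (List.mem_range.1 hi)
  rintro v _ ⟨rfl, hv0, hv1, hv2, hv3, hv6⟩
  refine Budget.Ev.seq (Q := fun w o => o = [] ∧ w 4 = d - 1 ∧ ∀ x, x ≠ 4 → w x = v x) ?_ ?_
  · have e : m.A .distBound (v 2).toNat (v 6) = d - 1 := by
      rw [hv2, hv6, ← hd]; simp
    refine Budget.Ev.query (by omega) (by omega) (by omega) (by rw [hv2]; simpa using hpd)
      (by rw [e]; exact hdX) ⟨rfl, ?_, fun x hx => Function.update_of_ne hx _ _⟩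
    rw [Function.update_self, e]
  rintro w _ ⟨rfl, hw4, hw⟩
  have e1 : (Expr.var 4 + 1 : Expr).eval w = d := by simp [hw4]
  have e2 : (Expr.var 4 + .var 3 / .var 1 : Expr).eval (Function.update w 4 d) = st := by
    simp [hw, hv3, hv1, hst]
  refine Budget.Ev.block ⟨⟨by omega, by decide +kernel, le_trans (by decide +kernel : _ ≤ 10000) hsz⟩,
    by rw [e1]; exact hdX', ⟨by omega, by decide +kernel, le_trans (by decide +kernel : _ ≤ 10000) hsz⟩,
    by rw [e1, e2]; exact hsX, trivial⟩ ?_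
  simp only [runBlock, e1, e2]
  refine ⟨by simp, ?_, ?_, ?_, ?_, ?_, ?_, ?_⟩ <;> simp [hw, hv0, hv1, hv2, hv3, hv6]

end Main

end NearCurve

namespace NearCurve
open V3

section Search

variable {m : Budget} {Y B : ℕ} {N δ : ℝ} {H P d st : ℤ} {p : ℕ}

theorem abs_coord_le_norm {w : V3 ℤ} {r : ℝ} (h : ‖intVec w.fn‖ ≤ r) :
    |(w.x : ℝ)| ≤ r ∧ |(w.y : ℝ)| ≤ r ∧ |(w.z : ℝ)| ≤ r := by
  have h1 := fun i => (PiLp.norm_apply_le (intVec w.fn) i).trans h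
  exact ⟨h1 0, h1 1, h1 2⟩

theorem dot_self_le_of_norm {w : V3 ℤ} {r : ℤ} (h : ‖intVec w.fn‖ ≤ r) : dot w w ≤ r ^ 2 := by
  have h1 := pow_le_pow_left₀ (norm_nonneg _) h 2
  rw [norm_intVec_sq] at h1
  exact_mod_cast h1

theorem Answers.Correct.arcData {A : Answers} {F dF : ℝ → E3} (hA : A.Correct F dF N δ) {j : ℤ}
    (hj : 0 ≤ j) (hj' : j ≤ 2 ^ p) :
    ArcData F dF (2 ^ p) j ⟨A (.curve 0) p j, A (.curve 1) p j, A (.curve 2) p j⟩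
      ⟨A (.deriv 0) p j, A (.deriv 1) p j, A (.deriv 2) p j⟩ := by
  have h1 := fun i => hA.curve i p j hj hj'
  have h2 := fun i => hA.deriv i p j hj hj'
  constructor
  · refine norm_le_two_of_coord fun i => ?_
    fin_cases i <;> simpa [intVec, V3.fn] using h1 _
  · refine norm_le_two_of_coord fun i => ?_
    fin_cases i <;> simpa [intVec, V3.fn] using h2 _

/-- The integral vector `w` represents a point of height at most `N` within `δ` of the arc that
starts at the parameter `j / P`. -/
def NearArc (φ : unitInterval → RP2) (N δ : ℝ) (P st j : ℤ) (w : V3 ℤ) : Prop :=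
  (|(w.x : ℝ)| ≤ N ∧ |(w.y : ℝ)| ≤ N ∧ |(w.z : ℝ)| ≤ N) ∧
    ∃ (hw : intVec w.fn ≠ 0) (t : unitInterval), (j : ℝ) / P ≤ t ∧ (t : ℝ) ≤ (j + st) / P ∧
      projDist (Projectivization.mk ℝ _ hw) (φ t) ≤ δ

/-- A bound for the number of combinations enumerated on an arc that holds for all arcs. -/
def arcCount (B : ℕ) (H P d st : ℤ) : ℕ := (1024 * H ^ 3 * (B : ℤ) ^ 2 * (st * d) / P ^ 2).toNat

theorem arcCount_le (hP : 0 < P) (h : 0 ≤ 1024 * H ^ 3 * (B : ℤ) ^ 2 * (st * d)) :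
    (arcCount B H P d st : ℤ) * P ^ 2 ≤ 1024 * H ^ 3 * (B : ℤ) ^ 2 * (st * d) := by
  rw [arcCount, Int.toNat_of_nonneg (Int.ediv_nonneg h (by positivity))]
  exact Int.ediv_mul_le _ (by positivity)

theorem le_arcCount (hP : 0 < P) {n : ℕ}
    (h : (n : ℤ) * P ^ 2 ≤ 1024 * H ^ 3 * (B : ℤ) ^ 2 * (st * d)) : n ≤ arcCount B H P d st := by
  have h1 := (Int.le_ediv_iff_mul_le (by positivity : 0 < P ^ 2)).2 h
  rw [arcCount]
  omega

/-- The numerical data are at most `Y`, the lowest level of the tower of bounds. -/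
structure SmallData (Y B : ℕ) (H d st : ℤ) (p : ℕ) : Prop where
  Y_ge : 100 * B * H ^ 2 ≤ Y
  P_lt : 2 ^ p < 2 * H ^ 2
  st_le : st ≤ 5 * 2 ^ p

/-- One pass of the main loop covers all points near its arc: the vectors near the arc are below the
threshold, and in the cone around `f` if the neighbourhood is thin. -/
theorem ev_step (hY : Scale m Y) {φ : unitInterval → RP2} {F dF ddF : ℝ → E3}
    (hF : BoundedLift φ F dF ddF B) (hA : m.A.Correct F dF N δ)
    (D : GridData B N δ H (2 ^ p) d st) (hS : SmallData Y B H d st p) (hp : p ≤ m.digits) {j : ℤ}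
    (hj : 0 ≤ j) (hj' : j ≤ 2 ^ p) {s : ℕ → ℤ} (hs : GridState B H p d st j s) :
    m.Ev step s (costArc m.digits + arcCount B H (2 ^ p) d st * costEnum +
      (assign 6 (.var 6 + .var 5)).ops) fun t o => GridState B H p d st (j + st) t ∧
        Output m.X (160 * (B : ℝ) ^ 2 / H) (4 * arcCount B H (2 ^ p) d st) 1 o ∧
        ∀ w, NearArc φ N δ (2 ^ p) st j w → Contains o w := by
  have hV : numVars = 35 := rfl
  obtain ⟨f, hf⟩ : ∃ f : V3 ℤ, f = ⟨m.A (.curve 0) p j, m.A (.curve 1) p j, m.A (.curve 2) p j⟩ :=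
    ⟨_, rfl⟩
  obtain ⟨g, hg⟩ : ∃ g : V3 ℤ, g = ⟨m.A (.deriv 0) p j, m.A (.deriv 1) p j, m.A (.deriv 2) p j⟩ :=
    ⟨_, rfl⟩
  have arc : ArcData F dF (2 ^ p) j f g := by rw [hf, hg]; exact hA.arcData hj hj'
  obtain ⟨hfn, hgn, -⟩ := arc.norm_bounds hF D hj hj'
  have hB := D.B_pos
  have hB' : (1 : ℤ) ≤ B := by exact_mod_cast hB
  have hH := D.H_pos'
  have hd := D.d_pos
  have hd' := D.d_le
  have hds := D.le_s
  obtain ⟨Y_ge, P_lt, st_le⟩ := hS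
  have hpP : (p : ℤ) ≤ 2 ^ p := by exact_mod_cast (Nat.lt_two_pow_self (n := p)).le
  obtain ⟨P, hP⟩ : ∃ P : ℤ, P = 2 ^ p := ⟨_, rfl⟩
  have hPpos : 0 < P := by rw [hP]; positivity
  have hPR : ((2 ^ p : ℤ) : ℝ) = P := by rw [hP]
  rw [← hP] at hpP P_lt st_le hj' arc D hd'
  rw [hPR] at hfn hgn
  have hHsq : H ≤ H ^ 2 := by nlinarith
  have hBH : H ^ 2 ≤ B * H ^ 2 := le_mul_of_one_le_left (by positivity) hB'
  have hBBH : (B : ℤ) ≤ B * H ^ 2 := le_mul_of_one_le_right (by positivity) (by nlinarith)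
  have hBP : B * P ≤ B * (2 * H ^ 2) := by gcongr
  have hYnn : 100 * (B * H ^ 2) ≤ (Y : ℤ) := by linarith
  have hcoord : ∀ {x : ℤ}, |(x : ℝ)| ≤ 2 * B * P → |x| ≤ Y := by
    intro x hx
    have : |x| ≤ 2 * B * P := by exact_mod_cast hx
    linarith
  have hfY : |f.x| ≤ Y ∧ |f.y| ≤ Y ∧ |f.z| ≤ Y :=
    ⟨hcoord (abs_coord_le_norm hfn).1, hcoord (abs_coord_le_norm hfn).2.1,
      hcoord (abs_coord_le_norm hfn).2.2⟩
  have hgY : |g.x| ≤ Y ∧ |g.y| ≤ Y ∧ |g.z| ≤ Y :=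
    ⟨hcoord (abs_coord_le_norm hgn).1, hcoord (abs_coord_le_norm hgn).2.1,
      hcoord (abs_coord_le_norm hgn).2.2⟩
  have hff : dot f f ≤ 4 * (B : ℤ) ^ 2 * P ^ 2 := by
    have := dot_self_le_of_norm (r := 2 * B * P) (w := f) (by push_cast; exact hfn)
    linarith [this, (by ring : (2 * (B : ℤ) * P) ^ 2 = 4 * (B : ℤ) ^ 2 * P ^ 2)]
  have hgg : dot g g ≤ 4 * (B : ℤ) ^ 2 * P ^ 2 := by
    have := dot_self_le_of_norm (r := 2 * B * P) (w := g) (by push_cast; exact hgn)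
    linarith [this, (by ring : (2 * (B : ℤ) * P) ^ 2 = 4 * (B : ℤ) ^ 2 * P ^ 2)]
  obtain ⟨r0, r1, r2, r3, r4, r5, r6⟩ := hs
  rw [← hP] at r3
  have hsY : ∀ x < 7, |s x| ≤ Y := by
    intro x hx
    have hx' : x = 0 ∨ x = 1 ∨ x = 2 ∨ x = 3 ∨ x = 4 ∨ x = 5 ∨ x = 6 := by omega
    have hn : 0 ≤ (p : ℤ) := by positivity
    rcases hx' with rfl | rfl | rfl | rfl | rfl | rfl | rfl
    · rw [r0, abs_of_nonneg] <;> linarith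
    · rw [r1, abs_of_nonneg] <;> linarith
    · rw [r2, abs_of_nonneg] <;> linarith
    · rw [r3, abs_of_nonneg] <;> linarith
    · rw [r4, abs_of_nonneg] <;> linarith
    · rw [r5, abs_of_nonneg] <;> linarith
    · rw [r6, abs_of_nonneg] <;> linarith
  have hp2 : (s 2).toNat = p := by rw [r2]; simp
  obtain ⟨n, hn, hev⟩ := ev_treatArc hY hsY (by rw [r0]; omega) (by rw [r1]; omega) r3 hPpos r4
    (by omega) r5 (by rw [hp2]; exact hp) (by rw [hp2, r6]; exact hf) (by rw [hp2, r6]; exact hg)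
    hfY hgY
  rw [r0, r1] at hev
  rw [r1] at hn
  have hnle : n ≤ arcCount B H P d st :=
    le_arcCount hPpos (count_le hB' hPpos (by omega) hds hd' st_le hff hgg (by omega) hn)
  rw [← hP]
  refine Budget.Ev.seq (Budget.Ev.mono hev
    (Nat.add_le_add_left (Nat.mul_le_mul_right _ hnle) _) fun _ _ h => h) ?_
  rintro t o ⟨ht, hout, hcov⟩
  refine Budget.Ev.assign' hY (by decide) (by decide) (by decide +kernel) (z := j + st) ?_ ?_ ?_
  · simp [ht 6 (by omega), ht 5 (by omega), r5, r6]
  · refine hY.abs_le (i := 0) (by omega) ?_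
    rw [abs_of_nonneg (by omega)]
    simp only [lev, pow_zero, pow_one]
    linarith
  · intro u hu hu6
    refine ⟨⟨?_, ?_, ?_, ?_, ?_, ?_, hu6⟩, ?_, ?_⟩
    · rw [hu 0 (by omega), ht 0 (by omega), r0]
    · rw [hu 1 (by omega), ht 1 (by omega), r1]
    · rw [hu 2 (by omega), ht 2 (by omega), r2]
    · rw [hu 3 (by omega), ht 3 (by omega), r3, hP]
    · rw [hu 4 (by omega), ht 4 (by omega), r4]
    · rw [hu 5 (by omega), ht 5 (by omega), r5]
    · rw [List.append_nil]
      exact (by exact_mod_cast hout : Output m.X (160 * (B : ℝ) ^ 2 / H) (4 * n) 1 o).mono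
        (by omega) le_rfl
    · rintro w ⟨hN, hw, τ, hτ, hτ', hdist⟩
      rw [List.append_nil]
      refine hcov w (V3.intVec_ne_zero.1 hw)
        (bil_le_threshold hF D arc hj hτ hτ' hw hN hdist) fun hthin => ?_
      have := cone_of_near hF D hthin arc hj hj' hτ hτ' hw hdist
      exact ⟨this.2, this.1⟩

/-- The number of arcs: they start at the multiples `j` of the step with `0 ≤ j ≤ P`. -/
def arcs (P st : ℤ) : ℕ := (P / st).toNat + 1

theorem lt_arcs_iff (hP : 0 ≤ P) (hst : 0 < st) (i : ℕ) : i < arcs P st ↔ i * st ≤ P := by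
  rw [← Int.le_ediv_iff_mul_le hst, arcs]
  have := Int.ediv_nonneg hP hst.le
  omega

theorem Output.flatMap {X : ℕ} {ℓ : ℝ} {p q M : ℕ} {os : ℕ → List Record}
    (h : ∀ i < M, Output X ℓ p q (os i)) : Output X ℓ (M * p) (M * q) ((List.range M).flatMap os) := by
  induction M with
  | zero => simpa using Output.nil
  | succ M ih =>
    rw [List.range_succ, List.flatMap_append, add_mul, add_mul, one_mul, one_mul]
    refine (ih fun i hi => h i (by omega)).append ?_
    simpa using h M (by omega)

/-- The main loop covers all arcs.  Its last arc may start at the parameter `1`, which is why the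
guard is `P + 1 - j`. -/
theorem ev_search (hY : Scale m Y) {φ : unitInterval → RP2} {F dF ddF : ℝ → E3}
    (hF : BoundedLift φ F dF ddF B) (hA : m.A.Correct F dF N δ)
    (D : GridData B N δ H (2 ^ p) d st) (hS : SmallData Y B H d st p) (hp : p ≤ m.digits)
    {s : ℕ → ℤ} (hs : GridState B H p d st 0 s) :
    m.Ev (whileE (.var 3 + 1 - .var 6) step) s ((arcs (2 ^ p) st + 1) * (costArc m.digits +
      arcCount B H (2 ^ p) d st * costEnum + (assign 6 (.var 6 + .var 5)).ops +
      ((Expr.var 3 + 1 - .var 6).compile numVars).ops + 1)) fun _ o =>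
        Output m.X (160 * (B : ℝ) ^ 2 / H) (arcs (2 ^ p) st * (4 * arcCount B H (2 ^ p) d st))
          (arcs (2 ^ p) st * 1) o ∧
        ∀ i < arcs (2 ^ p) st, ∀ w, NearArc φ N δ (2 ^ p) st (i * st) w → Contains o w := by
  have hst : 0 < st := by have := D.le_s; have := D.d_pos; omega
  have harcs := lt_arcs_iff (P := 2 ^ p) (by positivity) hst
  refine Budget.Ev.mono (Budget.Ev.count (by decide +kernel)
    (le_trans (by decide +kernel : _ ≤ 10000) hY.size_le) (arcs (2 ^ p) st)
    (I := fun i t => GridState B H p d st (i * st) t)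
    (Φ := fun i o => Output m.X (160 * (B : ℝ) ^ 2 / H) (4 * arcCount B H (2 ^ p) d st) 1 o ∧
        ∀ w, NearArc φ N δ (2 ^ p) st (i * st) w → Contains o w) ?_ ?_ s (by simpa using hs))
    le_rfl ?_
  · rintro i t ht -
    rw [harcs i]
    simp only [Expr.eval_sub, Expr.eval_add, Expr.eval_var, Expr.eval_one, ht.r₃, ht.r₆]
    omega
  · rintro i t ht hi
    refine Budget.Ev.mono (ev_step hY hF hA D hS hp (by positivity) ((harcs i).1 hi) ht) le_rfl ?_
    rintro u o ⟨hu, h⟩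
    refine ⟨?_, h⟩
    have e : ((i + 1 : ℕ) : ℤ) * st = i * st + st := by push_cast; ring
    rw [e]
    exact hu
  · rintro t o ⟨-, os, rfl, hos⟩
    exact ⟨Output.flatMap fun i hi => (hos i hi).1, fun i hi w hw =>
      ((hos i hi).2 w hw).of_subset (subset_flatMap_range hi os)⟩

end Search

end NearCurve

namespace NearCurve
open V3

/-! ### Rational points -/

/-- A rational point of height at most `N` has integral coordinates of absolute value at
most `N`. -/
theorem exists_integral_coordinates {x : QP2} {N : ℝ} (h : x.mulHeight ≤ N) :
    ∃ w : V3 ℤ, (|(w.x : ℝ)| ≤ N ∧ |(w.y : ℝ)| ≤ N ∧ |(w.z : ℝ)| ≤ N) ∧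
      ∃ hw : intVec w.fn ≠ 0, toReal x = Projectivization.mk ℝ (intVec w.fn) hw := by
  obtain ⟨b, hb⟩ := IsLocalization.exist_integer_multiples_of_finite (nonZeroDivisors ℤ) x.rep
  choose y hy using hb
  have hb0 : ((b : ℤ) : ℚ) ≠ 0 := by exact_mod_cast nonZeroDivisors.coe_ne_zero b
  have hy' : ∀ i, (y i : ℚ) = (b : ℤ) * x.rep i := fun i => by
    have := hy i
    simpa [Algebra.smul_def] using this
  obtain ⟨g, hg, hg1⟩ := Finset.extract_gcd (s := Finset.univ) y Finset.univ_nonempty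
  have hG : ((Finset.univ.gcd y : ℤ) : ℚ) ≠ 0 := by
    intro hc
    have h0 : Finset.univ.gcd y = 0 := by exact_mod_cast hc
    apply x.rep_nonzero
    funext i
    have h1 : y i = 0 := by rw [hg i (Finset.mem_univ i), h0, zero_mul]
    have h2 := hy' i
    rw [h1] at h2
    simpa [hb0] using h2.symm
  obtain ⟨c, hc⟩ : ∃ c : ℚ, c = (b : ℤ) / (Finset.univ.gcd y : ℤ) := ⟨_, rfl⟩
  have hc0 : c ≠ 0 := by rw [hc]; exact div_ne_zero hb0 hG
  have hgr : (((↑) : ℤ → ℚ) ∘ g) = c • x.rep := by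
    funext i
    have h1 : (y i : ℚ) = (Finset.univ.gcd y : ℤ) * g i := by
      exact_mod_cast hg i (Finset.mem_univ i)
    simp only [Function.comp, Pi.smul_apply, smul_eq_mul, hc]
    rw [div_mul_eq_mul_div, eq_div_iff hG, ← hy' i, h1, mul_comm]
  have hx : x.mulHeight = ((⨆ i, |g i| : ℤ) : ℝ) := by
    rw [← Rat.mulHeight_eq_max_abs_of_gcd_eq_one hg1, hgr, Height.mulHeight_smul_eq_mulHeight _ hc0,
      ← Projectivization.mulHeight_mk x.rep_nonzero, x.mk_rep]
  have hle : ∀ i, |(g i : ℝ)| ≤ N := fun i => by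
    refine le_trans ?_ (hx ▸ h)
    have : |g i| ≤ ⨆ i, |g i| := le_ciSup (f := fun i => |g i|) (Set.finite_range _).bddAbove i
    exact_mod_cast this
  have hfn : (⟨g 0, g 1, g 2⟩ : V3 ℤ).fn = g := by
    funext i; fin_cases i <;> rfl
  have e : intVec g = (c : ℝ) • ratVec x.rep := by
    ext i
    have h1 := congrFun hgr i
    simp only [Function.comp, Pi.smul_apply, smul_eq_mul] at h1
    have h2 : (g i : ℝ) = ((g i : ℚ) : ℝ) := by simp
    simp only [intVec, ratVec, PiLp.smul_apply, smul_eq_mul, h2, h1]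
    simp
  have hr : ratVec x.rep ≠ 0 := fun h0 => x.rep_nonzero (ratVec_injective (by rw [h0, map_zero]))
  have hc' : (c : ℝ) ≠ 0 := by exact_mod_cast hc0
  refine ⟨⟨g 0, g 1, g 2⟩, ⟨hle 0, hle 1, hle 2⟩, ?_⟩
  rw [hfn]
  refine ⟨by rw [e]; exact smul_ne_zero hc' hr, ?_⟩
  rw [toReal]
  conv_lhs => rw [← x.mk_rep]
  rw [Projectivization.map_mk, Projectivization.mk_eq_mk_iff']
  refine ⟨(c : ℝ)⁻¹, ?_⟩
  rw [e, smul_smul, inv_mul_cancel₀ hc', one_smul]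

/-- Each parameter belongs to one of the arcs. -/
theorem exists_arc {P st : ℤ} (hP : 0 < P) (hst : 0 < st) (t : unitInterval) :
    ∃ i < arcs P st, ((i * st : ℤ) : ℝ) / P ≤ t ∧ (t : ℝ) ≤ (((i * st : ℤ) : ℝ) + st) / P := by
  have hP' : (0 : ℝ) < P := by exact_mod_cast hP
  have hst' : (0 : ℝ) < st := by exact_mod_cast hst
  have ht := t.2.1
  have h0 : 0 ≤ (t : ℝ) * P / st := by positivity
  have h1 := Nat.floor_le h0
  have h2 := Nat.lt_floor_add_one ((t : ℝ) * P / st)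
  rw [le_div_iff₀ hst'] at h1
  rw [div_lt_iff₀ hst'] at h2
  refine ⟨⌊(t : ℝ) * P / st⌋₊, ?_, ?_, ?_⟩
  · rw [lt_arcs_iff hP.le hst]
    have h3 : (t : ℝ) * P ≤ P := mul_le_of_le_one_left hP'.le t.2.2
    exact_mod_cast h1.trans h3
  · rw [div_le_iff₀ hP']
    push_cast
    exact h1
  · rw [le_div_iff₀ hP']
    push_cast
    linarith

theorem covers_of_arcs {φ : unitInterval → RP2} {N δ : ℝ} {P st : ℤ} (hP : 0 < P) (hst : 0 < st)
    {o : List Record}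
    (h : ∀ i < arcs P st, ∀ w, NearArc φ N δ P st (i * st) w → Contains o w) {x : QP2}
    (hx : x.mulHeight ≤ N) (hy : ∃ y ∈ Set.range φ, projDist (toReal x) y ≤ δ) :
    ∃ R ∈ o, toReal x ∈ R.carrier := by
  obtain ⟨w, hN, hw, hxw⟩ := exists_integral_coordinates hx
  obtain ⟨_, ⟨t, rfl⟩, hd⟩ := hy
  obtain ⟨i, hi, h1, h2⟩ := exists_arc hP hst t
  rw [hxw] at hd ⊢
  exact h i hi w ⟨hN, hw, t, h1, h2, hd⟩ hw

end NearCurve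

namespace NearCurve
open V3

/-! ### The choice of the parameters -/

section Parameters

variable {B : ℕ} {N δ : ℝ}

/-- The parameters of the search, as the set-up computes them from the answers `A`. -/
structure Parameters (A : Answers) (B : ℕ) (a H : ℤ) (p : ℕ) (d st : ℤ) : Prop where
  ha : A .heightBound 0 0 = a
  hH : 113 * (B : ℤ) * B * (a + 1) = H
  hp : ∀ i : ℕ, (2 : ℤ) ^ i < H * H ↔ i < p
  hd : A .distBound p 0 + 1 = d
  hst : d + 2 ^ p / H = st

/-- Since `2 ^ p ≥ H² ≥ N²`, the working precision `1 / 2 ^ p` is at most `N^(-2) ≤ δ`, so that the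
rounding of `δ` and of the coordinates costs only a constant factor. -/
theorem exists_parameters {A : Answers} {F dF : ℝ → E3} (hA : A.Correct F dF N δ) (hB : 1 ≤ B)
    (hN : 1 < N) (hδ : 1 / N ^ 2 ≤ δ) :
    ∃ (a H : ℤ) (p : ℕ) (d st : ℤ), Parameters A B a H p d st ∧ GridData B N δ H (2 ^ p) d st ∧
      (2 : ℤ) ^ p < 2 * H ^ 2 ∧ st ≤ 5 * 2 ^ p ∧ (2 : ℤ) ^ p ≤ st * H ∧ |a| ≤ H ∧
      (H : ℝ) ≤ 339 * B ^ 2 * N ∧ (d : ℝ) ≤ 3 * 2 ^ p * δ := by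
  have hB' : (1 : ℝ) ≤ B := by exact_mod_cast hB
  have hB2 : (1 : ℝ) ≤ (B : ℝ) ^ 2 := one_le_pow₀ hB'
  have h1 := hA.heightBound 0 0
  rw [pow_zero, one_mul, abs_le] at h1
  obtain ⟨a, ha⟩ : ∃ a, A .heightBound 0 0 = a := ⟨_, rfl⟩
  rw [ha] at h1
  have ha0 : 0 ≤ a := by
    have : (-1 : ℝ) < a := by linarith
    have : (-1 : ℤ) < a := by exact_mod_cast this
    omega
  obtain ⟨H, hH⟩ : ∃ H, 113 * (B : ℤ) * B * (a + 1) = H := ⟨_, rfl⟩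
  have hHR : 113 * (B : ℝ) ^ 2 * (a + 1) = H := by rw [← hH]; push_cast; ring
  have hH1 : 113 * (B : ℝ) ^ 2 * N ≤ H := by
    rw [← hHR]
    have : N ≤ a + 1 := by linarith
    gcongr
  have hH2 : (H : ℝ) ≤ 339 * B ^ 2 * N := by
    rw [← hHR]
    have : (a : ℝ) + 1 ≤ 3 * N := by linarith
    have := mul_le_mul_of_nonneg_left this (by positivity : 0 ≤ 113 * (B : ℝ) ^ 2)
    linarith
  have hHN : 113 * N ≤ H := le_trans (by nlinarith) hH1
  have hH0R : (113 : ℝ) ≤ H := by linarith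
  have hH0 : 113 ≤ H := by exact_mod_cast hH0R
  have haH : |a| ≤ H := by
    rw [abs_of_nonneg ha0]
    have h2 : (a : ℝ) + 1 ≤ (B : ℝ) ^ 2 * (a + 1) := le_mul_of_one_le_left (by linarith) hB2
    have : (a : ℝ) ≤ H := by rw [← hHR]; linarith
    exact_mod_cast this
  obtain ⟨p, hp⟩ : ∃ p : ℕ, ∀ i : ℕ, (2 : ℤ) ^ i < H * H ↔ i < p := by
    have hex : ∃ p : ℕ, H * H ≤ 2 ^ p := by
      refine ⟨(H * H).toNat, ?_⟩
      have := (Nat.lt_two_pow_self (n := (H * H).toNat)).le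
      have h2 : ((H * H).toNat : ℤ) ≤ 2 ^ (H * H).toNat := by exact_mod_cast this
      have := Int.self_le_toNat (H * H)
      omega
    refine ⟨Nat.find hex, fun i => ?_⟩
    rw [← not_le, ← not_le, not_iff_not]
    exact ⟨fun h => Nat.find_min' hex h, fun h => (Nat.find_spec hex).trans
      (pow_le_pow_right₀ (by norm_num) h)⟩
  obtain ⟨P, hP⟩ : ∃ P : ℤ, 2 ^ p = P := ⟨_, rfl⟩
  have hPR : (2 : ℝ) ^ p = P := by rw [← hP]; push_cast; rfl
  have hPH : H * H ≤ P := by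
    rw [← hP]
    exact not_lt.1 fun h => lt_irrefl _ ((hp p).1 h)
  have hPlt : P < 2 * H ^ 2 := by
    rw [← hP]
    cases p with
    | zero => rw [pow_zero]; nlinarith
    | succ p =>
      have := (hp p).2 (by omega)
      rw [pow_succ]
      linarith [this, sq H]
  obtain ⟨d, hd⟩ : ∃ d, A .distBound p 0 + 1 = d := ⟨_, rfl⟩
  have h3 := hA.distBound p 0
  have hdR : (A .distBound p 0 : ℝ) = d - 1 := by rw [← hd]; push_cast; ring
  rw [hPR, hdR, abs_le] at h3
  have hN2 : 1 < N ^ 2 := one_lt_pow₀ hN (by norm_num)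
  have hN0 : 0 < N ^ 2 := by positivity
  have hinv : 1 / N ^ 2 ≤ 1 := by rw [div_le_one hN0]; exact hN2.le
  have hmin : 1 / N ^ 2 ≤ min δ 2 := le_min hδ (by linarith)
  have hPHR : (H : ℝ) ^ 2 ≤ P := by rw [sq]; exact_mod_cast hPH
  have hP0R : (0 : ℝ) < P := lt_of_lt_of_le (by positivity) hPHR
  have hP0 : 0 < P := by exact_mod_cast hP0R
  have hPN : 1 ≤ (P : ℝ) * (1 / N ^ 2) := by
    rw [mul_one_div, le_div_iff₀ hN0, one_mul]
    exact le_trans (pow_le_pow_left₀ (by linarith) (by linarith : N ≤ H) 2) hPHR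
  have hPm : (P : ℝ) * (1 / N ^ 2) ≤ P * min δ 2 := mul_le_mul_of_nonneg_left hmin hP0R.le
  have hdP : (P : ℝ) * (1 / N ^ 2) ≤ d := by linarith
  have hd1 : 1 ≤ d := by
    have : (1 : ℝ) ≤ d := hPN.trans hdP
    exact_mod_cast this
  have hPm2 : (P : ℝ) * min δ 2 ≤ P * 2 := mul_le_mul_of_nonneg_left (min_le_right _ _) hP0R.le
  have hPmδ : (P : ℝ) * min δ 2 ≤ P * δ := mul_le_mul_of_nonneg_left (min_le_left _ _) hP0R.le
  have hP1 : 1 ≤ P := by omega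
  have hdiv1 : P / H * H ≤ P := Int.ediv_mul_le _ (by omega)
  have hdiv2 : P < (P / H + 1) * H := Int.lt_ediv_add_one_mul_self _ (by omega)
  have hdiv3 : P / H ≤ P := Int.ediv_le_self _ hP0.le
  have hd4 : d ≤ 4 * P := by
    have h5 : (d : ℝ) ≤ 2 * P + 2 := by linarith
    have h6 : d ≤ 2 * P + 2 := by exact_mod_cast h5
    omega
  have hdiv0 : 0 ≤ P / H := Int.ediv_nonneg hP0.le (by omega)
  refine ⟨a, H, p, d, d + 2 ^ p / H, ⟨ha, hH, hp, hd, rfl⟩, ?_⟩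
  rw [hP, hPR]
  refine ⟨⟨hB, hN, hH1, by linarith [sq H], hd1, ?_, ?_, hd4, by omega, by linarith⟩, hPlt, by omega,
    ?_, haH, hH2, by linarith⟩
  · linarith
  · calc (P : ℝ) = P * (1 / N ^ 2) * N ^ 2 := by field_simp
      _ ≤ d * (H : ℝ) ^ 2 := by
          have : N ≤ H := by linarith
          have : 0 ≤ (P : ℝ) * (1 / N ^ 2) := by positivity
          gcongr
  · nlinarith

/-- An arc has length at least `1 / H`, which bounds the number of segments. -/
theorem arcs_le {H P st : ℤ} (hP : 0 < P) (hst : 0 < st) (hH : 1 ≤ H) (h : P ≤ st * H) :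
    (arcs P st : ℤ) ≤ 2 * H := by
  have h1 : P / st ≤ H := by
    refine Int.ediv_le_of_le_mul hst ?_
    linarith [mul_comm st H]
  have := Int.ediv_nonneg hP.le hst.le
  simp only [arcs]
  omega

/-- The number of points on an arc is `O(H³ δ)` times the length of the arc, and the lengths of the
arcs add up to at most `6`, counting the last arc in full. -/
theorem arcs_mul_arcCount_le {H P d st : ℤ} (hP : 0 < P) (hd : 1 ≤ d) (hst : 0 < st) (hH : 0 ≤ H)
    (hs : st ≤ 5 * P) (hdδ : (d : ℝ) ≤ 3 * P * δ) :
    (arcs P st * arcCount B H P d st : ℝ) ≤ 18432 * (H : ℝ) ^ 3 * B ^ 2 * δ := by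
  have h1 := arcCount_le (B := B) (H := H) (P := P) (d := d) (st := st) hP (by positivity)
  have h2 : (arcs P st : ℤ) * st ≤ 6 * P := by
    have : P / st * st ≤ P := Int.ediv_mul_le _ (by omega)
    have := Int.ediv_nonneg hP.le hst.le
    simp only [arcs]
    push_cast
    rw [Int.toNat_of_nonneg this]
    linarith
  have h3 : (arcs P st : ℤ) * arcCount B H P d st * P ≤ 6144 * H ^ 3 * (B : ℤ) ^ 2 * d := by
    refine le_of_mul_le_mul_right (a := P) ?_ hP
    calc (arcs P st : ℤ) * arcCount B H P d st * P * P =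
        arcs P st * (arcCount B H P d st * P ^ 2) := by ring
      _ ≤ arcs P st * (1024 * H ^ 3 * (B : ℤ) ^ 2 * (st * d)) := by gcongr
      _ = 1024 * H ^ 3 * (B : ℤ) ^ 2 * d * (arcs P st * st) := by ring
      _ ≤ 1024 * H ^ 3 * (B : ℤ) ^ 2 * d * (6 * P) := by gcongr
      _ = _ := by ring
  have h4 : (arcs P st * arcCount B H P d st * P : ℝ) ≤ 6144 * (H : ℝ) ^ 3 * (B : ℝ) ^ 2 * d := by
    exact_mod_cast h3
  have hP' : (0 : ℝ) < P := by exact_mod_cast hP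
  have hH' : (0 : ℝ) ≤ H := by exact_mod_cast hH
  refine le_of_mul_le_mul_right (a := (P : ℝ)) ?_ hP'
  calc (arcs P st * arcCount B H P d st * P : ℝ) ≤ 6144 * (H : ℝ) ^ 3 * (B : ℝ) ^ 2 * d := h4
    _ ≤ 6144 * (H : ℝ) ^ 3 * (B : ℝ) ^ 2 * (3 * P * δ) := by gcongr
    _ = _ := by ring

end Parameters

end NearCurve

namespace NearCurve
open V3

/-! ### Time and space -/

theorem size_pow_le (a n : ℕ) : (a ^ n).size ≤ n * a.size + 1 := by
  rw [Nat.size_le, pow_succ]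
  have h1 : a ^ n ≤ (2 ^ a.size) ^ n := Nat.pow_le_pow_left (Nat.lt_size_self a).le n
  rw [← pow_mul, mul_comm a.size] at h1
  have : 0 < 2 ^ (n * a.size) := by positivity
  omega

theorem size_le_log {a : ℕ} (ha : 1 ≤ a) : (a.size : ℝ) ≤ 2 * Real.log a + 1 := by
  have h0 : 0 < a.size := Nat.size_pos.2 ha
  have h1 : 2 ^ (a.size - 1) ≤ a := Nat.lt_size.1 (by omega)
  have h2 : ((2 : ℝ) ^ (a.size - 1)) ≤ a := by exact_mod_cast h1
  have h3 := Real.log_le_log (by positivity) h2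
  rw [Real.log_pow, Nat.cast_sub h0, Nat.cast_one] at h3
  have h4 := Real.log_two_gt_d9
  have h5 : (1 : ℝ) ≤ a.size := by exact_mod_cast h0
  nlinarith

/-- The budget of a search whose parameters are at most `Y`. -/
def searchBudget (A : Answers) (B e : ℕ) {S Y : ℕ} (hS : 1 ≤ S) (hY : 2 ≤ Y) : Budget where
  A := A
  c := fun p => B * (p + 1) ^ e
  X := lev Y S 6
  S := S
  U := 7 * (1 + (lev Y S 6 ^ S).size) ^ 2 + (lev Y S 6 ^ S).size +
    B * ((lev Y S 6 ^ S).size + 1) ^ e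
  M := (numVars + S + 1) * (lev Y S 6 ^ S).size + (lev Y S 6 ^ S).size +
    B * ((lev Y S 6 ^ S).size + 1) ^ e
  two_le := two_le_lev 6 hY hS
  one_le := hS
  time_le := fun p hp => by gcongr
  space_le := fun p hp => by gcongr

section Budget

variable {A : Answers} {B e S Y : ℕ} (hS : 1 ≤ S) (hY : 2 ≤ Y)

theorem scale_searchBudget (hS' : 10000 ≤ S) : Scale (searchBudget A B e hS hY) Y :=
  ⟨hY, hS', rfl⟩

/-- The seven levels of the tower cost only the constant factor `S ^ 7` in the number of digits. -/
theorem digits_searchBudget_le :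
    (searchBudget A B e hS hY).digits ≤ S ^ 7 * Y.size + 1 := by
  have : lev Y S 6 ^ S = Y ^ S ^ 7 := by
    simp only [lev]
    rw [← pow_mul, ← pow_succ]
  simp only [Budget.digits, searchBudget, this]
  exact size_pow_le Y _

theorem searchBudget_U_le (hB : 1 ≤ B) : (searchBudget A B e hS hY).U ≤
    9 * B * (1 + (searchBudget A B e hS hY).digits) ^ (e + 2) := by
  have e1 : (searchBudget A B e hS hY).U = 7 * (1 + (searchBudget A B e hS hY).digits) ^ 2 +
    (searchBudget A B e hS hY).digits + B * ((searchBudget A B e hS hY).digits + 1) ^ e := rfl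
  rw [e1]
  generalize (searchBudget A B e hS hY).digits = L
  have h1 : (1 + L) ^ 2 ≤ B * (1 + L) ^ (e + 2) :=
    (Nat.pow_le_pow_right (by omega) (by omega)).trans (Nat.le_mul_of_pos_left _ hB)
  have h2 : L ≤ (1 + L) ^ 2 := by nlinarith
  have h3 : (L + 1) ^ e ≤ (1 + L) ^ (e + 2) := by
    rw [add_comm L]
    exact Nat.pow_le_pow_right (by omega) (by omega)
  have h4 := Nat.mul_le_mul_left B h3
  linarith

theorem searchBudget_M_le (hB : 1 ≤ B) : (searchBudget A B e hS hY).M ≤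
    (numVars + S + 3) * B * (1 + (searchBudget A B e hS hY).digits) ^ (e + 1) := by
  have e1 : (searchBudget A B e hS hY).M = (numVars + S + 1) * (searchBudget A B e hS hY).digits +
    (searchBudget A B e hS hY).digits + B * ((searchBudget A B e hS hY).digits + 1) ^ e := rfl
  rw [e1]
  generalize (searchBudget A B e hS hY).digits = L
  have h1 : L ≤ B * (1 + L) ^ (e + 1) :=
    calc L ≤ 1 + L := by omega
      _ = (1 + L) ^ 1 := (pow_one _).symm
      _ ≤ (1 + L) ^ (e + 1) := Nat.pow_le_pow_right (by omega) (by omega)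
      _ ≤ _ := Nat.le_mul_of_pos_left _ hB
  have h3 : (L + 1) ^ e ≤ (1 + L) ^ (e + 1) := by
    rw [add_comm L]
    exact Nat.pow_le_pow_right (by omega) (by omega)
  have h4 := Nat.mul_le_mul_left B h3
  have h5 := Nat.mul_le_mul_left (numVars + S + 1) h1
  linarith

/-- The initial store, with `B` in register `0`, is within bounds. -/
theorem holds_single (hBY : B ≤ Y) : (searchBudget A B e hS hY).Holds
    (fun x => Finsupp.single 0 (B : ℤ) x) (Finsupp.single 0 (B : ℤ)) := by
  have hX : Y ≤ (searchBudget A B e hS hY).X := by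
    change Y ≤ lev Y S 6
    simpa [lev] using lev_mono hY hS (Nat.zero_le 6)
  have hXS : (searchBudget A B e hS hY).X ≤ (searchBudget A B e hS hY).X ^ S :=
    Nat.le_self_pow (by omega) _
  have hb : ∀ r, |Finsupp.single 0 (B : ℤ) r| ≤ Y := by
    intro r
    rw [Finsupp.single_apply]
    split_ifs
    · rw [abs_of_nonneg (by positivity)]
      exact_mod_cast hBY
    · simp
  refine ⟨⟨fun r => (hb r).trans (by exact_mod_cast hX.trans hXS), fun r hr => ?_⟩,
    fun x _ => ⟨rfl, (hb x).trans (by exact_mod_cast hX)⟩⟩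
  rw [Finsupp.single_apply, if_neg (by omega)]

end Budget

theorem costSetup_le (p : ℕ) : costSetup p ≤ (p + 1) * costSetup 0 := by
  simp only [costSetup]
  generalize (block _).ops = x
  generalize (block _).ops = y
  generalize doubling.ops + _ + 1 = z
  nlinarith

theorem costArc_le (L : ℕ) : costArc L ≤ (L + 1) * (3 * costArc 0) := by
  simp only [costArc]
  generalize (assign 13 thresholdE).ops = x
  generalize (assign 14 gram3E).ops = y
  generalize (block initBasis).ops = z
  generalize reduceRound.ops + 3 = r
  generalize Program.ops _ + 1 + emitCone.ops = u
  nlinarith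

/-- A constant of the program that bounds the costs of its parts. -/
def costUnit : ℕ := costSetup 0 + 3 * costArc 0 + costEnum + ((assign 6 (.var 6 + .var 5)).ops +
  ((Expr.var 3 + 1 - .var 6).compile numVars).ops + 1)

/-- The cost of the search in elementary instructions, for `M` arcs with `n` combinations each: for
each arc, `O(1 + L)` rounds of lattice reduction, and `O(1)` instructions for each combination. -/
theorem cost_le {p L M n : ℕ} (hp : p ≤ L) (hM : 1 ≤ M) :
    costSetup p + (M + 1) * (costArc L + n * costEnum + (assign 6 (.var 6 + .var 5)).ops +
      ((Expr.var 3 + 1 - .var 6).compile numVars).ops + 1) ≤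
      costUnit * (1 + L) * (1 + 2 * M + 2 * (M * n)) := by
  have h1 := costSetup_le p
  have h2 := costArc_le L
  have h3 : costUnit = costSetup 0 + 3 * costArc 0 + costEnum + ((assign 6 (.var 6 + .var 5)).ops +
    ((Expr.var 3 + 1 - .var 6).compile numVars).ops + 1) := rfl
  rw [show costArc L + n * costEnum + (assign 6 (.var 6 + .var 5)).ops +
      ((Expr.var 3 + 1 - .var 6).compile numVars).ops + 1 = costArc L + n * costEnum +
      ((assign 6 (.var 6 + .var 5)).ops + ((Expr.var 3 + 1 - .var 6).compile numVars).ops + 1) by ring]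
  generalize (assign 6 (.var 6 + .var 5)).ops + ((Expr.var 3 + 1 - .var 6).compile numVars).ops + 1 =
    x at *
  generalize costUnit = u at *
  have h4 : (p + 1) * costSetup 0 ≤ (1 + L) * u := Nat.mul_le_mul (by omega) (by omega)
  have h5 : costArc L + n * costEnum + x ≤ u * (1 + L) * (1 + n) := by
    have k1 : n * costEnum ≤ n * u * (1 + L) := by
      calc n * costEnum ≤ n * u := Nat.mul_le_mul_left _ (by omega)
        _ ≤ _ := Nat.le_mul_of_pos_right _ (by omega)
    have k2 : x ≤ x * (1 + L) := Nat.le_mul_of_pos_right _ (by omega)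
    have k3 : (L + 1) * (3 * costArc 0) + x * (1 + L) ≤ u * (1 + L) := by
      rw [mul_comm, add_comm L, ← add_mul]
      exact Nat.mul_le_mul_right _ (by omega)
    linarith [(by ring : u * (1 + L) * (1 + n) = u * (1 + L) + n * u * (1 + L))]
  calc _ ≤ (1 + L) * u + 2 * M * (u * (1 + L) * (1 + n)) :=
        Nat.add_le_add (h1.trans h4) (Nat.mul_le_mul (by omega) h5)
    _ = _ := by ring

/-- The common form of all bounds: a numerical factor, a power of `B`, and a power of the factor
`G B` that relates the number of digits to `1 + log N`. -/
theorem mul_pow_le {C c G B i j k : ℕ} (hB : 1 ≤ B) (hc : c ≤ C) (hG : G ≤ C) (hC : 1 ≤ C)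
    (hij : i + j ≤ k) (hj : j + 1 ≤ k) : c * B ^ i * (G * B) ^ j ≤ (C * B) ^ k :=
  calc c * B ^ i * (G * B) ^ j = c * G ^ j * B ^ (i + j) := by ring
    _ ≤ C * C ^ j * B ^ (i + j) := by gcongr
    _ = C ^ (j + 1) * B ^ (i + j) := by ring
    _ ≤ C ^ k * B ^ k := by gcongr
    _ = _ := (mul_pow _ _ _).symm

theorem mul_pow_le_real {C c G B i j k : ℕ} (hB : 1 ≤ B) (hc : c ≤ C) (hG : G ≤ C) (hC : 1 ≤ C)
    (hij : i + j ≤ k) (hj : j + 1 ≤ k) :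
    (c : ℝ) * (B : ℝ) ^ i * ((G : ℝ) * B) ^ j ≤ (((C * B) ^ k : ℕ) : ℝ) := by
  exact_mod_cast mul_pow_le hB hc hG hC hij hj

theorem primrec_pow_bound (C k : ℕ) : Primrec₂ fun B e : ℕ => (C * B) ^ (e + k) := by
  have hpow : Primrec₂ ((· ^ ·) : ℕ → ℕ → ℕ) := Primrec₂.unpaired'.1 Nat.Primrec.pow
  exact hpow.comp (Primrec.nat_mul.comp (Primrec.const C) Primrec.fst)
    (Primrec.nat_add.comp Primrec.snd (Primrec.const k))

/-- The parameters are polynomial in `B` and `N`, and `log B ≤ B` absorbs the dependence on `B`. -/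
theorem digits_le_log {B : ℕ} {N : ℝ} {H : ℤ} {S Y : ℕ} (hB : 1 ≤ B) (hN : 1 < N) (hS : 1 ≤ S)
    (hH : (H : ℝ) ≤ 339 * B ^ 2 * N) (hH0 : 0 ≤ H) (hY1 : 1 ≤ Y) (hY : (Y : ℤ) = 100 * B * H ^ 2) :
    (1 : ℝ) + (S ^ 7 * Y.size + 1 : ℕ) ≤ (50000000 * S ^ 7 : ℕ) * B * (1 + Real.log N) := by
  have hB' : (1 : ℝ) ≤ B := by exact_mod_cast hB
  have hS' : (1 : ℝ) ≤ (S : ℝ) ^ 7 := one_le_pow₀ (by exact_mod_cast hS)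
  have hlog : 0 ≤ Real.log N := Real.log_nonneg hN.le
  have h1 : (Y : ℝ) ≤ 11492100 * B ^ 5 * N ^ 2 := by
    have e : (Y : ℝ) = 100 * B * (H : ℝ) ^ 2 := by exact_mod_cast hY
    have hH0' : (0 : ℝ) ≤ H := by exact_mod_cast hH0
    rw [e]
    calc 100 * (B : ℝ) * (H : ℝ) ^ 2 ≤ 100 * B * (339 * B ^ 2 * N) ^ 2 := by gcongr
      _ = _ := by ring
  have hY0 : (0 : ℝ) < Y := by exact_mod_cast hY1
  have h2 : Real.log Y ≤ 11492100 + 5 * B + 2 * Real.log N := by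
    have h3 := Real.log_le_log hY0 h1
    rw [Real.log_mul (by positivity) (by positivity), Real.log_mul (by positivity) (by positivity),
      Real.log_pow, Real.log_pow] at h3
    have h4 := Real.log_le_sub_one_of_pos (x := 11492100) (by norm_num)
    have h5 := Real.log_le_sub_one_of_pos (x := (B : ℝ)) (by positivity)
    push_cast at h3
    linarith
  have h6 := size_le_log hY1
  have h7 : (Y.size : ℝ) ≤ 40000000 * B * (1 + Real.log N) := by
    have k1 : Real.log N ≤ B * Real.log N := le_mul_of_one_le_left hlog hB'
    have k2 : 0 ≤ B * Real.log N := by positivity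
    linarith [(by ring : 40000000 * (B : ℝ) * (1 + Real.log N) =
      40000000 * B + 40000000 * (B * Real.log N))]
  have h8 : 1 ≤ (B : ℝ) * (1 + Real.log N) := by nlinarith
  have h9 := mul_le_mul_of_nonneg_left h7 (by positivity : 0 ≤ (S : ℝ) ^ 7)
  have h10 : 1 ≤ (S : ℝ) ^ 7 * (B * (1 + Real.log N)) := one_le_mul_of_one_le_of_one_le hS' h8
  push_cast
  linarith

end NearCurve

namespace NearCurve
open V3

/-! ### The complexity of the search -/

/-- The base of the constants: it exceeds all numerical factors in the bounds. -/
def constBase (S : ℕ) : ℕ := 100000000000000 * (costUnit * (50000000 * S ^ 7) * (numVars + S + 3))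

/-- The three kinds of factors that occur in the bounds. -/
theorem le_constBase {S c : ℕ} (hS : 1 ≤ S)
    (hc : c ≤ 100000000000000 * costUnit ∨ c ≤ 50000000 * S ^ 7 ∨ c ≤ numVars + S + 3) :
    c ≤ constBase S := by
  have h1 : 1 ≤ costUnit := by simp only [costUnit]; omega
  have h2 : 1 ≤ 50000000 * S ^ 7 := Nat.mul_pos (by norm_num) (by positivity)
  have h3 : 1 ≤ numVars + S + 3 := by omega
  simp only [constBase]
  generalize 50000000 * S ^ 7 = x at *
  generalize numVars + S + 3 = y at *
  generalize costUnit = u at *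
  have k1 : u ≤ u * x * y := by
    rw [mul_assoc]; exact Nat.le_mul_of_pos_right _ (Nat.mul_pos h2 h3)
  have k2 : x ≤ u * x * y := by
    rw [mul_comm u, mul_assoc]; exact Nat.le_mul_of_pos_right _ (Nat.mul_pos h1 h3)
  have k3 : y ≤ u * x * y := Nat.le_mul_of_pos_left _ (Nat.mul_pos h1 h2)
  omega

/-- Points and time are governed by the number of arcs times the number of combinations on an arc,
which is `O(δ N³)`; the number of arcs itself is `O(N)`, and `N ≤ δ N³`. -/
theorem search_spec {S : ℕ} (hS : 10000 ≤ S) {B e : ℕ} {φ : unitInterval → RP2} {F dF ddF : ℝ → E3}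
    (hF : BoundedLift φ F dF ddF B) {N δ : ℝ} (hN : 1 < N) (hδ : 1 / N ^ 2 ≤ δ) {A : Answers}
    (hA : A.Correct F dF N δ) {K : ℕ} (hK : K = (constBase S * B) ^ (e + 20)) :
    ∃ (τ : Store) (out : List Record) (time space : ℕ),
      Runs A (fun p => B * (p + 1) ^ e) searchProgram (Finsupp.single 0 (B : ℤ)) τ out time space ∧
      (∀ R ∈ out, R.Valid) ∧
      (out.countP Record.isPoint : ℝ) ≤ K * (δ * N ^ 3) ∧
      (out.countP Record.isSegment : ℝ) ≤ K * N ∧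
      (∀ R ∈ out, R.length ≤ K / N) ∧
      (∀ x : QP2, x.mulHeight ≤ N →
        (∃ y ∈ Set.range φ, projDist (toReal x) y ≤ δ) → ∃ R ∈ out, toReal x ∈ R.carrier) ∧
      (time : ℝ) ≤ K * (δ * N ^ 3) * (1 + Real.log N) ^ (e + 3) ∧
      (space : ℝ) ≤ K * (1 + Real.log N) ^ (e + 3) ∧
      ((out.map Record.bits).sum : ℝ) ≤ K * (δ * N ^ 3) * (1 + Real.log N) := by
  have hB : 1 ≤ B := by
    by_contra hc
    have hB0 : B = 0 := by omega
    have := hF.le_norm 0 ⟨le_rfl, zero_le_one⟩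
    simp [hB0] at this
    linarith
  have hS1 : 1 ≤ S := by omega
  obtain ⟨a, H, p, d, st, hpar, D, hP, hst, hPst, haH, hHN, hdδ⟩ := exists_parameters hA hB hN hδ
  have hH := D.H_pos'
  have hd := D.d_pos
  have hd4 := D.d_le
  have hst0 : 0 < st := by have := D.le_s; omega
  have hB' : (1 : ℤ) ≤ B := by exact_mod_cast hB
  have hHsq : H ≤ H ^ 2 := by nlinarith
  have hBH : H ^ 2 ≤ B * H ^ 2 := le_mul_of_one_le_left (by positivity) hB'
  have hBBH : (B : ℤ) ≤ B * H ^ 2 := le_mul_of_one_le_right (by positivity) (by nlinarith)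
  obtain ⟨Y, hYH⟩ : ∃ Y : ℕ, (Y : ℤ) = 100 * B * H ^ 2 :=
    ⟨(100 * B * H ^ 2).toNat, Int.toNat_of_nonneg (by positivity)⟩
  have hYBH : (Y : ℤ) = 100 * (B * H ^ 2) := by rw [hYH]; ring
  have hY2 : 2 ≤ Y := by
    have : (2 : ℤ) ≤ Y := by linarith
    exact_mod_cast this
  have hBY : B ≤ Y := by
    have : (B : ℤ) ≤ Y := by linarith
    exact_mod_cast this
  obtain ⟨m, hm⟩ : ∃ m, m = searchBudget A B e hS1 hY2 := ⟨_, rfl⟩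
  have hsc : Scale m Y := by rw [hm]; exact scale_searchBudget hS1 hY2 hS
  have hmA : m.A = A := by rw [hm]; rfl
  have hmc : m.c = fun p => B * (p + 1) ^ e := by rw [hm]; rfl
  have hX : ∀ z : ℤ, 0 ≤ z → z ≤ Y → |z| ≤ m.X := fun z h0 hz => by
    refine hsc.abs_le (i := 0) (by omega) ?_
    rw [abs_of_nonneg h0]
    simpa [lev] using hz
  have hXd : m.X.size ≤ m.digits := Nat.size_le_size (Nat.le_self_pow (by have := m.one_le; omega) _)
  have hP1 : (1 : ℤ) ≤ 2 ^ p := one_le_pow₀ (by norm_num)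
  have hpd : p ≤ m.digits := by
    have h1 := m.lt_two_pow_digits (hX (2 ^ p) (by positivity) (by linarith))
    exact ((pow_lt_pow_iff_right₀ (by norm_num : (1 : ℤ) < 2)).1 h1).le
  have ha0 : |a| ≤ m.X := by
    refine haH.trans ((le_abs_self H).trans (hX H (by omega) (by linarith)))
  -- All parameters are at most `Y`, so that every part of the program fits into the budget.
  have hset := ev_setup (m := m) (s := fun x => Finsupp.single 0 (B : ℤ) x) (b := B) hsc (by simp)
    (by simp) (by simp) (by rw [hmA]; exact hpar.ha) ha0 hpar.hH (hX H (by omega) (by linarith))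
    hpar.hp (by rw [← abs_of_nonneg (by positivity : (0 : ℤ) ≤ 2 ^ p)]
                exact hX _ (by positivity) (by linarith)) hpd
    (by rw [hmA]; exact hpar.hd) (hX _ (by omega) (by linarith)) (hX _ (by omega) (by linarith))
    hpar.hst (hX _ (by omega) (by linarith))
  have hrun := Budget.Ev.seq (Q' := fun _ o =>
    Output m.X (160 * (B : ℝ) ^ 2 / H) (arcs (2 ^ p) st * (4 * arcCount B H (2 ^ p) d st))
      (arcs (2 ^ p) st * 1) o ∧
    ∀ i < arcs (2 ^ p) st, ∀ w, NearArc φ N δ (2 ^ p) st (i * st) w → Contains o w) hset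
    fun t o h => by
      obtain ⟨rfl, ht⟩ := h
      exact ev_search hsc hF (by rw [hmA]; exact hA) D ⟨hYH.ge, hP, hst⟩ hpd ht
  obtain ⟨τ, t, out, time, space, hr, -, ⟨hout, hcov⟩, htime, hspace⟩ :=
    hrun (Finsupp.single 0 (B : ℤ)) (by rw [hm]; exact holds_single hS1 hY2 hBY)
  rw [hmA, hmc] at hr
  refine ⟨τ, out, time, space, hr, hout.valid, ?_⟩
  -- The bounds depend on the run only through the numbers `M` of arcs and `n` of combinations.
  obtain ⟨M, hM⟩ : ∃ M, M = arcs (2 ^ p) st := ⟨_, rfl⟩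
  obtain ⟨n, hn⟩ : ∃ n, n = arcCount B H (2 ^ p) d st := ⟨_, rfl⟩
  have hM1 : 1 ≤ M := by rw [hM, arcs]; omega
  have hM2 := arcs_le (H := H) (P := 2 ^ p) (by positivity) hst0 (by omega) hPst
  have hMn := arcs_mul_arcCount_le (B := B) (H := H) (P := 2 ^ p) (by positivity) hd hst0 (by omega) hst
    (by push_cast; exact hdδ)
  rw [← hM] at hM2 hcov hout
  rw [← hM, ← hn] at hMn
  rw [← hn] at hout
  have htime' := htime.trans (Nat.mul_le_mul_right _ (cost_le hpd (hM ▸ hM1)))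
  rw [← hM, ← hn] at htime'
  have hG1 : 1 ≤ constBase S := le_constBase hS1 (Or.inr (Or.inr (by omega)))
  have hG := le_constBase (c := 50000000 * S ^ 7) hS1 (Or.inr (Or.inl le_rfl))
  have hu1 : 1 ≤ costUnit := by simp only [costUnit]; omega
  have hbound : ∀ {c i j : ℕ}, c ≤ 100000000000000 * costUnit ∨ c ≤ 50000000 * S ^ 7 ∨
      c ≤ numVars + S + 3 → i + j ≤ e + 20 → j + 1 ≤ e + 20 →
      (c : ℝ) * (B : ℝ) ^ i * (((50000000 * S ^ 7 : ℕ) : ℝ) * B) ^ j ≤ (K : ℝ) := by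
    intro c i j hc hij hj
    rw [hK]
    exact mul_pow_le_real hB (le_constBase hS1 hc) hG hG1 hij hj
  have hdig : (1 : ℝ) + m.digits ≤ (50000000 * S ^ 7 : ℕ) * B * (1 + Real.log N) := by
    refine le_trans ?_ (digits_le_log hB hN hS1 hHN (by omega) (by omega) hYH)
    have : m.digits ≤ S ^ 7 * Y.size + 1 := by rw [hm]; exact digits_searchBudget_le hS1 hY2
    have : (m.digits : ℝ) ≤ (S ^ 7 * Y.size + 1 : ℕ) := by exact_mod_cast this
    linarith
  have hU : (m.U : ℝ) ≤ 9 * B * (1 + m.digits) ^ (e + 2) := by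
    have : m.U ≤ 9 * B * (1 + m.digits) ^ (e + 2) := by
      rw [hm]; exact searchBudget_U_le hS1 hY2 hB
    exact_mod_cast this
  have hMsp : (m.M : ℝ) ≤ (numVars + S + 3 : ℕ) * B * (1 + m.digits) ^ (e + 1) := by
    have : m.M ≤ (numVars + S + 3) * B * (1 + m.digits) ^ (e + 1) := by
      rw [hm]; exact searchBudget_M_le hS1 hY2 hB
    exact_mod_cast this
  obtain ⟨g, hg⟩ : ∃ g : ℝ, g = ((50000000 * S ^ 7 : ℕ) : ℝ) * B := ⟨_, rfl⟩
  obtain ⟨lam, hlam⟩ : ∃ l : ℝ, l = 1 + Real.log N := ⟨_, rfl⟩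
  rw [← hg] at hdig
  simp only [← hg] at hbound
  rw [← hlam] at hdig ⊢
  have hlam1 : 1 ≤ lam := by rw [hlam]; linarith [Real.log_nonneg hN.le]
  have hg0 : 0 ≤ g := by rw [hg]; positivity
  have hBR : (1 : ℝ) ≤ B := by exact_mod_cast hB
  obtain ⟨Q, hQ⟩ : ∃ Q, Q = δ * N ^ 3 := ⟨_, rfl⟩
  have hNpos : 0 < N := by linarith
  have hQN : N ≤ Q := by
    rw [hQ]
    calc N = 1 / N ^ 2 * N ^ 3 := by field_simp
      _ ≤ δ * N ^ 3 := by gcongr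
  rw [← hQ]
  have hQ1 : 1 ≤ Q := by linarith
  have hH' : (0 : ℝ) ≤ H := by exact_mod_cast (by omega : (0 : ℤ) ≤ H)
  have hδ0 : 0 ≤ δ := le_trans (by positivity) hδ
  have hMn' : (M * n : ℝ) ≤ 720000000000 * B ^ 8 * Q := by
    refine hMn.trans ?_
    calc 18432 * (H : ℝ) ^ 3 * B ^ 2 * δ ≤ 18432 * (339 * B ^ 2 * N) ^ 3 * B ^ 2 * δ := by gcongr
      _ = 18432 * 339 ^ 3 * (B ^ 8 * Q) := by rw [hQ]; ring
      _ ≤ 720000000000 * (B ^ 8 * Q) := by gcongr; norm_num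
      _ = _ := by ring
  have hM' : (M : ℝ) ≤ 678 * B ^ 2 * N := by
    have : (M : ℝ) ≤ 2 * H := by exact_mod_cast hM2
    linarith
  have hB28 : (B : ℝ) ^ 2 ≤ (B : ℝ) ^ 8 := pow_le_pow_right₀ hBR (by norm_num)
  have hMQ : (M : ℝ) ≤ 678 * B ^ 8 * Q := hM'.trans (by gcongr)
  have hBQ : 1 ≤ (B : ℝ) ^ 8 * Q := one_le_mul_of_one_le_of_one_le (one_le_pow₀ hBR) hQ1
  refine ⟨?_, ?_, ?_, ?_, ?_, ?_, ?_⟩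
  · have h1 : (out.countP Record.isPoint : ℝ) ≤ M * (4 * n) := by exact_mod_cast hout.points
    have h2 := hbound (c := 10000000000000) (i := 8) (j := 0) (Or.inl (by omega)) (by omega) (by omega)
    rw [pow_zero, mul_one] at h2
    push_cast at h2
    calc (out.countP Record.isPoint : ℝ) ≤ 10000000000000 * (B : ℝ) ^ 8 * Q := by linarith
      _ ≤ K * Q := by gcongr
  · have h1 : (out.countP Record.isSegment : ℝ) ≤ M := by
      have := hout.segments
      rw [mul_one] at this
      exact_mod_cast this
    have h2 := hbound (c := 678) (i := 2) (j := 0) (Or.inl (by omega)) (by omega) (by omega)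
    rw [pow_zero, mul_one] at h2
    push_cast at h2
    exact h1.trans (hM'.trans (by gcongr))
  · intro R hR
    have h2 := hbound (c := 2) (i := 0) (j := 0) (Or.inl (by omega)) (by omega) (by omega)
    rw [pow_zero, pow_zero, mul_one, mul_one] at h2
    push_cast at h2
    refine (hout.length_le R hR).trans ?_
    have h3 := D.H_ge
    have h4 := D.H_pos
    rw [div_le_div_iff₀ (by linarith) hNpos]
    have h5 : 0 ≤ (B : ℝ) ^ 2 * N := by positivity
    calc 160 * (B : ℝ) ^ 2 * N ≤ 2 * H := by linarith
      _ ≤ K * H := by gcongr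
  · exact fun x hx hy => covers_of_arcs (by positivity) hst0 (hM ▸ hcov) hx hy
  · have h1 : (time : ℝ) ≤ (costUnit * (1 + m.digits) * (1 + 2 * M + 2 * (M * n))) * m.U := by
      exact_mod_cast htime'
    have h2 := hbound (c := 100000000000000 * costUnit) (i := 9) (j := e + 3) (Or.inl le_rfl)
      (by omega) (by omega)
    push_cast at h2
    calc (time : ℝ) ≤ (costUnit * (1 + m.digits) * (1 + 2 * M + 2 * (M * n))) * m.U := h1
      _ ≤ (costUnit * (1 + m.digits) * (10000000000000 * B ^ 8 * Q)) *
          (9 * B * (1 + m.digits) ^ (e + 2)) := by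
          gcongr
          linarith
      _ = 90000000000000 * costUnit * B ^ 9 * (1 + m.digits) ^ (e + 3) * Q := by ring
      _ ≤ 100000000000000 * costUnit * B ^ 9 * (g * lam) ^ (e + 3) * Q := by gcongr; norm_num
      _ = 100000000000000 * costUnit * B ^ 9 * g ^ (e + 3) * (Q * lam ^ (e + 3)) := by
          rw [mul_pow]; ring
      _ ≤ K * (Q * lam ^ (e + 3)) := by gcongr
      _ = _ := by ring
  · have h1 : (space : ℝ) ≤ m.M := by exact_mod_cast hspace
    have h2 := hbound (c := numVars + S + 3) (i := 1) (j := e + 1) (Or.inr (Or.inr le_rfl))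
      (by omega) (by omega)
    rw [pow_one] at h2
    calc (space : ℝ) ≤ (numVars + S + 3 : ℕ) * B * (1 + m.digits) ^ (e + 1) := h1.trans hMsp
      _ ≤ (numVars + S + 3 : ℕ) * B * (g * lam) ^ (e + 1) := by gcongr
      _ = (numVars + S + 3 : ℕ) * B * g ^ (e + 1) * lam ^ (e + 1) := by rw [mul_pow]; ring
      _ ≤ K * lam ^ (e + 1) := by gcongr
      _ ≤ K * lam ^ (e + 3) := by gcongr; omega
  · have h1 : (out.map Record.bits).sum ≤ (M * (4 * n) + M) * (7 * (1 + m.digits)) := by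
      have hlen : out.length ≤ M * (4 * n) + M := by
        have h3 := hout.points
        have h4 := hout.segments
        have h5 := List.length_eq_countP_add_countP Record.isPoint (l := out)
        have h6 : out.countP (fun R => decide (¬ Record.isPoint R = true)) =
            out.countP Record.isSegment := by
          refine List.countP_congr fun R _ => ?_
          cases R <;> simp [Record.isPoint, Record.isSegment]
        rw [h6] at h5
        omega
      refine (List.sum_le_card_nsmul _ (7 * (1 + m.digits)) ?_).trans ?_
      · intro b hb
        obtain ⟨R, hR, rfl⟩ := List.mem_map.1 hb
        have := hout.bits_le R hR
        omega
      · rw [List.length_map, smul_eq_mul]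
        exact Nat.mul_le_mul_right _ hlen
    have h2 : ((out.map Record.bits).sum : ℝ) ≤ (M * (4 * n) + M) * (7 * (1 + m.digits)) := by
      exact_mod_cast h1
    have h3 := hbound (c := 70000000000000) (i := 8) (j := 1) (Or.inl (by omega)) (by omega) (by omega)
    push_cast at h3
    rw [pow_one] at h3
    calc ((out.map Record.bits).sum : ℝ) ≤ (M * (4 * n) + M) * (7 * (1 + m.digits)) := h2
      _ ≤ (10000000000000 * B ^ 8 * Q) * (7 * (g * lam)) := by
          gcongr
          linarith
      _ = 70000000000000 * B ^ 8 * g * Q * lam := by ring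
      _ ≤ K * Q * lam := by gcongr

end NearCurve

/-- There are a single program and computable constants `K B e` and `k e` that serve for all curves.
The program receives `B` in register `0`, and approximations to `F`, `dF`, `N` and `δ` on request,
an approximation of precision `p` at a cost of `B * (p + 1) ^ e`. -/
theorem mainTheorem1 :
    ∃ (P : NearCurve.Program) (K : ℕ → ℕ → ℕ) (k : ℕ → ℕ), Computable₂ K ∧ Computable k ∧
      ∀ (B e : ℕ) (φ : unitInterval → NearCurve.RP2) (F dF ddF : ℝ → NearCurve.E3),
        NearCurve.BoundedLift φ F dF ddF B →
        ∀ N δ : ℝ, 1 < N → 1 / N ^ 2 ≤ δ →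
        ∀ A : NearCurve.Answers, A.Correct F dF N δ →
        ∃ (τ : NearCurve.Store) (out : List NearCurve.Record) (time space : ℕ),
          NearCurve.Runs A (fun p => B * (p + 1) ^ e) P (Finsupp.single 0 (B : ℤ)) τ out time space ∧
          -- the output consists of few rational points and few short rational segments
          (∀ R ∈ out, R.Valid) ∧
          (out.countP NearCurve.Record.isPoint : ℝ) ≤ K B e * (δ * N ^ 3) ∧
          (out.countP NearCurve.Record.isSegment : ℝ) ≤ K B e * N ∧
          (∀ R ∈ out, R.length ≤ K B e / N) ∧
          -- which together contain all the points sought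
          (∀ x : NearCurve.QP2, x.mulHeight ≤ N →
            (∃ y ∈ Set.range φ, NearCurve.projDist (NearCurve.toReal x) y ≤ δ) →
            ∃ R ∈ out, NearCurve.toReal x ∈ R.carrier) ∧
          -- time, working space, and space to record the output
          (time : ℝ) ≤ K B e * (δ * N ^ 3) * (1 + Real.log N) ^ k e ∧
          (space : ℝ) ≤ K B e * (1 + Real.log N) ^ k e ∧
          ((out.map NearCurve.Record.bits).sum : ℝ) ≤
            K B e * (δ * N ^ 3) * (1 + Real.log N) := by
  refine ⟨NearCurve.searchProgram, fun B e => (NearCurve.constBase 10000 * B) ^ (e + 20),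
    fun e => e + 3, (NearCurve.primrec_pow_bound _ 20).to_comp,
    (Primrec.nat_add.comp Primrec.id (Primrec.const 3)).to_comp, ?_⟩
  intro B e φ F dF ddF hF N δ hN hδ A hA
  exact NearCurve.search_spec le_rfl hF hN hδ hA rfl
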